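/- **Setting.** Write $\mathbb R^+=\,]0,\infty[$, $\mathbb R^+_0=[0,\infty[$, $\lambda_3$ for Lebesgue measure and $\lambda_2$ for surface measure in $\mathbb R^3$. A bounded set $A\subseteq\mathbb R^3$ is called *polyhedral* if $\overline A$ is a finite union of compact convex polytopes and $A$ contains the interior of $\overline A$ relative to its affine hull (so an open polyhedral set is the interior of a finite union of polytopes). $\vec n_A(x)$ is the outer unit normal of a polyhedral open set $A$, and $\partial_{\rm reg}A$ is the set of boundary points where it exists. A *partition* of a set $A$ is a finite family of pairwise disjoint subsets of $A$ whose closures have union $\overline A$. *Continuous data.* $T>0$; $\Omega,\Omega_{\rm s},\Omega_{\rm g}\subseteq\mathbb R^3$ are nonempty, bounded, open and polyhedral, $\Omega_{\rm s}\cap\Omega_{\rm g}=\emptyset$, $\overline\Omega=\overline\Omega_{\rm s}\cup\overline\Omega_{\rm g}$, and $\partial\Omega_{\rm s}$ is the disjoint union of $\partial\Omega$ and $\Sigma:=\partial\Omega_{\rm g}$. For $m\in\{{\rm s,g}\}$: $\varepsilon_m:\mathbb R^+_0\to\mathbb R^+_0$ is continuous, with a constant $C_\varepsilon>0$ such that $\varepsilon_m(\theta_2)\ge(\theta_2-\theta_1)C_\varepsilon+\varepsilon_m(\theta_1)$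 for $\theta_2\ge\theta_1\ge0$; $\kappa_m\ge0$; $f_m\in L^\infty(]0,T[\times\Omega_m)$, $f_m\ge0$ a.e. Further, $\sigma>0$, $\theta_{\rm ext}>0$, $\theta_{\rm init}\in L^\infty(\Omega,\mathbb R^+)$, and $\epsilon:\mathbb R^+_0\to\,]0,1]$ is locally Lipschitz: for all $r\ge0$, $$L_{\epsilon,r}:=\sup\Big\{\tfrac{|\epsilon(\theta_1)-\epsilon(\theta_2)|}{|\theta_1-\theta_2|}:\theta_1\ne\theta_2\in[0,r]\Big\}<\infty\qquad(\sup\emptyset:=0).$$ Put $\epsilon_{\min,r}:=\min_{[0,r]}\epsilon$ and let $\operatorname{var}^-\epsilon(r)$ be the negative variation of $\epsilon$ on $[0,r]$, i.e. the supremum of $\sum_k-\min\{0,\epsilon(s_k)-\epsilon(s_{k-1})\}$ over all $0=s_0<\dots<s_n=r$. Let $\operatorname{conv}(\overline\Omega)$ be the closed convex hull of $\Omega$, $O:=\operatorname{int}(\operatorname{conv}(\overline\Omega))\setminus\overline\Omega$, $\Gamma_\Omega:=\overline\Omega\cap\overline O$, $\Gamma_{\rm ph}:=\partial\operatorname{conv}(\overline\Omega)\cap\partial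 O$. *Time and space discretization.* $0=t_0<\dots<t_N=T$, $k_\nu:=t_\nu-t_{\nu-1}$. $(\omega_i)_{i\in I}$ is a partition of $\Omega$ into nonempty, polyhedral, connected, open sets; $\omega_{m,i}:=\omega_i\cap\Omega_m$, $I_m:=\{i:\omega_{m,i}\ne\emptyset\}$; $x_i\in\overline\omega_i$ are given points. Assume: - $\partial_{\rm reg}\omega_{{\rm s},i}\cap\Sigma=\partial_{\rm reg}\omega_{{\rm g},i}\cap\Sigma$ for all $i$; and $x_i\in\overline\omega_{m,i}$ for all $m$ and $i\in I_m$. - If $\lambda_2(\overline\omega_i\cap\Gamma_\Omega)\ne0$, then $x_i\in\Gamma_\Omega$; if $\lambda_2(\overline\omega_i\cap(\partial\Omega\setminus\Gamma_\Omega))\ne0$, then $x_i\in\overline{\partial\Omega\setminus\Gamma_\Omega}$. - If $i\ne j$ and $\lambda_2(\partial\omega_i\cap\partial\omega_j)\ne0$, then $x_i\ne x_j$ and $\vec n_{\omega_i}=(x_j-x_i)/\|x_i-x_j\|_2$ $\lambda_2$-a.e. on $\partial\omega_i\cap\partial\omega_j$. Let $(\zeta_\alpha)_{\alpha\in I_\Omega}$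 and $(\zeta_\alpha)_{\alpha\in I_\Sigma}$ ($I_\Omega\cap I_\Sigma=\emptyset$) be partitions of $\Gamma_\Omega$ and $\Sigma$, respectively, into nonempty, polyhedral, connected, relatively open sets, each lying in a plane. For each $\alpha\in I_\Omega$ (resp. $\alpha\in I_\Sigma$) there is a unique $i(\alpha)\in I$ with $\zeta_\alpha\subseteq\partial\omega_{i(\alpha)}\cap\Gamma_\Omega$ (resp. $\zeta_\alpha\subseteq\partial\omega_{{\rm s},i(\alpha)}\cap\Sigma$), and $x_{i(\alpha)}\in\overline\zeta_\alpha$. Put $\zeta_{\rm ph}:=\Gamma_{\rm ph}$, where ${\rm ph}\notin I_\Omega\cup I_\Sigma$, and $$\operatorname{nb}_m(i):=\{j\in I_m\setminus\{i\}:\lambda_2(\partial\omega_{m,i}\cap\partial\omega_{m,j})\ne0\},$$ $$J_{\Omega,i}:=\{\alpha\in I_\Omega:\lambda_2(\zeta_\alpha\cap\partial\omega_i)\ne0\},\qquad J_{\Sigma,i}:=\{\alpha\in I_\Sigma:\lambda_2(\zeta_\alpha\cap\partial\omega_{{\rm s},i})\ne0\}.$$ *Radiation.* For $\alpha,\beta\in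 I_\Sigma$, respectively $\alpha,\beta\in I_\Omega\cup\{{\rm ph}\}$, let $$\Lambda_{\alpha,\beta}:=\int_{\zeta_\alpha\times\zeta_\beta}\Lambda\,\omega\,d(\lambda_2\otimes\lambda_2),\qquad\omega(x,y):=\frac{\big(\vec n(y)\cdot(x-y)\big)\big(\vec n(x)\cdot(y-x)\big)}{\pi\big((y-x)\cdot(y-x)\big)^2},$$ where $\vec n$ on $\Sigma$ is the outer unit normal of $\Omega_{\rm s}$, respectively $\vec n$ on $\partial O$ is the unit normal pointing into $O$ (on $\Gamma_\Omega$ this is the outer unit normal of $\Omega_{\rm s}$), and where $\Lambda(x,y)=1$ if $x$ and $y$ are mutually visible through $V:=\Omega_{\rm g}$, respectively $V:=O$, i.e. if the open segment $]x,y[$ lies in $V$, and $\Lambda(x,y)=0$ otherwise. For a vector $u\ge0$ indexed by $I_\Omega$, respectively $I_\Sigma$, define $$G_{\alpha,\beta}(u):=\lambda_2(\zeta_\alpha)\delta_{\alpha\beta}-(1-\epsilon(u_\alpha))\Lambda_{\alpha,\beta},\qquad E_\alpha(u):=\sigma\epsilon(u_\alpha)u_\alpha^4\lambda_2(\zeta_\alpha),\qquad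 E_{{\rm ph},\alpha}(u):=\sigma(1-\epsilon(u_\alpha))\theta_{\rm ext}^4\Lambda_{\alpha,{\rm ph}},$$ $$R_\Gamma(u):=G(u)^{-1}(E(u)+E_{\rm ph}(u)),\qquad V_{\Gamma,\alpha}(u):=\epsilon(u_\alpha)\sum_{\beta\in I_\Omega}R_{\Gamma,\beta}(u)\Lambda_{\alpha,\beta}+\sigma\epsilon(u_\alpha)\theta_{\rm ext}^4\Lambda_{\alpha,{\rm ph}},$$ $$R_\Sigma(u):=G(u)^{-1}E(u),\qquad V_{\Sigma,\alpha}(u):=\epsilon(u_\alpha)\sum_{\beta\in I_\Sigma}R_{\Sigma,\beta}(u)\Lambda_{\alpha,\beta}.$$ *Scheme.* Let $f_{m,\nu,i}$, $\theta_{{\rm init},i}$ be real numbers with $$0\le\operatorname{ess\,inf}(f_m|_{]t_{\nu-1},t_\nu[\times\omega_{m,i}})\le f_{m,\nu,i}\le\|f_m\|_{L^\infty(]t_{\nu-1},t_\nu[\times\omega_{m,i})}\quad(\nu\in\{1,\dots,N\},\ i\in I_m),$$ $$0\le\operatorname{ess\,inf}(\theta_{\rm init}|_{\omega_i})\le\theta_{{\rm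 init},i}\le\|\theta_{\rm init}\|_{L^\infty(\omega_i)}\quad(i\in I).$$ A *nonnegative solution* of the scheme is a family $(u_0,\dots,u_N)$, $u_\nu\in(\mathbb R^+_0)^I$, with $u_{0,i}=\theta_{{\rm init},i}$ and $\mathcal H_{\nu,i}(u_{\nu-1},u_\nu)=0$ for all $i\in I$, $\nu\in\{1,\dots,N\}$, where $$\begin{aligned}\mathcal H_{\nu,i}(\tilde u,u)={}&k_\nu^{-1}\sum_m(\varepsilon_m(u_i)-\varepsilon_m(\tilde u_i))\lambda_3(\omega_{m,i})-\sum_m\kappa_m\sum_{j\in\operatorname{nb}_m(i)}\frac{u_j-u_i}{\|x_i-x_j\|_2}\lambda_2(\partial\omega_{m,i}\cap\partial\omega_{m,j})\\&+\sigma\epsilon(u_i)u_i^4\lambda_2(\partial\omega_{{\rm s},i}\cap\Gamma_\Omega)-\sum_{\alpha\in J_{\Omega,i}}V_{\Gamma,\alpha}\big((u_{i(\beta)})_{\beta\in I_\Omega}\big)\\&+\sigma\epsilon(u_i)(u_i^4-\theta_{\rm ext}^4)\lambda_2(\partial\omega_{{\rm s},i}\cap(\partial\Omega\setminus\Gamma_\Omega))\\&+\sigma\epsilon(u_i)u_i^4\lambda_2(\omega_i\cap\Sigma)-\sum_{\alpha\in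 J_{\Sigma,i}}V_{\Sigma,\alpha}\big((u_{i(\beta)})_{\beta\in I_\Sigma}\big)-\sum_mf_{m,\nu,i}\lambda_3(\omega_{m,i}).\end{aligned}$$ *Constants.* Let $$L_1:=\sigma\max_i\frac{\lambda_2(\partial\omega_{{\rm s},i}\cap\Gamma_\Omega)}{\lambda_3(\omega_i)},\quad L_2:=\sigma\max_i\frac{\lambda_2(\partial\omega_{{\rm s},i}\cap(\partial\Omega\setminus\Gamma_\Omega))}{\lambda_3(\omega_i)},\quad L_3:=\sigma\max_i\frac{\lambda_2(\omega_i\cap\Sigma)}{\lambda_3(\omega_i)},$$ $$l^1(r):=4\operatorname{var}^-\epsilon(r)\,r^3+L_{\epsilon,r}r^4,\quad l^2(r):=4\epsilon_{\min,r}^{-1}r^3+\max\{r^4,\theta_{\rm ext}^4\}L_{\epsilon,r}(2\epsilon_{\min,r}^{-1}+1),\quad l^3(r):=L_{\epsilon,r}\theta_{\rm ext}^4,$$ $$\Phi(r):=(L_1+L_2+L_3)\,l^1(r)+(L_1+L_3)\,l^2(r)+L_2\,l^3(r),$$ $$m:=\min\{\theta_{\rm ext},\operatorname{ess\,inf}\theta_{\rm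 init}\},\qquad M_\nu:=\max\{\theta_{\rm ext},\|\theta_{\rm init}\|_{L^\infty(\Omega)}\}+\frac{t_\nu}{C_\varepsilon}\sum_{m\in\{{\rm s,g}\}}\|f_m\|_{L^\infty(]0,t_\nu[\times\Omega_m)}.$$ **Corollary 4.4.** Under these assumptions: 1. Every nonnegative solution $(u_0,\dots,u_N)$ of the scheme satisfies $u_\nu\in[m,M_\nu]^I$ for each $\nu\in\{0,\dots,N\}$. 2. If $k_\nu\,\Phi(M_\nu)<C_\varepsilon$ for each $\nu\in\{1,\dots,N\}$, then the scheme has a unique nonnegative solution. 3. The condition in 2 is satisfied if $\max\{k_\nu:\nu\in\{1,\dots,N\}\}\,\Phi(M_N)<C_\varepsilon$. -/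

import Mathlib

open Set MeasureTheory
open scoped MeasureTheory ENNReal

noncomputable section

namespace HeatFV

/-! ### Geometry -/

/-- Euclidean three-space. -/
abbrev E3 : Type := EuclideanSpace ℝ (Fin 3)

/-- Three-dimensional Lebesgue measure, as a real number. -/
def vol (A : Set E3) : ℝ := (volume : Measure E3).real A

/-- The surface measure: the two-dimensional Hausdorff measure, normalized such that it agrees
with Lebesgue measure on every plane. -/
def surf : Measure E3 := μHE[2]

/-- Surface area, as a real number. -/
def area (A : Set E3) : ℝ := surf.real A

/-- A (bounded) polyhedral set: its closure is a finite union of compact convex polytopes, and it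
contains the interior of its closure relative to its affine hull. An open set is polyhedral in
this sense if and only if it is the interior of a finite union of compact convex polytopes. -/
def IsPolyhedral (A : Set E3) : Prop :=
  (∃ F : Finset (Finset E3), closure A = ⋃ t ∈ F, convexHull ℝ (t : Set E3)) ∧
    intrinsicInterior ℝ (closure A) ⊆ A

/-- A family of (relatively) open subsets of `A` forms a partition of `A`: the members are
pairwise disjoint and their closures cover exactly the closure of `A`. -/
def IsPartition {ι : Type*} (A : Set E3) (p : ι → Set E3) : Prop :=
  (∀ i, p i ⊆ A) ∧ (∀ i j, i ≠ j → Disjoint (p i) (p j)) ∧ ⋃ i, closure (p i) = closure A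

/-- `n` is the outer unit normal at `x` to the open polyhedral set `A`: near `x`, the set `A` is
the open half-space on the side opposite to `n`. -/
def IsOuterNormal (A : Set E3) (x n : E3) : Prop :=
  ‖n‖ = 1 ∧ ∃ r > 0, ∀ y ∈ Metric.ball x r, (y ∈ A ↔ inner ℝ n (y - x) < 0)

/-- The regular boundary: the points at which the outer unit normal exists. -/
def regBoundary (A : Set E3) : Set E3 := {x | ∃ n, IsOuterNormal A x n}

open Classical in
/-- The outer unit normal field (zero off the regular boundary). -/
def outerNormal (A : Set E3) (x : E3) : E3 :=
  if h : ∃ n, IsOuterNormal A x n then h.choose else 0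

/-! ### Radiation between surface points -/

/-- The view factor `ω(x,y)`, for a unit normal field `n`. -/
def viewFactor (n : E3 → E3) (x y : E3) : ℝ :=
  (inner ℝ (n y) (x - y) * inner ℝ (n x) (y - x)) /
    (Real.pi * (inner ℝ (y - x) (y - x)) ^ 2)

open Classical in
/-- The visibility factor `Λ(x,y)` for points on the boundary of the transparent open set `V`:
it is one if `x` and `y` see each other through `V`, and zero otherwise. -/
def visibility (V : Set E3) (x y : E3) : ℝ := if openSegment ℝ x y ⊆ V then 1 else 0

/-- The integral of `Λ ω` over `A × B`. -/
def exchange (V : Set E3) (n : E3 → E3) (A B : Set E3) : ℝ :=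
  ∫ p, visibility V p.1 p.2 * viewFactor n p.1 p.2 ∂((surf.restrict A).prod (surf.restrict B))

/-! ### Emissivity -/

/-- The difference quotients of `e` on `[0, r]`. -/
def diffQuotients (e : ℝ → ℝ) (r : ℝ) : Set ℝ :=
  {q | ∃ a ∈ Icc 0 r, ∃ b ∈ Icc 0 r, a ≠ b ∧ q = |e a - e b| / |a - b|}

/-- The Lipschitz constant `L_{e,r}` of `e` on `[0, r]`. -/
def lipConst (e : ℝ → ℝ) (r : ℝ) : ℝ := sSup (diffQuotients e r)

/-- The minimum of `e` on `[0, r]`. -/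
def minOn (e : ℝ → ℝ) (r : ℝ) : ℝ := sInf (e '' Icc 0 r)

/-- The negative variation of `e` on `[0, r]`, i.e. the supremum of
`∑ -min {0, e (s (k+1)) - e (s k)}` over all discretizations `0 = s 0 < ... < s n = r`. -/
def negVar (e : ℝ → ℝ) (r : ℝ) : ℝ :=
  sSup {v | ∃ (n : ℕ) (s : Fin (n + 1) → ℝ), StrictMono s ∧ s 0 = 0 ∧ s (Fin.last n) = r ∧
    v = ∑ k : Fin n, -min 0 (e (s k.succ) - e (s k.castSucc))}

/-! ### The continuous problem -/

/-- The two parts of the domain: solid and gas. -/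
inductive Phase : Type
  | solid
  | gas

/-- The data of the transient conductive-radiative heat transport problem, with the standing
assumptions on them. -/
structure Problem where
  /-- final time -/
  T : ℝ
  T_pos : 0 < T
  /-- the space domain -/
  Om : Set E3
  /-- the solid domain and the gas domain -/
  dom : Phase → Set E3
  Om_nonempty : Om.Nonempty
  Om_open : IsOpen Om
  Om_bounded : Bornology.IsBounded Om
  Om_polyhedral : IsPolyhedral Om
  dom_nonempty : ∀ m, (dom m).Nonempty
  dom_open : ∀ m, IsOpen (dom m)
  dom_bounded : ∀ m, Bornology.IsBounded (dom m)
  dom_polyhedral : ∀ m, IsPolyhedral (dom m)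
  dom_disjoint : Disjoint (dom .solid) (dom .gas)
  closure_Om : closure Om = closure (dom .solid) ∪ closure (dom .gas)
  /-- the gas is enclosed by the solid -/
  frontier_solid : frontier (dom .solid) = frontier Om ∪ frontier (dom .gas)
  frontier_disjoint : Disjoint (frontier Om) (frontier (dom .gas))
  /-- internal energy of solid and gas -/
  en : Phase → ℝ → ℝ
  en_continuous : ∀ m, ContinuousOn (en m) (Ici 0)
  en_nonneg : ∀ m, ∀ θ, 0 ≤ θ → 0 ≤ en m θ
  /-- growth constant of the internal energies -/
  C : ℝ
  C_pos : 0 < C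
  en_growth : ∀ m, ∀ θ₁ θ₂, 0 ≤ θ₁ → θ₁ ≤ θ₂ → (θ₂ - θ₁) * C + en m θ₁ ≤ en m θ₂
  /-- thermal conductivities -/
  kap : Phase → ℝ
  kap_nonneg : ∀ m, 0 ≤ kap m
  /-- heat sources -/
  f : Phase → ℝ × E3 → ℝ
  f_memLp : ∀ m, MemLp (f m) ∞ (volume.restrict (Ioo 0 T ×ˢ dom m))
  f_nonneg : ∀ m, ∀ᵐ p ∂(volume.restrict (Ioo 0 T ×ˢ dom m)), 0 ≤ f m p
  /-- the Boltzmann radiation constant -/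
  sig : ℝ
  sig_pos : 0 < sig
  /-- the emissivity -/
  em : ℝ → ℝ
  em_mem : ∀ θ, 0 ≤ θ → em θ ∈ Ioc 0 1
  em_lipschitz : ∀ r, 0 ≤ r → BddAbove (diffQuotients em r)
  /-- the external temperature -/
  ext : ℝ
  ext_pos : 0 < ext
  /-- the initial temperature -/
  init : E3 → ℝ
  init_memLp : MemLp init ∞ (volume.restrict Om)
  init_pos : ∀ᵐ x ∂(volume.restrict Om), 0 < init x

namespace Problem

variable (P : Problem)

/-- The interface `Σ` between solid and gas. -/
def Sig : Set E3 := frontier (P.dom .gas)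

/-- The closed convex hull of the domain. -/
def hull : Set E3 := closure (convexHull ℝ P.Om)

/-- The open radiation region `O`. -/
def cav : Set E3 := interior P.hull \ closure P.Om

/-- `Γ_Ω`, the part of the boundary of the open radiation region that belongs to the solid. -/
def GamOm : Set E3 := closure P.Om ∩ closure P.cav

/-- `Γ_ph`, the phantom closure of the open radiation region. -/
def GamPh : Set E3 := frontier P.hull ∩ frontier P.cav

/-- The radiation exchange coefficients of the closed cavities: radiation travels through the gas,
and the normal on `Σ` is the outer unit normal of the solid. -/
def exchangeSig (A B : Set E3) : ℝ := exchange (P.dom .gas) (outerNormal (P.dom .solid)) A B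

/-- The radiation exchange coefficients of the open cavities: radiation travels through the open
radiation region, and the normal on its boundary points into this region; on `Γ_Ω` it is the outer
unit normal of the solid. -/
def exchangeGam (A B : Set E3) : ℝ := exchange P.cav (fun x => -outerNormal P.cav x) A B

/-- The coefficient function `l_g^1`. -/
def lg1 (r : ℝ) : ℝ := 4 * negVar P.em r * r ^ 3 + lipConst P.em r * r ^ 4

/-- The coefficient function `l_g^2`. -/
def lg2 (r : ℝ) : ℝ :=
  4 * (minOn P.em r)⁻¹ * r ^ 3 +
    max (r ^ 4) (P.ext ^ 4) * lipConst P.em r * (2 * (minOn P.em r)⁻¹ + 1)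

/-- The coefficient function `l_g^3`. -/
def lg3 (r : ℝ) : ℝ := lipConst P.em r * P.ext ^ 4

/-- The lower bound `m`. -/
def lower : ℝ := min P.ext (essInf P.init (volume.restrict P.Om))

/-- The norm of the heat source `f_m` in `L^∞(]a,b[ × A)`. -/
def fNorm (m : Phase) (a b : ℝ) (A : Set E3) : ℝ :=
  (eLpNorm (P.f m) ∞ (volume.restrict (Ioo a b ×ˢ A))).toReal

/-- The norm of the initial temperature in `L^∞(A)`. -/
def initNorm (A : Set E3) : ℝ := (eLpNorm P.init ∞ (volume.restrict A)).toReal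

/-- The upper bound at time `s`. -/
def upper (s : ℝ) : ℝ :=
  max P.ext (P.initNorm P.Om) +
    s / P.C * (P.fNorm .solid 0 s (P.dom .solid) + P.fNorm .gas 0 s (P.dom .gas))

end Problem

/-! ### Discretization of time and space -/

/-- A discretization `0 = t 0 < ... < t N = T` of the time interval. -/
structure TimeGrid (T : ℝ) (N : ℕ) where
  t : Fin (N + 1) → ℝ
  strictMono : StrictMono t
  t_zero : t 0 = 0
  t_last : t (Fin.last N) = T

/-- The time steps. The index `ν : Fin N` stands for the step from `t ν.castSucc` to
`t ν.succ`. -/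
def TimeGrid.k {T : ℝ} {N : ℕ} (τ : TimeGrid T N) (ν : Fin N) : ℝ := τ.t ν.succ - τ.t ν.castSucc

/-- An admissible discretization of the space domain: control volumes `cv i` with discretization
points `x i`, and boundary elements on `Γ_Ω` and on `Σ`, compatible with the control volumes. -/
structure SpaceGrid (P : Problem) (I IG IS : Type*) where
  /-- control volumes -/
  cv : I → Set E3
  cv_partition : IsPartition P.Om cv
  cv_nonempty : ∀ i, (cv i).Nonempty
  cv_polyhedral : ∀ i, IsPolyhedral (cv i)
  cv_connected : ∀ i, IsConnected (cv i)
  cv_open : ∀ i, IsOpen (cv i)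
  cv_interface : ∀ i, regBoundary (cv i ∩ P.dom .solid) ∩ P.Sig =
    regBoundary (cv i ∩ P.dom .gas) ∩ P.Sig
  /-- discretization points -/
  x : I → E3
  x_mem : ∀ i, x i ∈ closure (cv i)
  x_mem_phase : ∀ m i, (cv i ∩ P.dom m).Nonempty → x i ∈ closure (cv i ∩ P.dom m)
  x_mem_cavity : ∀ i, surf (closure (cv i) ∩ P.GamOm) ≠ 0 → x i ∈ closure (cv i) ∩ P.GamOm
  x_mem_outer : ∀ i, surf (closure (cv i) ∩ (frontier P.Om \ P.GamOm)) ≠ 0 →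
    x i ∈ closure (cv i) ∩ closure (frontier P.Om \ P.GamOm)
  /-- neighbouring discretization points are distinct, and the segment joining them is
  perpendicular to the common boundary -/
  x_ne : ∀ i j, i ≠ j → surf (frontier (cv i) ∩ frontier (cv j)) ≠ 0 → x i ≠ x j
  x_normal : ∀ i j, i ≠ j → surf (frontier (cv i) ∩ frontier (cv j)) ≠ 0 →
    ∀ᵐ y ∂(surf.restrict (frontier (cv i) ∩ frontier (cv j))),
      IsOuterNormal (cv i) y (‖x i - x j‖⁻¹ • (x j - x i))
  /-- boundary elements on `Γ_Ω` -/
  zO : IG → Set E3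
  zO_partition : IsPartition P.GamOm zO
  zO_nonempty : ∀ α, (zO α).Nonempty
  zO_polyhedral : ∀ α, IsPolyhedral (zO α)
  zO_connected : ∀ α, IsConnected (zO α)
  zO_open : ∀ α, ∃ U, IsOpen U ∧ zO α = P.GamOm ∩ U
  zO_planar : ∀ α, ∃ Q : AffineSubspace ℝ E3, Module.finrank ℝ Q.direction = 2 ∧ zO α ⊆ Q
  /-- boundary elements on `Σ` -/
  zS : IS → Set E3
  zS_partition : IsPartition P.Sig zS
  zS_nonempty : ∀ α, (zS α).Nonempty
  zS_polyhedral : ∀ α, IsPolyhedral (zS α)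
  zS_connected : ∀ α, IsConnected (zS α)
  zS_open : ∀ α, ∃ U, IsOpen U ∧ zS α = P.Sig ∩ U
  zS_planar : ∀ α, ∃ Q : AffineSubspace ℝ E3, Module.finrank ℝ Q.direction = 2 ∧ zS α ⊆ Q
  /-- the unique control volume `i(α)` adjacent to a boundary element -/
  iO : IG → I
  iO_sub : ∀ α, zO α ⊆ frontier (cv (iO α)) ∩ P.GamOm
  iO_unique : ∀ α j, zO α ⊆ frontier (cv j) ∩ P.GamOm → j = iO α
  x_iO : ∀ α, x (iO α) ∈ closure (zO α)
  iS : IS → I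
  iS_sub : ∀ α, zS α ⊆ frontier (cv (iS α) ∩ P.dom .solid) ∩ P.Sig
  iS_unique : ∀ α j, zS α ⊆ frontier (cv j ∩ P.dom .solid) ∩ P.Sig → j = iS α
  x_iS : ∀ α, x (iS α) ∈ closure (zS α)

/-! ### The discrete radiation operators -/

section Radiosity

variable {ι : Type*} [Fintype ι]

open Classical in
/-- The matrix `G(u)` for boundary elements of area `a`, exchange coefficients `L` and emissivity
`e`. -/
def radMatrix (e : ℝ → ℝ) (a : ι → ℝ) (L : ι → ι → ℝ) (u : ι → ℝ) : Matrix ι ι ℝ :=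
  Matrix.of fun α β => (if α = β then a α else 0) - (1 - e (u α)) * L α β

open Classical in
/-- The radiosity `R(u) = G(u)⁻¹ b`. -/
def radiosity (e : ℝ → ℝ) (a : ι → ℝ) (L : ι → ι → ℝ) (b u : ι → ℝ) : ι → ℝ :=
  (radMatrix e a L u)⁻¹.mulVec b

end Radiosity

namespace SpaceGrid

variable {P : Problem} {I IG IS : Type*} (D : SpaceGrid P I IG IS)

/-- The part `ω_{m,i}` of a control volume in the domain of phase `m`. -/
def cvp (m : Phase) (i : I) : Set E3 := D.cv i ∩ P.dom m

/-- The exchange coefficients `Λ_{α,β}` on `Σ`. -/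
def LamS (α β : IS) : ℝ := P.exchangeSig (D.zS α) (D.zS β)

/-- The exchange coefficients `Λ_{α,β}` on `Γ_Ω`. -/
def LamO (α β : IG) : ℝ := P.exchangeGam (D.zO α) (D.zO β)

/-- The exchange coefficients `Λ_{α,ph}` with the phantom closure. -/
def LamPh (α : IG) : ℝ := P.exchangeGam (D.zO α) P.GamPh

/-- The radiosity on `Γ_Ω`; the right-hand side is `E_Γ(u) + E_ph(u)`. -/
def RO [Fintype IG] (u : IG → ℝ) : IG → ℝ :=
  radiosity P.em (fun α => area (D.zO α)) D.LamO
    (fun α => P.sig * P.em (u α) * u α ^ 4 * area (D.zO α) +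
      P.sig * (1 - P.em (u α)) * P.ext ^ 4 * D.LamPh α) u

/-- The radiosity on `Σ`; the right-hand side is `E_Σ(u)`. -/
def RS [Fintype IS] (u : IS → ℝ) : IS → ℝ :=
  radiosity P.em (fun α => area (D.zS α)) D.LamS
    (fun α => P.sig * P.em (u α) * u α ^ 4 * area (D.zS α)) u

/-- The absorbed radiation `V_{Γ,α}`. -/
def VO [Fintype IG] (u : IG → ℝ) (α : IG) : ℝ :=
  P.em (u α) * ∑ β, D.RO u β * D.LamO α β + P.sig * P.em (u α) * P.ext ^ 4 * D.LamPh α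

/-- The absorbed radiation `V_{Σ,α}`. -/
def VS [Fintype IS] (u : IS → ℝ) (α : IS) : ℝ := P.em (u α) * ∑ β, D.RS u β * D.LamS α β

open Classical in
/-- The neighbours `nb_m(i)` of a control volume in phase `m`. -/
def nb [Fintype I] (m : Phase) (i : I) : Finset I :=
  Finset.univ.filter fun j =>
    j ≠ i ∧ (D.cvp m j).Nonempty ∧ surf (frontier (D.cvp m i) ∩ frontier (D.cvp m j)) ≠ 0

open Classical in
/-- The boundary elements `J_{Ω,i}` adjacent to a control volume. -/
def JO [Fintype IG] (i : I) : Finset IG :=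
  Finset.univ.filter fun α => surf (D.zO α ∩ frontier (D.cv i)) ≠ 0

open Classical in
/-- The interface elements `J_{Σ,i}` adjacent to a control volume. -/
def JS [Fintype IS] (i : I) : Finset IS :=
  Finset.univ.filter fun α => surf (D.zS α ∩ frontier (D.cvp .solid i)) ≠ 0

/-- `L_{V,Γ_Ω}`. -/
def LVcav : ℝ := P.sig * ⨆ i, area (frontier (D.cvp .solid i) ∩ P.GamOm) / vol (D.cv i)

/-- `L_{V,∂Ω∖Γ_Ω}`. -/
def LVout : ℝ :=
  P.sig * ⨆ i, area (frontier (D.cvp .solid i) ∩ (frontier P.Om \ P.GamOm)) / vol (D.cv i)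

/-- `L_{V,Σ}`. -/
def LVsig : ℝ := P.sig * ⨆ i, area (D.cv i ∩ P.Sig) / vol (D.cv i)

/-- The factor that multiplies the time step in the step-size condition, at the bound `r`. -/
def stepFactor (r : ℝ) : ℝ :=
  (D.LVcav + D.LVout + D.LVsig) * P.lg1 r + (D.LVcav + D.LVsig) * P.lg2 r + D.LVout * P.lg3 r

end SpaceGrid

/-! ### The scheme -/

/-- Approximations `f_{m,ν,i}` of the heat sources and `θ_{init,i}` of the initial temperature.
The value `f_{m,ν,i}` is constrained only where `ω_{m,i}` is nonempty: it is irrelevant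
otherwise. -/
structure Approximation {P : Problem} {I IG IS : Type*} (D : SpaceGrid P I IG IS) {N : ℕ}
    (τ : TimeGrid P.T N) where
  f : Phase → Fin N → I → ℝ
  f_nonneg : ∀ (m : Phase) (ν : Fin N) (i : I), (D.cvp m i).Nonempty →
    0 ≤ essInf (P.f m) (volume.restrict (Ioo (τ.t ν.castSucc) (τ.t ν.succ) ×ˢ D.cvp m i))
  f_lower : ∀ (m : Phase) (ν : Fin N) (i : I), (D.cvp m i).Nonempty →
    essInf (P.f m) (volume.restrict (Ioo (τ.t ν.castSucc) (τ.t ν.succ) ×ˢ D.cvp m i)) ≤ f m ν i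
  f_upper : ∀ (m : Phase) (ν : Fin N) (i : I), (D.cvp m i).Nonempty →
    f m ν i ≤ P.fNorm m (τ.t ν.castSucc) (τ.t ν.succ) (D.cvp m i)
  init : I → ℝ
  init_nonneg : ∀ i, 0 ≤ essInf P.init (volume.restrict (D.cv i))
  init_lower : ∀ i, essInf P.init (volume.restrict (D.cv i)) ≤ init i
  init_upper : ∀ i, init i ≤ P.initNorm (D.cv i)

section Scheme

variable {P : Problem} {I IG IS : Type*} [Fintype I] [Fintype IG] [Fintype IS]
  {D : SpaceGrid P I IG IS} {N : ℕ} {τ : TimeGrid P.T N}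

/-- The contribution of phase `m` to the scheme: change of internal energy, heat conduction and
heat sources. -/
def phaseTerm (A : Approximation D τ) (ν : Fin N) (v u : I → ℝ) (i : I) (m : Phase) : ℝ :=
  (τ.k ν)⁻¹ * ((P.en m (u i) - P.en m (v i)) * vol (D.cvp m i))
    - P.kap m * ∑ j ∈ D.nb m i,
        (u j - u i) / ‖D.x i - D.x j‖ * area (frontier (D.cvp m i) ∩ frontier (D.cvp m j))
    - A.f m ν i * vol (D.cvp m i)

/-- The contribution of radiation to the scheme. -/
def radiationTerm (D : SpaceGrid P I IG IS) (u : I → ℝ) (i : I) : ℝ :=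
  (P.sig * P.em (u i) * u i ^ 4 * area (frontier (D.cvp .solid i) ∩ P.GamOm)
    - ∑ α ∈ D.JO i, D.VO (fun β => u (D.iO β)) α)
  + P.sig * P.em (u i) * (u i ^ 4 - P.ext ^ 4) *
      area (frontier (D.cvp .solid i) ∩ (frontier P.Om \ P.GamOm))
  + (P.sig * P.em (u i) * u i ^ 4 * area (D.cv i ∩ P.Sig)
    - ∑ α ∈ D.JS i, D.VS (fun β => u (D.iS β)) α)

/-- The finite volume operator `H_{ν,i}(v, u)`. -/
def schemeOp (A : Approximation D τ) (ν : Fin N) (v u : I → ℝ) (i : I) : ℝ :=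
  phaseTerm A ν v u i .solid + phaseTerm A ν v u i .gas + radiationTerm D u i

/-- `u = (u_0, ..., u_N)` is a nonnegative solution of the fully implicit scheme. -/
def IsNonnegSolution (A : Approximation D τ) (u : Fin (N + 1) → I → ℝ) : Prop :=
  (∀ ν i, 0 ≤ u ν i) ∧ (∀ i, u 0 i = A.init i) ∧
    ∀ (ν : Fin N) (i : I), schemeOp A ν (u ν.castSucc) (u ν.succ) i = 0

end Scheme

end HeatFV

end

noncomputable section

namespace HeatFV

/-! ### Planes and the surface measure -/

/-! After collecting terms, one time step reads B_i(u_i) + ∑_j c_ij (u_i - u_j) = A_i(u) + data for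
every control volume i. B_i contains the internal energy and the emission, c_ij ≥ 0 is the heat
conduction, and A_i is the absorbed radiation. The energy gives B_i the slope C_ε λ₃(ω_i)/k_ν, which
the emission lowers only through the variation of the emissivity. The condition k_ν Φ(M_ν) < C_ε
says that the remaining slope beats the Lipschitz constant of A_i in the maximum norm. Conduction
does no harm, since its diagonal adds to the slope exactly what its off-diagonal part adds to the
Lipschitz constant. After truncation of the temperatures to [0, M_ν], inverting the diagonal part
therefore gives a contraction (`existsUnique_of_slope`, `existsUnique_in_box`).

The bounds come from a discrete maximum principle. Where u is maximal and above θ_ext, heat flows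
out and no more radiation is absorbed than emitted, so the energy grows through the sources only,
and M_ν accounts for these. At a minimum below θ_ext the signs are reversed. The same comparison at
the ends of the box makes the truncation inactive, and the a priori upper bound turns uniqueness in
the box into uniqueness among all nonnegative solutions. The last claim is monotonicity of Φ and of
the bound in time.

All estimates for radiation rest on the closure relation ∑_β Λ_αβ (+ Λ_α,ph) = λ₂(ζ_α). By it, the
radiosity of an element is a convex combination of σu⁴ and a weighted mean of the incoming
radiosities. This yields a maximum principle, the invertibility of G(u), and the Lipschitz estimate
`IsRadiosity.abs_sub_le`.

For the closure relation, the function (n·z)exp(-|z|²) is integrated over the half-space of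
directions at a regular boundary point x, with value π/2. Almost every ray leaves V first at a point
of exactly one boundary plane. In cone coordinates over the planes the same integral becomes π/2
times the integral of Λω over the boundary (`PlaneFamily.lintegral_transport`). The remaining
geometry compares outer normals: nested sets share them, disjoint sets have opposite ones. This
decides to which control volume a boundary element belongs, so that emitting and absorbing areas
agree (`sum_area_JS`, `sum_area_JO`). -/

instance fact_finrank_E3 : Fact (Module.finrank ℝ E3 = 2 + 1) := ⟨by simp⟩

/-- The plane with unit normal `ν` at signed distance `c` from the origin. -/
def plane (ν : E3) (c : ℝ) : Set E3 := {y | inner ℝ ν y = c}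

lemma isClosed_plane (ν : E3) (c : ℝ) : IsClosed (plane ν c) :=
  isClosed_eq (by fun_prop) continuous_const

lemma measurableSet_plane (ν : E3) (c : ℝ) : MeasurableSet (plane ν c) :=
  (isClosed_plane ν c).measurableSet

lemma plane_neg (ν : E3) (c : ℝ) : plane (-ν) (-c) = plane ν c := by
  ext y; simp [plane]

/-- The linear plane orthogonal to `ν`. -/
abbrev orthPlane (ν : E3) : Submodule ℝ E3 := (Submodule.span ℝ {ν})ᗮ

lemma finrank_orthPlane {ν : E3} (hν : ‖ν‖ = 1) : Module.finrank ℝ (orthPlane ν) = 2 :=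
  Submodule.finrank_orthogonal_span_singleton (n := 2) (norm_ne_zero_iff.1 (by simp [hν]))

lemma inner_orthPlane (ν : E3) (w : orthPlane ν) : inner ℝ ν (w : E3) = 0 :=
  Submodule.mem_orthogonal_singleton_iff_inner_right.1 w.2

lemma inner_self_of_unit {ν : E3} (hν : ‖ν‖ = 1) : inner ℝ ν ν = 1 := by
  rw [real_inner_self_eq_norm_sq, hν]; norm_num

/-- Fubini coordinates for the orthogonal splitting into the normal line and the plane through the
origin; both factors carry their own Lebesgue measure. -/
lemma measurePreserving_coords {ν : E3} (hν : ‖ν‖ = 1) :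
    MeasurePreserving (fun p : ℝ × orthPlane ν => p.1 • ν + (p.2 : E3)) volume volume := by
  have h1 := (Submodule.measurePreserving_measurableEquivProd (Submodule.span ℝ {ν}) (0 : E3)).symm
  rw [InnerProductSpace.euclideanHausdorffMeasure_eq_volume] at h1
  have h2 := (LinearIsometryEquiv.toSpanUnitSingleton ν hν (𝕜 := ℝ)).measurePreserving
  have h3 := h2.prod (MeasurePreserving.id (volume : Measure (orthPlane ν)))
  have h4 := h1.comp h3
  have h5 : (fun p : ℝ × orthPlane ν => p.1 • ν + (p.2 : E3)) =
      ((Submodule.span ℝ {ν}).measurableEquivProd (0 : E3)).symm ∘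
        Prod.map (LinearIsometryEquiv.toSpanUnitSingleton ν hν) id := by
    ext p : 1
    simp
  rw [h5]
  exact h4

lemma isometry_planeParam (ν : E3) (c : ℝ) :
    Isometry (fun w : orthPlane ν => c • ν + (w : E3)) :=
  (IsometryEquiv.addLeft (c • ν)).isometry.comp isometry_subtype_coe

lemma range_planeParam {ν : E3} (hν : ‖ν‖ = 1) (c : ℝ) :
    Set.range (fun w : orthPlane ν => c • ν + (w : E3)) = plane ν c := by
  ext y
  simp only [Set.mem_range, plane, Set.mem_ofPred_eq]
  constructor
  · rintro ⟨w, rfl⟩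
    rw [inner_add_right, inner_smul_right, inner_self_of_unit hν, inner_orthPlane]; ring
  · intro h
    refine ⟨⟨y - c • ν, ?_⟩, by simp⟩
    rw [Submodule.mem_orthogonal_singleton_iff_inner_right, inner_sub_right, inner_smul_right,
      inner_self_of_unit hν, h]; ring

/-- Isometries preserve Hausdorff measure, and in a two-dimensional inner product space the
normalized Hausdorff measure is Lebesgue measure. All surface integrals over planes are computed
through this. -/
lemma map_planeParam {ν : E3} (hν : ‖ν‖ = 1) (c : ℝ) :
    (volume : Measure (orthPlane ν)).map (fun w : orthPlane ν => c • ν + (w : E3)) =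
      surf.restrict (plane ν c) := by
  rw [← range_planeParam hν, surf, ← (isometry_planeParam ν c).map_euclideanHausdorffMeasure,
    ← InnerProductSpace.euclideanHausdorffMeasure_eq_volume, finrank_orthPlane hν]

lemma measurable_planeParam (ν : E3) (c : ℝ) :
    Measurable (fun w : orthPlane ν => c • ν + (w : E3)) :=
  (isometry_planeParam ν c).continuous.measurable

lemma surf_inter_plane {ν : E3} (hν : ‖ν‖ = 1) (c : ℝ) {A : Set E3} (hA : MeasurableSet A) :
    surf (A ∩ plane ν c) = volume ((fun w : orthPlane ν => c • ν + (w : E3)) ⁻¹' A) := by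
  rw [← Measure.restrict_apply hA, ← map_planeParam hν, Measure.map_apply
    (measurable_planeParam ν c) hA]

lemma surf_plane_inter_lt_top {ν : E3} (hν : ‖ν‖ = 1) (c : ℝ) {A : Set E3}
    (hA : Bornology.IsBounded A) : surf (A ∩ plane ν c) < ∞ := by
  -- The closure is measurable, which is not assumed of `A`.
  have h1 : surf (closure A ∩ plane ν c) < ∞ := by
    rw [surf_inter_plane hν c isClosed_closure.measurableSet]
    apply Bornology.IsBounded.measure_lt_top
    exact (isometry_planeParam ν c).antilipschitz.isBounded_preimage hA.closure
  exact lt_of_le_of_lt (measure_mono (inter_subset_inter_left _ subset_closure)) h1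

/-- The level sets of a nonzero linear functional are null sets. -/
lemma volume_level_eq_zero {F : Type*} [NormedAddCommGroup F] [InnerProductSpace ℝ F]
    [FiniteDimensional ℝ F] [MeasurableSpace F] [BorelSpace F] (φ : F →ₗ[ℝ] ℝ) (hφ : φ ≠ 0)
    (c : ℝ) : volume {w | φ w = c} = 0 := by
  by_cases hne : ∃ w₀, φ w₀ = c
  · obtain ⟨w₀, h₀⟩ := hne
    have h1 : volume ((LinearMap.ker φ : Submodule ℝ F) : Set F) = 0 := by
      apply Measure.addHaar_submodule
      rwa [Ne, LinearMap.ker_eq_top]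
    have h2 : {w | φ w = c} = (fun w => w + (-w₀)) ⁻¹' (LinearMap.ker φ : Submodule ℝ F) := by
      ext w; simp [h₀, ← sub_eq_add_neg, sub_eq_zero]
    rw [h2, measure_preimage_add_right, h1]
  · rw [show {w | φ w = c} = ∅ by
      ext w; simp only [mem_ofPred_eq, mem_empty_iff_false, iff_false]; exact fun h => hne ⟨w, h⟩]
    simp

lemma volume_plane {ν : E3} (hν : ν ≠ 0) (c : ℝ) : volume (plane ν c) = 0 := by
  refine volume_level_eq_zero (innerₛₗ ℝ ν) ?_ c
  intro h
  have := LinearMap.congr_fun h ν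
  simp at this
  exact hν this

/-- Restricted to the first plane, the equation of the second one is either a nontrivial linear
equation, which has a null solution set, or constant. A constant one has no solution here, since
otherwise the first plane would be contained in the second. -/
lemma surf_plane_inter_level {ν : E3} (hν : ‖ν‖ = 1) (c : ℝ) {μ : E3} {d : ℝ}
    (hne : ¬ plane ν c ⊆ plane μ d) : surf (plane ν c ∩ plane μ d) = 0 := by
  rw [inter_comm, surf_inter_plane hν c (measurableSet_plane μ d)]
  set φ : orthPlane ν →ₗ[ℝ] ℝ := (innerₛₗ ℝ μ).comp (orthPlane ν).subtype with hφ
  have hset : (fun w : orthPlane ν => c • ν + (w : E3)) ⁻¹' plane μ d =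
      {w | φ w = d - c * inner ℝ μ ν} := by
    ext w
    simp only [plane, mem_preimage, mem_ofPred_eq, inner_add_right, inner_smul_right, hφ,
      LinearMap.comp_apply, Submodule.subtype_apply, innerₛₗ_apply_apply]
    constructor <;> intro h <;> linarith
  by_cases h0 : φ = 0
  · rw [hset, h0]
    by_cases h1 : 0 = d - c * inner ℝ μ ν
    · exfalso
      apply hne
      rw [← range_planeParam hν]
      rintro _ ⟨w, rfl⟩
      have : w ∈ (fun w : orthPlane ν => c • ν + (w : E3)) ⁻¹' plane μ d := by
        rw [hset, h0]; simpa using h1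
      exact this
    · simp [h1]
  · rw [hset]; exact volume_level_eq_zero φ h0 _

/-! ### Integration over cones -/

lemma lintegral_comp_smul_ofReal {F : Type*} [NormedAddCommGroup F] [NormedSpace ℝ F]
    [FiniteDimensional ℝ F] [MeasurableSpace F] [BorelSpace F] (μ : Measure F)
    [μ.IsAddHaarMeasure] {r : ℝ} (hr : 0 < r) {f : F → ℝ≥0∞} (hf : Measurable f) :
    ∫⁻ x, f x ∂μ = ENNReal.ofReal (r ^ Module.finrank ℝ F) * ∫⁻ x, f (r • x) ∂μ := by
  have h1 : ∫⁻ x, f (r • x) ∂μ = ∫⁻ y, f y ∂(Measure.map (r • ·) μ) :=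
    (lintegral_map hf (measurable_const_smul r)).symm
  rw [h1, Measure.map_addHaar_smul μ hr.ne', lintegral_smul_measure, smul_eq_mul, ← mul_assoc,
    ← ENNReal.ofReal_mul (by positivity), abs_of_pos (by positivity),
    mul_inv_cancel₀ (by positivity)]
  simp

lemma lintegral_coords {ν : E3} (hν : ‖ν‖ = 1) {g : E3 → ℝ≥0∞} (hg : Measurable g) :
    ∫⁻ z, g z = ∫⁻ s : ℝ, ∫⁻ w : orthPlane ν, g (s • ν + (w : E3)) := by
  have hm : Measurable fun p : ℝ × orthPlane ν => g (p.1 • ν + (p.2 : E3)) :=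
    hg.comp (measurePreserving_coords hν).measurable
  rw [← (measurePreserving_coords hν).lintegral_comp hg, Measure.volume_eq_prod,
    lintegral_prod _ hm.aemeasurable]

/-- Cone coordinates z = t • y with apex 0 and y in the plane. The density is t²c: dilating the
slice gives t² from its two dimensions, and the height s = ct gives c. -/
lemma lintegral_cone_of_pos {ν : E3} (hν : ‖ν‖ = 1) {c : ℝ} (hc : 0 < c) {g : E3 → ℝ≥0∞}
    (hg : Measurable g) :
    ∫⁻ z in {z | 0 < inner ℝ ν z}, g z =
      ∫⁻ y in plane ν c, (∫⁻ t in Ioi (0 : ℝ), g (t • y) * ENNReal.ofReal (t ^ 2 * c)) ∂surf := by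
  have hms : MeasurableSet {z : E3 | 0 < inner ℝ ν z} :=
    (isOpen_lt continuous_const (by fun_prop)).measurableSet
  have hm1 : Measurable fun p : ℝ × orthPlane ν => g (p.1 • ν + (p.2 : E3)) :=
    hg.comp (measurePreserving_coords hν).measurable
  have hmi : ∀ z, Measurable fun t : ℝ => g (t • z) * ENNReal.ofReal (t ^ 2 * c) := fun z => by
    fun_prop
  have hm2 : Measurable fun y : E3 =>
      ∫⁻ t in Ioi (0 : ℝ), g (t • y) * ENNReal.ofReal (t ^ 2 * c) := by
    apply Measurable.lintegral_prod_right (f := fun (y : E3) (t : ℝ) =>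
      g (t • y) * ENNReal.ofReal (t ^ 2 * c))
    simp only [Function.uncurry_def]
    fun_prop
  rw [← map_planeParam hν, lintegral_map hm2 (measurable_planeParam ν c)]
  rw [← lintegral_indicator hms, lintegral_coords hν (hg.indicator hms)]
  have e1 : ∀ s : ℝ, ∫⁻ w : orthPlane ν, ({z : E3 | 0 < inner ℝ ν z}.indicator g)
      (s • ν + (w : E3)) = (Ioi (0 : ℝ)).indicator
        (fun s => ∫⁻ w : orthPlane ν, g (s • ν + (w : E3))) s := by
    intro s
    have hin : ∀ w : orthPlane ν, inner ℝ ν (s • ν + (w : E3)) = s := fun w => by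
      rw [inner_add_right, inner_smul_right, inner_self_of_unit hν, inner_orthPlane]; ring
    by_cases hs : 0 < s
    · rw [indicator_of_mem (mem_Ioi.2 hs)]
      refine lintegral_congr fun w => ?_
      rw [indicator_of_mem]
      simpa [hin] using hs
    · rw [indicator_of_notMem (by simpa using hs)]
      refine (lintegral_congr fun w => ?_).trans lintegral_zero
      rw [indicator_of_notMem]
      simpa [hin] using hs
  have hmF : Measurable fun s : ℝ => ∫⁻ w : orthPlane ν, g (s • ν + (w : E3)) :=
    hm1.lintegral_prod_right
  simp_rw [e1]
  -- Substitution s = ct of the height.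
  rw [lintegral_comp_smul_ofReal volume hc (hmF.indicator measurableSet_Ioi)]
  have e2 : ∀ t : ℝ, (Ioi (0 : ℝ)).indicator
      (fun s => ∫⁻ w : orthPlane ν, g (s • ν + (w : E3))) (c • t) = (Ioi (0 : ℝ)).indicator
        (fun t => ∫⁻ w : orthPlane ν, g (t • (c • ν + (w : E3))) * ENNReal.ofReal (t ^ 2)) t := by
    intro t
    by_cases ht : 0 < t
    · rw [indicator_of_mem (mem_Ioi.2 ht), indicator_of_mem (by simpa using mul_pos hc ht)]
      -- Dilation by t of the slice at height ct, which brings it back to the plane at height c.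
      rw [lintegral_comp_smul_ofReal volume ht (f := fun w : orthPlane ν =>
        g ((c • t) • ν + (w : E3))) (hm1.comp measurable_prodMk_left),
        finrank_orthPlane hν, lintegral_mul_const _ (by fun_prop), mul_comm]
      congr 1
      refine lintegral_congr fun w => ?_
      simp [smul_smul, mul_comm]
    · rw [indicator_of_notMem, indicator_of_notMem (by simpa using ht)]
      simp only [mem_Ioi, not_lt, smul_eq_mul] at ht ⊢
      exact mul_nonpos_of_nonneg_of_nonpos hc.le ht
  simp_rw [e2]
  rw [lintegral_indicator measurableSet_Ioi, Module.finrank_self, pow_one, lintegral_lintegral_swap,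
    ← lintegral_const_mul _ (by
      apply Measurable.lintegral_prod_right (f := fun (w : orthPlane ν) (t : ℝ) =>
        g (t • (c • ν + (w : E3))) * ENNReal.ofReal (t ^ 2))
      simp only [Function.uncurry_def]
      fun_prop)]
  · refine lintegral_congr fun w => ?_
    rw [← lintegral_const_mul _ (by fun_prop)]
    refine lintegral_congr fun t => ?_
    rw [ENNReal.ofReal_mul (by positivity)]
    ring
  · apply Measurable.aemeasurable
    simp only [Function.uncurry_def]
    fun_prop

lemma lintegral_cone {ν : E3} (hν : ‖ν‖ = 1) {c : ℝ} (hc : c ≠ 0) {g : E3 → ℝ≥0∞}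
    (hg : Measurable g) :
    ∫⁻ z in {z | 0 < c * inner ℝ ν z}, g z =
      ∫⁻ y in plane ν c, (∫⁻ t in Ioi (0 : ℝ), g (t • y) * ENNReal.ofReal (t ^ 2 * |c|)) ∂surf := by
  rcases lt_or_gt_of_ne hc with h | h
  · have := lintegral_cone_of_pos (ν := -ν) (by simpa using hν) (neg_pos.2 h) hg
    rw [plane_neg] at this
    rw [abs_of_neg h, ← this]
    congr 2
    ext z
    simp only [mem_ofPred_eq, inner_neg_left]
    rw [mul_pos_iff]
    constructor
    · rintro (h1 | h1) <;> linarith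
    · intro h1; right; constructor <;> linarith
  · rw [abs_of_pos h, ← lintegral_cone_of_pos hν h hg]
    congr 2
    ext z
    simp only [mem_ofPred_eq]
    exact mul_pos_iff_of_pos_left h

/-! ### Gaussian moments and the half-space integral -/

lemma integral_pow_mul_exp_neg_sq {q : ℕ} {b : ℝ} (hb : 0 < b) :
    ∫ x in Ioi (0 : ℝ), x ^ q * Real.exp (-b * x ^ 2) =
      b ^ (-((q : ℝ) + 1) / 2) * (1 / 2) * Real.Gamma (((q : ℝ) + 1) / 2) := by
  have := integral_rpow_mul_exp_neg_mul_rpow (p := 2) (q := q) two_pos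
    (by have : (0 : ℝ) ≤ q := q.cast_nonneg
        linarith) hb
  rw [← this]
  refine setIntegral_congr_fun measurableSet_Ioi fun x hx => ?_
  simp only [Real.rpow_natCast, Real.rpow_two]

lemma integrableOn_pow_mul_exp_neg_sq (q : ℕ) {b : ℝ} (hb : 0 < b) :
    IntegrableOn (fun x : ℝ => x ^ q * Real.exp (-b * x ^ 2)) (Ioi 0) := by
  have := integrable_rpow_mul_exp_neg_mul_sq hb (s := q)
    (by have : (0 : ℝ) ≤ q := q.cast_nonneg
        linarith)
  simp only [Real.rpow_natCast] at this
  exact this.integrableOn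

lemma lintegral_mul_exp_neg_sq :
    ∫⁻ s in Ioi (0 : ℝ), ENNReal.ofReal (s * Real.exp (-s ^ 2)) = ENNReal.ofReal (1 / 2) := by
  have h1 := integral_pow_mul_exp_neg_sq (q := 1) one_pos
  have h2 := integrableOn_pow_mul_exp_neg_sq 1 one_pos
  simp only [pow_one, neg_mul, one_mul] at h1 h2
  rw [← ofReal_integral_eq_lintegral_ofReal h2, h1]
  · norm_num
  · filter_upwards [ae_restrict_mem measurableSet_Ioi] with s hs
    have : 0 < s := hs
    positivity

lemma lintegral_cube_mul_exp_neg_sq {b : ℝ} (hb : 0 < b) :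
    ∫⁻ t in Ioi (0 : ℝ), ENNReal.ofReal (t ^ 3 * Real.exp (-b * t ^ 2)) =
      ENNReal.ofReal (1 / (2 * b ^ 2)) := by
  have h1 := integral_pow_mul_exp_neg_sq (q := 3) hb
  have h2 := integrableOn_pow_mul_exp_neg_sq 3 hb
  rw [← ofReal_integral_eq_lintegral_ofReal h2, h1]
  · congr 1
    have : ((3 : ℕ) : ℝ) + 1 = 4 := by norm_num
    rw [this, show (4 : ℝ) / 2 = ((1 : ℕ) : ℝ) + 1 by norm_num, Real.Gamma_nat_eq_factorial,
      show (-4 : ℝ) / 2 = -((2 : ℕ) : ℝ) by norm_num, Real.rpow_neg hb.le, Real.rpow_natCast]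
    field_simp
    norm_num
  · filter_upwards [ae_restrict_mem measurableSet_Ioi] with s hs
    have : 0 < s := hs
    positivity

/-- By Fubini the value is 1/2 from the normal direction times π from the Gaussian on the plane. The
factor n·z is the cosine in the view factor; the Gaussian makes the integral over all directions and
lengths finite. -/
lemma lintegral_halfspace_gaussian {n : E3} (hn : ‖n‖ = 1) :
    ∫⁻ z in {z | 0 < inner ℝ n z}, ENNReal.ofReal (inner ℝ n z * Real.exp (-‖z‖ ^ 2)) =
      ENNReal.ofReal (Real.pi / 2) := by
  have hms : MeasurableSet {z : E3 | 0 < inner ℝ n z} :=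
    (isOpen_lt continuous_const (by fun_prop)).measurableSet
  have hg : Measurable fun z : E3 => ENNReal.ofReal (inner ℝ n z * Real.exp (-‖z‖ ^ 2)) := by
    fun_prop
  rw [← lintegral_indicator hms, lintegral_coords hn (hg.indicator hms)]
  have hG : ∫⁻ w : orthPlane n, ENNReal.ofReal (Real.exp (-‖w‖ ^ 2)) = ENNReal.ofReal Real.pi := by
    have h1 := GaussianFourier.integral_rexp_neg_mul_sq_norm (V := orthPlane n) one_pos
    have h2 := GaussianFourier.integrable_cexp_neg_mul_sq_norm_add (V := orthPlane n) (b := 1)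
      (by simp) 0 0
    rw [finrank_orthPlane hn] at h1
    norm_num at h1
    simp only [Submodule.coe_norm] at h1 ⊢
    rw [← ofReal_integral_eq_lintegral_ofReal _ (.of_forall fun w => (Real.exp_pos _).le), h1]
    have := h2.re
    refine this.congr (.of_forall fun w => ?_)
    simp only [neg_mul, one_mul, inner_zero_left, Complex.ofReal_zero, mul_zero, add_zero]
    rw [show (-(‖w‖ : ℂ) ^ 2) = ((-‖w‖ ^ 2 : ℝ) : ℂ) by push_cast; ring]
    exact Complex.exp_ofReal_re _
  have e1 : ∀ s : ℝ, ∫⁻ w : orthPlane n, ({z : E3 | 0 < inner ℝ n z}.indicator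
      (fun z => ENNReal.ofReal (inner ℝ n z * Real.exp (-‖z‖ ^ 2)))) (s • n + (w : E3)) =
      (Ioi (0 : ℝ)).indicator
        (fun s => ENNReal.ofReal (s * Real.exp (-s ^ 2))) s * ENNReal.ofReal Real.pi := by
    intro s
    have hin : ∀ w : orthPlane n, inner ℝ n (s • n + (w : E3)) = s := fun w => by
      rw [inner_add_right, inner_smul_right, inner_self_of_unit hn, inner_orthPlane]; ring
    have hno : ∀ w : orthPlane n, ‖s • n + (w : E3)‖ ^ 2 = s ^ 2 + ‖w‖ ^ 2 := fun w => by
      rw [norm_add_sq_real, inner_smul_left, inner_orthPlane, norm_smul, hn]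
      simp
    by_cases hs : 0 < s
    · rw [indicator_of_mem (mem_Ioi.2 hs), ← hG, ← lintegral_const_mul _ (by fun_prop)]
      refine lintegral_congr fun w => ?_
      rw [indicator_of_mem (by simpa [hin] using hs), hin, hno,
        ← ENNReal.ofReal_mul (by positivity), neg_add, Real.exp_add, mul_assoc]
    · rw [indicator_of_notMem (by simpa using hs), zero_mul]
      refine (lintegral_congr fun w => ?_).trans lintegral_zero
      rw [indicator_of_notMem]
      simpa [hin] using hs
  simp_rw [e1]
  rw [lintegral_mul_const _ (by
      apply Measurable.indicator _ measurableSet_Ioi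
      fun_prop), lintegral_indicator measurableSet_Ioi,
    lintegral_mul_exp_neg_sq, ← ENNReal.ofReal_mul (by norm_num)]
  congr 1
  ring

/-! ### Polyhedral sets -/

/-- A set is a plane. -/
def IsPlane (Q : Set E3) : Prop := ∃ ν : E3, ∃ c : ℝ, ‖ν‖ = 1 ∧ Q = plane ν c

lemma IsPlane.isClosed {Q : Set E3} (h : IsPlane Q) : IsClosed Q := by
  obtain ⟨ν, c, -, rfl⟩ := h; exact isClosed_plane ν c

lemma IsPlane.volume_eq_zero {Q : Set E3} (h : IsPlane Q) : volume Q = 0 := by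
  obtain ⟨ν, c, hν, rfl⟩ := h
  exact volume_plane (norm_ne_zero_iff.1 (by simp [hν])) c

lemma IsPlane.surf_inter_lt_top {Q A : Set E3} (h : IsPlane Q) (hA : Bornology.IsBounded A) :
    surf (A ∩ Q) < ∞ := by
  obtain ⟨ν, c, hν, rfl⟩ := h
  exact surf_plane_inter_lt_top hν c hA

lemma IsPlane.surf_inter_eq_zero {Q R : Set E3} (hQ : IsPlane Q) (hR : IsPlane R) (hne : Q ≠ R) :
    surf (Q ∩ R) = 0 := by
  obtain ⟨ν, c, hν, rfl⟩ := hQ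
  obtain ⟨μ, d, hμ, rfl⟩ := hR
  by_cases h : plane ν c ⊆ plane μ d
  · rw [inter_comm]
    exact surf_plane_inter_level hμ d fun h' => hne (h.antisymm h')
  · exact surf_plane_inter_level hν c h

lemma convex_plane (ν : E3) (c : ℝ) : Convex ℝ (plane ν c) :=
  convex_hyperplane (innerₛₗ ℝ ν).isLinear c

lemma exists_isPlane_superset {s : Set E3} (hs : affineSpan ℝ s ≠ ⊤) :
    ∃ Q, IsPlane Q ∧ s ⊆ Q := by
  rcases s.eq_empty_or_nonempty.symm with ⟨p, hp⟩ | hne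
  · have hdir : (affineSpan ℝ s).direction ≠ ⊤ := by
      rwa [Ne, AffineSubspace.direction_eq_top_iff_of_nonempty ⟨p, subset_affineSpan ℝ s hp⟩]
    have h2 : (affineSpan ℝ s).directionᗮ ≠ ⊥ := by
      rwa [Ne, Submodule.orthogonal_eq_bot_iff]
    obtain ⟨v, hv, hv0⟩ := Submodule.exists_mem_ne_zero_of_ne_bot h2
    refine ⟨plane (‖v‖⁻¹ • v) (inner ℝ (‖v‖⁻¹ • v) p), ⟨_, _, by
      rw [norm_smul, norm_inv, norm_norm, inv_mul_cancel₀ (norm_ne_zero_iff.2 hv0)], rfl⟩, ?_⟩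
    intro y hy
    have h3 : y - p ∈ (affineSpan ℝ s).direction := by
      rw [← vsub_eq_sub]
      exact AffineSubspace.vsub_mem_direction (subset_affineSpan ℝ s hy) (subset_affineSpan ℝ s hp)
    have h4 : inner ℝ v (y - p) = 0 := Submodule.inner_left_of_mem_orthogonal h3 hv
    rw [inner_sub_right] at h4
    simp only [plane, mem_ofPred_eq, inner_smul_left]
    rw [sub_eq_zero.1 h4]
  · refine ⟨plane (EuclideanSpace.single 0 1) 0, ⟨_, _, by simp, rfl⟩, by simp [hne]⟩

/-- The boundary of a polytope lies in finitely many planes. -/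
lemma exists_planes_frontier_convexHull (t : Finset E3) :
    ∃ S : Finset (Set E3), (∀ Q ∈ S, IsPlane Q) ∧
      frontier (convexHull ℝ (t : Set E3)) ⊆ ⋃ Q ∈ S, Q := by
  classical
  have hex : ∀ s : Finset E3, ∃ Q, IsPlane Q ∧ (affineSpan ℝ (s : Set E3) ≠ ⊤ → (s : Set E3) ⊆ Q) := by
    intro s
    by_cases h : affineSpan ℝ (s : Set E3) ≠ ⊤
    · obtain ⟨Q, h1, h2⟩ := exists_isPlane_superset h
      exact ⟨Q, h1, fun _ => h2⟩
    · exact ⟨plane (EuclideanSpace.single 0 1) 0, ⟨_, _, by simp, rfl⟩, fun h' => absurd h' h⟩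
  choose q hq1 hq2 using hex
  -- One plane for each set of vertices whose affine span is not the whole space.
  refine ⟨t.powerset.image q, ?_, ?_⟩
  · intro Q hQ
    obtain ⟨s, -, rfl⟩ := Finset.mem_image.1 hQ
    exact hq1 s
  · intro x hx
    have hcl : IsClosed (convexHull ℝ (t : Set E3)) := t.finite_toSet.isClosed_convexHull ℝ
    rw [hcl.frontier_eq] at hx
    -- Carathéodory with strictly positive weights on affinely independent vertices. If these
    -- spanned the space, the point would be interior to their simplex, hence to the polytope.
    obtain ⟨ι, _, z, w, hz, hai, hw, hw1, hwx⟩ := eq_pos_convex_span_of_mem_convexHull hx.1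
    have hfin : (Set.range z).Finite := Set.finite_range z
    set s : Finset E3 := hfin.toFinset with hs
    have hsr : (s : Set E3) = Set.range z := by simp [hs]
    have hst : s ⊆ t := by
      intro y hy
      have : y ∈ (s : Set E3) := hy
      rw [hsr] at this
      exact hz this
    by_cases htop : affineSpan ℝ (Set.range z) = ⊤
    · exfalso
      apply hx.2
      let b : AffineBasis ι ℝ E3 := ⟨z, hai, htop⟩
      have hb : interior (convexHull ℝ (Set.range z)) = {x | ∀ i, 0 < b.coord i x} :=
        b.interior_convexHull
      have hmem : x ∈ interior (convexHull ℝ (Set.range z)) := by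
        rw [hb]
        intro i
        have : x = Finset.univ.affineCombination ℝ b w := by
          rw [Finset.affineCombination_eq_linear_combination _ _ _ hw1]
          exact hwx.symm
        rw [this, b.coord_apply_combination_of_mem (Finset.mem_univ i) hw1]
        exact hw i
      exact interior_mono (convexHull_mono hz) hmem
    · refine mem_iUnion₂.2 ⟨q s, Finset.mem_image_of_mem q (Finset.mem_powerset.2 hst), ?_⟩
      have hsub := hq2 s (by rwa [hsr])
      obtain ⟨ν, c, -, hQ⟩ := hq1 s
      rw [hQ] at hsub ⊢
      apply convexHull_min hsub (convex_plane ν c)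
      rw [hsr, ← hwx]
      exact (convex_convexHull ℝ _).sum_mem (fun i _ => (hw i).le) hw1
        fun i _ => subset_convexHull ℝ _ (mem_range_self i)

/-- A bounded regular open set whose boundary lies in finitely many planes. -/
structure PiecewiseFlat (V : Set E3) : Prop where
  isOpen : IsOpen V
  isBounded : Bornology.IsBounded V
  interior_closure_subset : interior (closure V) ⊆ V
  exists_planes : ∃ S : Finset (Set E3), (∀ Q ∈ S, IsPlane Q) ∧ frontier V ⊆ ⋃ Q ∈ S, Q

/-- The interior is contained in the intrinsic interior, so `V` is regular open. A frontier point
then lies on the boundary of any polytope of the union that contains it: were it interior to the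
polytope, it would be interior to the closure of `V`, hence in `V`. -/
lemma IsPolyhedral.piecewiseFlat {V : Set E3} (hV : IsPolyhedral V) (ho : IsOpen V)
    (hb : Bornology.IsBounded V) : PiecewiseFlat V where
  isOpen := ho
  isBounded := hb
  interior_closure_subset := interior_subset_intrinsicInterior.trans hV.2
  exists_planes := by
    classical
    obtain ⟨F, hF⟩ := hV.1
    choose S hS1 hS2 using exists_planes_frontier_convexHull
    refine ⟨F.biUnion S, ?_, ?_⟩
    · intro Q hQ
      obtain ⟨t, -, hQt⟩ := Finset.mem_biUnion.1 hQ
      exact hS1 t Q hQt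
    · intro x hx
      have hx1 : x ∈ closure V := frontier_subset_closure hx
      have hx2 : x ∉ V := fun h => by
        rw [ho.frontier_eq] at hx
        exact hx.2 h
      rw [hF] at hx1
      obtain ⟨t, ht, hxt⟩ := mem_iUnion₂.1 hx1
      have hxf : x ∈ frontier (convexHull ℝ (t : Set E3)) := by
        rw [(t.finite_toSet.isClosed_convexHull ℝ).frontier_eq]
        refine ⟨hxt, fun hi => hx2 ?_⟩
        apply interior_subset_intrinsicInterior.trans hV.2
        refine interior_mono ?_ hi
        rw [hF]
        exact subset_biUnion_of_mem (u := fun t : Finset E3 => convexHull ℝ (t : Set E3)) ht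
      obtain ⟨Q, hQ, hxQ⟩ := mem_iUnion₂.1 (hS2 t hxf)
      exact mem_iUnion₂.2 ⟨Q, Finset.mem_biUnion.2 ⟨t, ht, hQ⟩, hxQ⟩

namespace PiecewiseFlat

variable {V W : Set E3}

lemma notMem_of_mem_frontier (hV : PiecewiseFlat V) {x : E3} (hx : x ∈ frontier V) : x ∉ V := by
  rw [hV.isOpen.frontier_eq] at hx
  exact hx.2

lemma inter (hV : PiecewiseFlat V) (hW : PiecewiseFlat W) : PiecewiseFlat (V ∩ W) where
  isOpen := hV.isOpen.inter hW.isOpen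
  isBounded := hV.isBounded.subset inter_subset_left
  interior_closure_subset := subset_inter
    ((interior_mono (closure_mono inter_subset_left)).trans hV.interior_closure_subset)
    ((interior_mono (closure_mono inter_subset_right)).trans hW.interior_closure_subset)
  exists_planes := by
    classical
    obtain ⟨S, hS1, hS2⟩ := hV.exists_planes
    obtain ⟨R, hR1, hR2⟩ := hW.exists_planes
    refine ⟨S ∪ R, fun Q hQ => (Finset.mem_union.1 hQ).elim (hS1 Q) (hR1 Q), ?_⟩
    rw [Finset.set_biUnion_union]
    refine (frontier_inter_subset V W).trans (union_subset_union ?_ ?_)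
    · exact inter_subset_left.trans hS2
    · exact inter_subset_right.trans hR2

lemma surf_frontier_lt_top (hV : PiecewiseFlat V) : surf (frontier V) < ∞ := by
  obtain ⟨S, hS1, hS2⟩ := hV.exists_planes
  have hb : Bornology.IsBounded (frontier V) := hV.isBounded.closure.subset frontier_subset_closure
  have : frontier V ⊆ ⋃ Q ∈ S, frontier V ∩ Q := by
    intro x hx
    obtain ⟨Q, hQ, hxQ⟩ := mem_iUnion₂.1 (hS2 hx)
    exact mem_iUnion₂.2 ⟨Q, hQ, hx, hxQ⟩
  refine (measure_mono this).trans_lt ?_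
  refine (measure_biUnion_finset_le S _).trans_lt ?_
  exact ENNReal.sum_lt_top.2 fun Q hQ => (hS1 Q hQ).surf_inter_lt_top hb

lemma volume_frontier (hV : PiecewiseFlat V) : volume (frontier V) = 0 := by
  obtain ⟨S, hS1, hS2⟩ := hV.exists_planes
  refine measure_mono_null hS2 ?_
  exact (measure_biUnion_null_iff S.countable_toSet).2 fun Q hQ => (hS1 Q hQ).volume_eq_zero

end PiecewiseFlat

/-- Distinct planes meet in a surface null set, and there are finitely many pairs. -/
lemma ae_unique_plane (S : Finset (Set E3)) (hS : ∀ Q ∈ S, IsPlane Q) :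
    ∀ᵐ x ∂surf, ∀ Q ∈ S, ∀ R ∈ S, x ∈ Q → x ∈ R → Q = R := by
  have h1 : ∀ Q ∈ S, ∀ R ∈ S, ∀ᵐ x ∂surf, x ∈ Q → x ∈ R → Q = R := by
    intro Q hQ R hR
    by_cases h : Q = R
    · exact .of_forall fun _ _ _ => h
    · have := (hS Q hQ).surf_inter_eq_zero (hS R hR) h
      filter_upwards [measure_eq_zero_iff_ae_notMem.1 this] with x hx h1 h2
      exact absurd ⟨h1, h2⟩ hx
  simp only [Filter.eventually_all_finset]
  exact h1

/-! ### Outer normals -/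

lemma exists_pos_smul_add_mem_ball (x v : E3) {r : ℝ} (hr : 0 < r) :
    ∃ t : ℝ, 0 < t ∧ x + t • v ∈ Metric.ball x r := by
  refine ⟨r / (2 * (‖v‖ + 1)), by positivity, ?_⟩
  rw [mem_ball_iff_norm, add_sub_cancel_left, norm_smul, Real.norm_of_nonneg (by positivity)]
  have : (0 : ℝ) < ‖v‖ + 1 := by positivity
  rw [div_mul_eq_mul_div, div_lt_iff₀ (by positivity)]
  nlinarith [norm_nonneg v]

lemma IsOuterNormal.inner_neg_imp {A B : Set E3} {x n m : E3} (hA : IsOuterNormal A x n)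
    (hB : IsOuterNormal B x m) {r : ℝ} (hr : 0 < r)
    (h : ∀ y ∈ Metric.ball x r, y ∈ A → y ∈ B) (v : E3) (hv : inner ℝ n v < 0) :
    inner ℝ m v < 0 := by
  obtain ⟨-, r₁, hr₁, h₁⟩ := hA
  obtain ⟨-, r₂, hr₂, h₂⟩ := hB
  obtain ⟨t, ht, hb⟩ := exists_pos_smul_add_mem_ball x v (lt_min hr (lt_min hr₁ hr₂))
  have hb0 := Metric.ball_subset_ball (min_le_left _ _) hb
  have hb1 := Metric.ball_subset_ball ((min_le_right _ _).trans (min_le_left _ _)) hb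
  have hb2 := Metric.ball_subset_ball ((min_le_right _ _).trans (min_le_right _ _)) hb
  have h3 := (h₂ _ hb2).1 (h _ hb0 ((h₁ _ hb1).2 (by
    simpa [inner_smul_right] using mul_neg_of_pos_of_neg ht hv)))
  rw [add_sub_cancel_left, inner_smul_right] at h3
  by_contra! h4
  exact absurd h3 (not_lt.2 (mul_nonneg ht.le h4))

/-- An open half-space bounded by a plane through 0 determines its unit normal, and such half-spaces
are never properly nested. For ⟨n, m⟩ < 1 the vector m - n lies in the first half-space but not in
the second. -/
lemma eq_of_inner_neg_imp {n m : E3} (hn : ‖n‖ = 1) (hm : ‖m‖ = 1)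
    (h : ∀ v, inner ℝ n v < 0 → inner ℝ m v < 0) : n = m := by
  rw [← inner_eq_one_iff_of_norm_eq_one (𝕜 := ℝ) hn hm]
  refine le_antisymm ?_ ?_
  · have := real_inner_le_norm n m
    rwa [hn, hm, one_mul] at this
  · by_contra! hlt
    have h1 := h (m - n) (by
      rw [inner_sub_right, inner_self_of_unit hn]; linarith)
    rw [inner_sub_right, inner_self_of_unit hm, real_inner_comm] at h1
    linarith

/-- Locally nested sets have the same outer normal. -/
lemma IsOuterNormal.eq_of_subset {A B : Set E3} {x n m : E3} (hA : IsOuterNormal A x n)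
    (hB : IsOuterNormal B x m) {r : ℝ} (hr : 0 < r)
    (h : ∀ y ∈ Metric.ball x r, y ∈ A → y ∈ B) : n = m :=
  eq_of_inner_neg_imp hA.1 hB.1 (hA.inner_neg_imp hB hr h)

lemma IsOuterNormal.unique {A : Set E3} {x n m : E3} (hA : IsOuterNormal A x n)
    (hB : IsOuterNormal A x m) : n = m :=
  hA.eq_of_subset hB one_pos fun _ _ h => h

/-- Disjoint sets have opposite outer normals. -/
lemma IsOuterNormal.eq_neg_of_disjoint {A B : Set E3} {x n m : E3} (hA : IsOuterNormal A x n)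
    (hB : IsOuterNormal B x m) (h : Disjoint A B) : m = -n := by
  symm
  apply eq_of_inner_neg_imp (by rw [norm_neg, hA.1]) hB.1
  intro v hv
  rw [inner_neg_left] at hv
  by_contra! hm
  obtain ⟨hn1, r₁, hr₁, h₁⟩ := hA
  obtain ⟨hm1, r₂, hr₂, h₂⟩ := hB
  -- Unless m = -n, the vector -(n + m) points strictly into both half-spaces, so that a short step
  -- along it reaches a common point of `A` and `B`.
  obtain ⟨n', hn'⟩ : ∃ v : E3, inner ℝ n v < 0 ∧ inner ℝ m v < 0 := by
    by_cases hc : inner ℝ n m = -1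
    · exfalso
      have : inner ℝ n (-m) = 1 := by rw [inner_neg_right, hc]; norm_num
      rw [inner_eq_one_iff_of_norm_eq_one (𝕜 := ℝ) hn1 (by rwa [norm_neg])] at this
      rw [this, inner_neg_left] at hv
      linarith
    · have hlt : -1 < inner ℝ n m := by
        refine lt_of_le_of_ne ?_ (Ne.symm hc)
        have := neg_le_of_abs_le (abs_real_inner_le_norm n m)
        rwa [hn1, hm1, one_mul] at this
      refine ⟨-(n + m), ?_, ?_⟩
      · rw [inner_neg_right, inner_add_right, inner_self_of_unit hn1]; linarith
      · rw [inner_neg_right, inner_add_right, inner_self_of_unit hm1, real_inner_comm]; linarith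
  obtain ⟨t, ht, hb⟩ := exists_pos_smul_add_mem_ball x n' (lt_min hr₁ hr₂)
  have hb1 := Metric.ball_subset_ball (min_le_left _ _) hb
  have hb2 := Metric.ball_subset_ball (min_le_right _ _) hb
  refine disjoint_left.1 h ((h₁ _ hb1).2 ?_) ((h₂ _ hb2).2 ?_)
  · simpa [inner_smul_right] using mul_neg_of_pos_of_neg ht hn'.1
  · simpa [inner_smul_right] using mul_neg_of_pos_of_neg ht hn'.2

/-- If sets with opposite outer normals are contained in a regular open set, then this set is
a neighbourhood of the point. -/
lemma IsOuterNormal.mem_of_neg {A B C : Set E3} {x n : E3} (hA : IsOuterNormal A x n)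
    (hB : IsOuterNormal B x (-n)) (hAC : A ⊆ C) (hBC : B ⊆ C)
    (hC : interior (closure C) ⊆ C) : x ∈ C := by
  obtain ⟨hn1, r₁, hr₁, h₁⟩ := hA
  obtain ⟨hm1, r₂, hr₂, h₂⟩ := hB
  apply hC
  rw [mem_interior]
  refine ⟨Metric.ball x (min r₁ r₂), ?_, Metric.isOpen_ball, Metric.mem_ball_self (lt_min hr₁ hr₂)⟩
  have hne : ∀ y ∈ Metric.ball x (min r₁ r₂), inner ℝ n (y - x) ≠ 0 → y ∈ C := by
    intro y hy h0
    rcases lt_or_gt_of_ne h0 with h | h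
    · exact hAC ((h₁ y (Metric.ball_subset_ball (min_le_left _ _) hy)).2 h)
    · exact hBC ((h₂ y (Metric.ball_subset_ball (min_le_right _ _) hy)).2 (by
        rw [inner_neg_left]; linarith))
  intro y hy
  by_cases h0 : inner ℝ n (y - x) = 0
  -- A point of the separating plane is approached along the normal by points of the two half-balls,
  -- which belong to `C`.
  · rw [Metric.mem_closure_iff]
    intro ε hε
    obtain ⟨ρ, hρ, hball⟩ := Metric.isOpen_ball.mem_nhds hy |> Metric.mem_nhds_iff.1
    obtain ⟨t, ht, hb⟩ := exists_pos_smul_add_mem_ball y n (lt_min hε hρ)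
    refine ⟨y + t • n, hne _ (hball (Metric.ball_subset_ball (min_le_right _ _) hb)) ?_, ?_⟩
    · rw [add_sub_right_comm, inner_add_right, h0, inner_smul_right, inner_self_of_unit hn1]
      simpa using ht.ne'
    · rw [dist_comm]
      exact Metric.ball_subset_ball (min_le_left _ _) hb
  · exact subset_closure (hne y hy h0)

/-- A boundary point that lies on exactly one of the planes is regular. -/
lemma PiecewiseFlat.isOuterNormal_of_unique {V : Set E3} (hV : PiecewiseFlat V)
    {S : Finset (Set E3)} (hS : ∀ Q ∈ S, IsPlane Q) (hVS : frontier V ⊆ ⋃ Q ∈ S, Q) {x ν : E3}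
    {c : ℝ} (hν : ‖ν‖ = 1) (hx : x ∈ frontier V) (hQ : plane ν c ∈ S) (hxQ : x ∈ plane ν c)
    (huniq : ∀ R ∈ S, x ∈ R → R = plane ν c) :
    IsOuterNormal V x ν ∨ IsOuterNormal V x (-ν) := by
  classical
  have hcl : IsClosed (⋃ R ∈ S.erase (plane ν c), R) :=
    (S.erase _).finite_toSet.isClosed_biUnion fun R hR => (hS R (Finset.mem_of_mem_erase hR)).isClosed
  have hxn : x ∈ (⋃ R ∈ S.erase (plane ν c), R)ᶜ := by
    intro h
    obtain ⟨R, hR, hxR⟩ := mem_iUnion₂.1 h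
    exact Finset.ne_of_mem_erase hR (huniq R (Finset.mem_of_mem_erase hR) hxR)
  obtain ⟨r, hr, hball⟩ := Metric.mem_nhds_iff.1 (hcl.isOpen_compl.mem_nhds hxn)
  -- All other planes keep a positive distance from x, so the frontier is flat in a small ball.
  have hfr : ∀ y ∈ Metric.ball x r, y ∈ frontier V → inner ℝ ν (y - x) = 0 := by
    intro y hy hyf
    obtain ⟨R, hR, hyR⟩ := mem_iUnion₂.1 (hVS hyf)
    by_cases h : R = plane ν c
    · rw [h] at hyR
      have h1 : inner ℝ ν y = c := hyR
      have h2 : inner ℝ ν x = c := hxQ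
      rw [inner_sub_right, h1, h2, sub_self]
    · exact absurd (mem_iUnion₂.2 ⟨R, Finset.mem_erase.2 ⟨h, hR⟩, hyR⟩) (hball hy)
  -- Each open half-ball is connected and misses the frontier, so it lies in `V` or in the exterior
  -- of `V`.
  have key : ∀ μ : E3, (μ = ν ∨ μ = -ν) →
      Metric.ball x r ∩ {y | 0 < inner ℝ μ (y - x)} ⊆ V ∨
      Metric.ball x r ∩ {y | 0 < inner ℝ μ (y - x)} ⊆ (closure V)ᶜ := by
    intro μ hμ
    apply IsPreconnected.subset_or_subset hV.isOpen isClosed_closure.isOpen_compl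
    · exact disjoint_compl_right.mono_left subset_closure |>.mono_right le_rfl
    · rintro y ⟨hy1, hy2⟩
      by_contra hcon
      simp only [mem_union, mem_compl_iff, not_or, not_not] at hcon
      have : y ∈ frontier V := by
        rw [hV.isOpen.frontier_eq]; exact ⟨hcon.2, hcon.1⟩
      have h0 := hfr y hy1 this
      simp only [mem_ofPred_eq] at hy2
      rcases hμ with rfl | rfl
      · linarith
      · rw [inner_neg_left] at hy2; linarith
    · apply Convex.isPreconnected
      apply (convex_ball x r).inter
      have : {y : E3 | 0 < inner ℝ μ (y - x)} = {y | inner ℝ μ x < innerₛₗ ℝ μ y} := by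
        ext y; simp [inner_sub_right]
      rw [this]
      exact convex_halfSpace_gt (innerₛₗ ℝ μ).isLinear _
  have hclose : ∀ y ∈ Metric.ball x r, inner ℝ ν (y - x) = 0 → ∀ μ : E3, (μ = ν ∨ μ = -ν) →
      ∀ U, IsOpen U → y ∈ U → (U ∩ (Metric.ball x r ∩ {y | 0 < inner ℝ μ (y - x)})).Nonempty := by
    intro y hy h0 μ hμ U hU hyU
    obtain ⟨ρ, hρ, hsub⟩ := Metric.mem_nhds_iff.1 ((hU.inter Metric.isOpen_ball).mem_nhds ⟨hyU, hy⟩)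
    obtain ⟨t, ht, hb⟩ := exists_pos_smul_add_mem_ball y μ hρ
    have hμ1 : ‖μ‖ = 1 := by rcases hμ with rfl | rfl <;> simp [hν]
    have h0' : inner ℝ μ (y - x) = 0 := by
      rcases hμ with rfl | rfl
      · exact h0
      · rw [inner_neg_left, h0, neg_zero]
    refine ⟨y + t • μ, (hsub hb).1, (hsub hb).2, ?_⟩
    simp only [mem_ofPred_eq]
    rw [add_sub_right_comm, inner_add_right, h0', inner_smul_right, inner_self_of_unit hμ1]
    simpa using ht
  have hxnV := hV.notMem_of_mem_frontier hx
  have hxcl := frontier_subset_closure hx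
  have hxball : x ∈ Metric.ball x r := Metric.mem_ball_self hr
  have hxx : inner ℝ ν (x - x) = 0 := by simp
  -- Both halves inside contradicts regular openness at x, and both outside contradicts that x is in
  -- the closure. The two mixed cases give the two possible normals.
  rcases key ν (.inl rfl) with hp | hp <;> rcases key (-ν) (.inr rfl) with hm | hm
  · exfalso
    apply hxnV
    apply hV.interior_closure_subset
    rw [mem_interior]
    refine ⟨Metric.ball x r, ?_, Metric.isOpen_ball, hxball⟩
    intro y hy
    by_cases h0 : inner ℝ ν (y - x) = 0
    · rw [mem_closure_iff]
      intro U hU hyU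
      exact (hclose y hy h0 ν (.inl rfl) U hU hyU).mono (inter_subset_inter_right _ hp)
    · apply subset_closure
      rcases lt_or_gt_of_ne h0 with h | h
      · exact hm ⟨hy, by simp only [mem_ofPred_eq, inner_neg_left]; linarith⟩
      · exact hp ⟨hy, h⟩
  · right
    refine ⟨by simpa using hν, r, hr, fun y hy => ?_⟩
    rw [inner_neg_left, neg_lt_zero]
    refine ⟨fun hyV => ?_, fun h => hp ⟨hy, h⟩⟩
    by_contra! hle
    rcases hle.lt_or_eq with h | h
    · exact hm ⟨hy, by simp only [mem_ofPred_eq, inner_neg_left]; linarith⟩ (subset_closure hyV)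
    · obtain ⟨z, hz1, hz2⟩ := hclose y hy h (-ν) (.inr rfl) V hV.isOpen hyV
      exact hm hz2 (subset_closure hz1)
  · left
    refine ⟨hν, r, hr, fun y hy => ?_⟩
    refine ⟨fun hyV => ?_, fun h => hm ⟨hy, by simp only [mem_ofPred_eq, inner_neg_left]; linarith⟩⟩
    by_contra! hle
    rcases hle.lt_or_eq with h | h
    · exact hp ⟨hy, h⟩ (subset_closure hyV)
    · obtain ⟨z, hz1, hz2⟩ := hclose y hy h.symm ν (.inl rfl) V hV.isOpen hyV
      exact hp hz2 (subset_closure hz1)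
  · exfalso
    obtain ⟨y, hyb, hyV⟩ := mem_closure_iff.1 hxcl _ Metric.isOpen_ball hxball
    by_cases h0 : inner ℝ ν (y - x) = 0
    · obtain ⟨z, hz1, hz2⟩ := hclose y hyb h0 ν (.inl rfl) V hV.isOpen hyV
      exact hp hz2 (subset_closure hz1)
    · rcases lt_or_gt_of_ne h0 with h | h
      · exact hm ⟨hyb, by simp only [mem_ofPred_eq, inner_neg_left]; linarith⟩ (subset_closure hyV)
      · exact hp ⟨hyb, h⟩ (subset_closure hyV)

/-- Almost every boundary point is regular. -/
lemma PiecewiseFlat.ae_isOuterNormal {V : Set E3} (hV : PiecewiseFlat V) :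
    ∀ᵐ x ∂surf, x ∈ frontier V → ∃ n, IsOuterNormal V x n := by
  obtain ⟨S, hS1, hS2⟩ := hV.exists_planes
  filter_upwards [ae_unique_plane S hS1] with x hx hxf
  obtain ⟨Q, hQ, hxQ⟩ := mem_iUnion₂.1 (hS2 hxf)
  obtain ⟨ν, c, hν, rfl⟩ := hS1 Q hQ
  rcases hV.isOuterNormal_of_unique hS1 hS2 hν hxf hQ hxQ
    (fun R hR hxR => hx R hR _ hQ hxR hxQ) with h | h
  exacts [⟨_, h⟩, ⟨_, h⟩]

lemma isOuterNormal_outerNormal {A : Set E3} {x : E3} (h : ∃ n, IsOuterNormal A x n) :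
    IsOuterNormal A x (outerNormal A x) := by
  unfold outerNormal
  rw [dif_pos h]
  exact h.choose_spec

/-! ### The closure relation for view factors -/

lemma lintegral_cone_at {ν : E3} (hν : ‖ν‖ = 1) {c : ℝ} (x : E3) (hc : c - inner ℝ ν x ≠ 0)
    {g : E3 → ℝ≥0∞} (hg : Measurable g) :
    ∫⁻ z in {z | 0 < (c - inner ℝ ν x) * inner ℝ ν z}, g z =
      ∫⁻ y in plane ν c, (∫⁻ t in Ioi (0 : ℝ),
        g (t • (y - x)) * ENNReal.ofReal (t ^ 2 * |c - inner ℝ ν x|)) ∂surf := by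
  rw [lintegral_cone hν hc hg]
  have hmp : MeasurePreserving (fun y : E3 => y + x) surf surf := by
    unfold surf
    exact measurePreserving_add_right _ x
  have hpre : (fun y : E3 => y + x) ⁻¹' plane ν c = plane ν (c - inner ℝ ν x) := by
    ext y
    simp only [plane, mem_preimage, mem_ofPred_eq, inner_add_right]
    constructor <;> intro h <;> linarith
  have h := hmp.setLIntegral_comp_preimage_emb (Homeomorph.addRight x).measurableEmbedding
    (fun y => ∫⁻ t in Ioi (0 : ℝ),
      g (t • (y - x)) * ENNReal.ofReal (t ^ 2 * |c - inner ℝ ν x|)) (plane ν c)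
  rw [hpre] at h
  rw [← h]
  simp only [add_sub_cancel_right]

/-! ### Visibility and rays -/

lemma isOpen_forall_mem_segment {V : Set E3} (hV : IsOpen V) (a b : ℝ) :
    IsOpen {p : E3 × E3 | ∀ t ∈ Icc a b, p.1 + t • (p.2 - p.1) ∈ V} := by
  rw [isOpen_iff_eventually]
  intro p hp
  refine (isCompact_Icc (a := a) (b := b)).eventually_forall_of_forall_eventually fun t ht => ?_
  have hcont : Continuous fun q : (E3 × E3) × ℝ => q.1.1 + q.2 • (q.1.2 - q.1.1) := by fun_prop
  exact (hV.preimage hcont).mem_nhds (hp t ht)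

lemma openSegment_subset_iff {V : Set E3} {x y : E3} :
    openSegment ℝ x y ⊆ V ↔ ∀ t ∈ Ioo (0 : ℝ) 1, x + t • (y - x) ∈ V := by
  rw [openSegment_eq_image']
  exact image_subset_iff

/-- The open segment is exhausted by countably many compact subsegments. For each of them the
condition is open in the pair of endpoints by compactness. -/
lemma measurableSet_visible {V : Set E3} (hV : IsOpen V) :
    MeasurableSet {p : E3 × E3 | openSegment ℝ p.1 p.2 ⊆ V} := by
  have : {p : E3 × E3 | openSegment ℝ p.1 p.2 ⊆ V} =
      ⋂ n : ℕ, {p : E3 × E3 | ∀ t ∈ Icc (1 / ((n : ℝ) + 1)) (1 - 1 / ((n : ℝ) + 1)),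
        p.1 + t • (p.2 - p.1) ∈ V} := by
    ext p
    simp only [mem_ofPred_eq, mem_iInter, openSegment_subset_iff]
    constructor
    · intro h n t ht
      have : (0 : ℝ) < 1 / ((n : ℝ) + 1) := by positivity
      exact h t ⟨by linarith [ht.1], by linarith [ht.2]⟩
    · intro h t ht
      obtain ⟨n, hn⟩ := exists_nat_one_div_lt (lt_min ht.1 (sub_pos.2 ht.2))
      have h1 := hn.le.trans (min_le_left _ _)
      have h2 := hn.le.trans (min_le_right _ _)
      exact h n t ⟨h1, by linarith⟩
  rw [this]
  exact MeasurableSet.iInter fun n => (isOpen_forall_mem_segment hV _ _).measurableSet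

lemma IsOuterNormal.inner_pos_of_visible {V : Set E3} {x y n : E3}
    (hx : IsOuterNormal V x (-n)) (hxy : openSegment ℝ x y ⊆ V) : 0 < inner ℝ n (y - x) := by
  obtain ⟨-, r, hr, h⟩ := hx
  obtain ⟨t, ht, hb⟩ := exists_pos_smul_add_mem_ball x (y - x) hr
  -- The cap 1/2 keeps the parameter strictly inside (0, 1), hence on the open segment.
  set s := min t (1 / 2) with hs
  have hs0 : 0 < s := lt_min ht (by norm_num)
  have hs1 : s < 1 := (min_le_right _ _).trans_lt (by norm_num)
  have hsb : x + s • (y - x) ∈ Metric.ball x r := by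
    rw [mem_ball_iff_norm, add_sub_cancel_left, norm_smul, Real.norm_of_nonneg hs0.le] at *
    rw [Real.norm_of_nonneg ht.le] at hb
    exact (mul_le_mul_of_nonneg_right (min_le_left _ _) (norm_nonneg _)).trans_lt hb
  have h1 := (h _ hsb).1 (openSegment_subset_iff.1 hxy s ⟨hs0, hs1⟩)
  rw [add_sub_cancel_left, inner_smul_right, inner_neg_left] at h1
  by_contra! h2
  nlinarith

/-- A ray that starts into an open bounded set leaves this set. -/
lemma IsOuterNormal.exists_visible {V : Set E3} (ho : IsOpen V) (hb : Bornology.IsBounded V)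
    {x n z : E3} (hx : IsOuterNormal V x (-n)) (hz : 0 < inner ℝ n z) :
    ∃ t : ℝ, 0 < t ∧ x + t • z ∈ frontier V ∧ openSegment ℝ x (x + t • z) ⊆ V := by
  obtain ⟨-, r, hr, h⟩ := hx
  obtain ⟨δ, hδ, hδb⟩ := exists_pos_smul_add_mem_ball x z hr
  have hsmall : ∀ s, 0 < s → s ≤ δ → x + s • z ∈ V := by
    intro s hs hsδ
    apply (h _ _).2
    · rw [add_sub_cancel_left, inner_smul_right, inner_neg_left]
      nlinarith
    · rw [mem_ball_iff_norm, add_sub_cancel_left, norm_smul, Real.norm_of_nonneg hs.le]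
      rw [mem_ball_iff_norm, add_sub_cancel_left, norm_smul, Real.norm_of_nonneg hδ.le] at hδb
      exact (mul_le_mul_of_nonneg_right hsδ (norm_nonneg _)).trans_lt hδb
  have hz0 : z ≠ 0 := by rintro rfl; simp at hz
  -- Exit parameters. The bound δ, below which the ray stays in `V`, excludes the starting point
  -- itself and makes the first exit parameter positive.
  set T : Set ℝ := {t | δ ≤ t ∧ x + t • z ∉ V} with hT
  have hTc : IsClosed T := by
    have hc : Continuous fun t : ℝ => x + t • z := by fun_prop
    exact isClosed_Ici.inter (ho.isClosed_compl.preimage hc)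
  have hTne : T.Nonempty := by
    obtain ⟨R, hR⟩ := hb.subset_ball x
    have hzn : 0 < ‖z‖ := norm_pos_iff.2 hz0
    refine ⟨max δ (R / ‖z‖), le_max_left _ _, fun hmem => ?_⟩
    have := hR hmem
    rw [mem_ball_iff_norm, add_sub_cancel_left, norm_smul,
      Real.norm_of_nonneg (hδ.le.trans (le_max_left _ _))] at this
    have h2 : R ≤ max δ (R / ‖z‖) * ‖z‖ := by
      rw [← div_le_iff₀ hzn]; exact le_max_right _ _
    linarith
  have hTb : BddBelow T := ⟨δ, fun t ht => ht.1⟩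
  have hmem := hTc.csInf_mem hTne hTb
  set t₀ := sInf T
  have ht0 : 0 < t₀ := hδ.trans_le hmem.1
  have hin : ∀ s, 0 < s → s < t₀ → x + s • z ∈ V := by
    intro s hs hst
    by_contra hcon
    rcases le_total s δ with h1 | h1
    · exact hcon (hsmall s hs h1)
    · exact absurd (csInf_le hTb ⟨h1, hcon⟩) (not_le.2 hst)
  have hseg : openSegment ℝ x (x + t₀ • z) ⊆ V := by
    rw [openSegment_subset_iff]
    intro s hs
    rw [add_sub_cancel_left, smul_smul]
    exact hin _ (mul_pos hs.1 ht0) (by nlinarith [hs.2])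
  refine ⟨t₀, ht0, ?_, hseg⟩
  rw [ho.frontier_eq]
  refine ⟨closure_mono hseg ?_, hmem.2⟩
  rw [closure_openSegment]
  exact right_mem_segment ℝ _ _

/-- Of two different exit points on one ray, the nearer would be an inner point of the visible
segment to the farther one, hence in `V`. -/
lemma visible_unique {V : Set E3} {x z : E3} {s t : ℝ} (hs : 0 < s) (ht : 0 < t)
    (hsV : x + s • z ∉ V) (htV : x + t • z ∉ V) (hs' : openSegment ℝ x (x + s • z) ⊆ V)
    (ht' : openSegment ℝ x (x + t • z) ⊆ V) : s = t := by
  have key : ∀ a b : ℝ, 0 < a → a < b → openSegment ℝ x (x + b • z) ⊆ V → x + a • z ∈ V := by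
    intro a b ha hab h
    have := openSegment_subset_iff.1 h (a / b) ⟨div_pos ha (ha.trans hab),
      (div_lt_one (ha.trans hab)).2 hab⟩
    rwa [add_sub_cancel_left, smul_smul, div_mul_cancel₀ _ (ha.trans hab).ne'] at this
  rcases lt_trichotomy s t with h | h | h
  · exact absurd (key s t hs h ht') hsV
  · exact h
  · exact absurd (key t s ht h hs') htV

/-- Finitely many distinct planes, with unit normals. -/
structure PlaneFamily where
  planes : Finset (Set E3)
  normal : Set E3 → E3
  offset : Set E3 → ℝ
  norm_normal : ∀ Q ∈ planes, ‖normal Q‖ = 1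
  eq_plane : ∀ Q ∈ planes, Q = plane (normal Q) (offset Q)

namespace PlaneFamily

variable (F : PlaneFamily)

lemma isPlane {Q : Set E3} (hQ : Q ∈ F.planes) : IsPlane Q :=
  ⟨_, _, F.norm_normal Q hQ, F.eq_plane Q hQ⟩

lemma inner_eq_offset {Q : Set E3} (hQ : Q ∈ F.planes) {x : E3} :
    x ∈ Q ↔ inner ℝ (F.normal Q) x = F.offset Q := by
  conv_lhs => rw [F.eq_plane Q hQ]
  rfl

open Classical in
/-- The modulus of the normal component of `v` at the point `x` of the planes. -/
def absNormal (x v : E3) : ℝ :=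
  ∑ Q ∈ F.planes, Q.indicator (fun _ => |inner ℝ (F.normal Q) v|) x

/-- The point `x` lies on at most one of the planes. -/
def IsGeneric (x : E3) : Prop := ∀ Q ∈ F.planes, ∀ R ∈ F.planes, x ∈ Q → x ∈ R → Q = R

lemma ae_isGeneric : ∀ᵐ x ∂surf, F.IsGeneric x := ae_unique_plane F.planes fun _ h => F.isPlane h

lemma absNormal_nonneg (x v : E3) : 0 ≤ F.absNormal x v :=
  Finset.sum_nonneg fun _ _ => indicator_nonneg (fun _ _ => abs_nonneg _) _

lemma absNormal_eq {x : E3} (hx : F.IsGeneric x) {Q : Set E3} (hQ : Q ∈ F.planes) (hxQ : x ∈ Q)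
    (v : E3) : F.absNormal x v = |inner ℝ (F.normal Q) v| := by
  unfold absNormal
  rw [Finset.sum_eq_single_of_mem Q hQ, indicator_of_mem hxQ]
  intro R hR hne
  exact indicator_of_notMem (fun hxR => hne (hx R hR Q hQ hxR hxQ)) _

/-- This is the reason for working with `absNormal`: `outerNormal` is chosen point by point, whereas
a finite sum of indicators on closed planes is clearly measurable. The lost sign is recovered from
visibility. -/
lemma measurable_absNormal : Measurable fun p : E3 × E3 => F.absNormal p.1 p.2 := by
  unfold absNormal
  refine Finset.measurable_sum _ fun Q hQ => ?_
  have : (fun p : E3 × E3 => Q.indicator (fun _ => |inner ℝ (F.normal Q) p.2|) p.1) =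
      (Prod.fst ⁻¹' Q).indicator fun p : E3 × E3 => |inner ℝ (F.normal Q) p.2| := by
    ext p; rfl
  rw [this]
  exact Measurable.indicator (by fun_prop) (measurable_fst (F.isPlane hQ).isClosed.measurableSet)

/-- The view factor, expressed by the planes. -/
def kernel (x y : E3) : ℝ :=
  F.absNormal x (y - x) * F.absNormal y (y - x) / (Real.pi * (inner ℝ (y - x) (y - x)) ^ 2)

lemma kernel_nonneg (x y : E3) : 0 ≤ F.kernel x y :=
  div_nonneg (mul_nonneg (F.absNormal_nonneg _ _) (F.absNormal_nonneg _ _))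
    (mul_nonneg Real.pi_pos.le (sq_nonneg _))

lemma measurable_kernel : Measurable fun p : E3 × E3 => F.kernel p.1 p.2 := by
  unfold kernel
  have g1 : Measurable fun p : E3 × E3 => (p.1, p.2 - p.1) := by fun_prop
  have g2 : Measurable fun p : E3 × E3 => (p.2, p.2 - p.1) := by fun_prop
  have h1 := F.measurable_absNormal.comp g1
  have h2 := F.measurable_absNormal.comp g2
  have h3 : Measurable fun p : E3 × E3 =>
      Real.pi * (inner ℝ (p.2 - p.1) (p.2 - p.1)) ^ 2 := by fun_prop
  exact (h1.mul h2).div h3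

/-- The transport kernel, i.e. the product of the visibility factor and the view factor. -/
def transport (V : Set E3) (x y : E3) : ℝ≥0∞ :=
  {p : E3 × E3 | openSegment ℝ p.1 p.2 ⊆ V}.indicator
    (fun p => ENNReal.ofReal (F.kernel p.1 p.2)) (x, y)

lemma measurable_transport {V : Set E3} (hV : IsOpen V) :
    Measurable fun p : E3 × E3 => F.transport V p.1 p.2 :=
  (F.measurable_kernel.ennreal_ofReal).indicator (measurableSet_visible hV)

/-- The planes cover the boundary of the set. -/
def Covers (V : Set E3) : Prop := frontier V ⊆ ⋃ Q ∈ F.planes, Q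

/-- At a generic frontier point the outer normal is, up to sign, the normal of the only plane
through the point. -/
lemma absNormal_eq_of_isOuterNormal {V : Set E3} (hV : PiecewiseFlat V) (hF : F.Covers V) {x n : E3}
    (hxV : x ∈ frontier V) (hx : F.IsGeneric x) (hn : IsOuterNormal V x (-n)) (v : E3) :
    F.absNormal x v = |inner ℝ n v| := by
  obtain ⟨Q, hQ, hxQ⟩ := mem_iUnion₂.1 (hF hxV)
  rw [F.absNormal_eq hx hQ hxQ]
  have hQ' := F.eq_plane Q hQ
  have hQ1 : plane (F.normal Q) (F.offset Q) ∈ F.planes := by rw [← hQ']; exact hQ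
  have hQ2 : x ∈ plane (F.normal Q) (F.offset Q) := by rw [← hQ']; exact hxQ
  rcases hV.isOuterNormal_of_unique (fun R hR => F.isPlane hR) hF (F.norm_normal Q hQ) hxV
    hQ1 hQ2 (fun R hR hxR => hx R hR _ hQ1 hxR hQ2) with h | h
  · rw [← hn.unique h, inner_neg_left, abs_neg]
  · rw [neg_inj.1 (hn.unique h)]

end PlaneFamily

lemma PiecewiseFlat.exists_planeFamily {V : Set E3} (hV : PiecewiseFlat V) :
    ∃ F : PlaneFamily, F.Covers V := by
  obtain ⟨S, hS1, hS2⟩ := hV.exists_planes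
  choose! ν c h1 h2 using hS1
  exact ⟨⟨S, ν, c, h1, h2⟩, hS2⟩

section Closure

variable {V : Set E3} (F : PlaneFamily) (x n : E3)

/-- The directions in which one sees a boundary point on the plane `Q` from `x`. -/
def PlaneFamily.directions (V : Set E3) (Q : Set E3) : Set E3 :=
  {z | 0 < (F.offset Q - inner ℝ (F.normal Q) x) * inner ℝ (F.normal Q) z ∧ 0 < inner ℝ n z ∧
    -- The quotient is the parameter at which the ray from x along z hits `Q`; the first condition
    -- makes it positive.
    x + ((F.offset Q - inner ℝ (F.normal Q) x) / inner ℝ (F.normal Q) z) • z ∈ frontier V ∧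
    openSegment ℝ x
      (x + ((F.offset Q - inner ℝ (F.normal Q) x) / inner ℝ (F.normal Q) z) • z) ⊆ V}

lemma PlaneFamily.measurableSet_directions (hV : IsOpen V) (Q : Set E3) :
    MeasurableSet (F.directions x n V Q) := by
  have hm : Measurable fun z : E3 =>
      x + ((F.offset Q - inner ℝ (F.normal Q) x) / inner ℝ (F.normal Q) z) • z := by fun_prop
  have h1 : Measurable fun z : E3 =>
      (F.offset Q - inner ℝ (F.normal Q) x) * inner ℝ (F.normal Q) z := by fun_prop
  have h2 : Measurable fun z : E3 => inner ℝ n z := by fun_prop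
  refine (measurableSet_lt measurable_const h1).inter
    ((measurableSet_lt measurable_const h2).inter
      ((hm isClosed_frontier.measurableSet).inter ?_))
  exact (measurable_const.prodMk hm : Measurable fun z : E3 => (x, _)) (measurableSet_visible hV)

variable {F x n}

/-- A ray that starts into `V` has exactly one visible exit point, and this point lies on one of the
planes. It is counted twice only if the ray meets two planes at the same point, which happens for a
null set of directions. -/
lemma PlaneFamily.ae_sum_directions (hV : PiecewiseFlat V) (hF : F.Covers V)
    (hx : IsOuterNormal V x (-n)) (g : E3 → ℝ≥0∞) :
    ∀ᵐ z : E3, {z : E3 | 0 < inner ℝ n z}.indicator g z =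
      ∑ Q ∈ F.planes, (F.directions x n V Q).indicator g z := by
  classical
  have h1 : ∀ᵐ z : E3, ∀ Q ∈ F.planes, inner ℝ (F.normal Q) z ≠ 0 := by
    simp only [Filter.eventually_all_finset]
    intro Q hQ
    exact measure_eq_zero_iff_ae_notMem.1
      (volume_plane (norm_ne_zero_iff.1 (by simp [F.norm_normal Q hQ])) 0)
  -- Equal hitting parameters for `Q` and `R` amount to a homogeneous linear equation for z. For
  -- planes off x this equation is trivial only if `Q = R`.
  have h2 : ∀ᵐ z : E3, ∀ Q ∈ F.planes, ∀ R ∈ F.planes,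
      F.offset Q - inner ℝ (F.normal Q) x ≠ 0 → F.offset R - inner ℝ (F.normal R) x ≠ 0 →
      (F.offset Q - inner ℝ (F.normal Q) x) * inner ℝ (F.normal R) z =
        (F.offset R - inner ℝ (F.normal R) x) * inner ℝ (F.normal Q) z → Q = R := by
    simp only [Filter.eventually_all_finset]
    intro Q hQ R hR
    set a := F.offset Q - inner ℝ (F.normal Q) x with ha
    set b := F.offset R - inner ℝ (F.normal R) x with hb
    by_cases h0 : a • F.normal R - b • F.normal Q = 0
    · refine .of_forall fun z ha0 hb0 _ => ?_
      ext y
      rw [F.inner_eq_offset hQ, F.inner_eq_offset hR]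
      have h3 : a * inner ℝ (F.normal R) (y - x) = b * inner ℝ (F.normal Q) (y - x) := by
        have := congrArg (fun w => inner ℝ w (y - x)) h0
        simp only [inner_sub_left, inner_smul_left, inner_zero_left] at this
        simpa [sub_eq_zero, inner_sub_right] using this
      have e1 : inner ℝ (F.normal Q) y = F.offset Q ↔ inner ℝ (F.normal Q) (y - x) = a := by
        rw [inner_sub_right, ha]; constructor <;> intro h <;> linarith
      have e2 : inner ℝ (F.normal R) y = F.offset R ↔ inner ℝ (F.normal R) (y - x) = b := by
        rw [inner_sub_right, hb]; constructor <;> intro h <;> linarith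
      rw [e1, e2]
      constructor
      · intro h; rw [h, mul_comm b] at h3; exact mul_left_cancel₀ ha0 h3
      · intro h; rw [h, mul_comm a] at h3; exact (mul_left_cancel₀ hb0 h3).symm
    · have := measure_eq_zero_iff_ae_notMem.1 (volume_plane h0 0)
      filter_upwards [this] with z hz _ _ heq
      exfalso
      apply hz
      simp only [plane, mem_ofPred_eq, inner_sub_left, inner_smul_left]
      simpa [sub_eq_zero] using heq
  filter_upwards [h1, h2] with z hz1 hz2
  by_cases hz : 0 < inner ℝ n z
  · rw [indicator_of_mem (show z ∈ {z : E3 | 0 < inner ℝ n z} from hz)]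
    obtain ⟨t, ht, hfr, hseg⟩ := hx.exists_visible hV.isOpen hV.isBounded hz
    obtain ⟨Q, hQ, hyQ⟩ := mem_iUnion₂.1 (hF hfr)
    have hne := hz1 Q hQ
    rw [F.inner_eq_offset hQ, inner_add_right, inner_smul_right] at hyQ
    have hoff : F.offset Q - inner ℝ (F.normal Q) x = t * inner ℝ (F.normal Q) z := by linarith
    have hteq : (F.offset Q - inner ℝ (F.normal Q) x) / inner ℝ (F.normal Q) z = t := by
      rw [hoff, mul_div_cancel_right₀ _ hne]
    have hmem : z ∈ F.directions x n V Q := by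
      refine ⟨?_, hz, ?_, ?_⟩
      · rw [hoff, mul_assoc]
        exact mul_pos ht (mul_self_pos.2 hne)
      · rwa [hteq]
      · rwa [hteq]
    rw [Finset.sum_eq_single_of_mem Q hQ, indicator_of_mem hmem]
    intro R hR hRQ
    refine indicator_of_notMem (fun hmR => hRQ ?_) _
    obtain ⟨r1, -, r3, r4⟩ := hmR
    have hR0 : F.offset R - inner ℝ (F.normal R) x ≠ 0 := left_ne_zero_of_mul r1.ne'
    have hQ0 : F.offset Q - inner ℝ (F.normal Q) x ≠ 0 := by
      rw [hoff]; exact mul_ne_zero ht.ne' hne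
    have hRne := hz1 R hR
    have hpos : 0 < (F.offset R - inner ℝ (F.normal R) x) / inner ℝ (F.normal R) z := by
      rcases mul_pos_iff.1 r1 with ⟨p, q⟩ | ⟨p, q⟩
      · exact div_pos p q
      · exact div_pos_of_neg_of_neg p q
    have heq := visible_unique hpos ht (hV.notMem_of_mem_frontier r3)
      (hV.notMem_of_mem_frontier hfr) r4 hseg
    apply hz2 R hR Q hQ hR0 hQ0
    rw [div_eq_iff hRne] at heq
    rw [heq, hoff]
    ring
  · rw [indicator_of_notMem (show z ∉ {z : E3 | 0 < inner ℝ n z} from hz)]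
    symm
    refine Finset.sum_eq_zero fun Q _ => indicator_of_notMem (fun h => hz h.2.1) _

/-- Cone coordinates z = t • (y - x) over `Q`. The t-integral is that of t³ exp(-bt²) with b = |y -
x|² and equals 1/(2b²), which produces the fourth power of the distance in the view factor. -/
lemma PlaneFamily.lintegral_directions (hV : PiecewiseFlat V)
    (hx : IsOuterNormal V x (-n)) {Q : Set E3} (hQ : Q ∈ F.planes) :
    ∫⁻ z, (F.directions x n V Q).indicator
        (fun z => ENNReal.ofReal (inner ℝ n z * Real.exp (-‖z‖ ^ 2))) z =
      ∫⁻ y in Q, {y | y ∈ frontier V ∧ openSegment ℝ x y ⊆ V}.indicator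
        (fun y => ENNReal.ofReal (|inner ℝ n (y - x)| * |inner ℝ (F.normal Q) (y - x)| /
          (2 * (inner ℝ (y - x) (y - x)) ^ 2))) y ∂surf := by
  set a := F.offset Q - inner ℝ (F.normal Q) x with ha
  have hyQ : ∀ y ∈ Q, inner ℝ (F.normal Q) (y - x) = a := fun y hy => by
    rw [inner_sub_right, (F.inner_eq_offset hQ).1 hy]
  have hmQ : MeasurableSet Q := (F.isPlane hQ).isClosed.measurableSet
  by_cases h0 : a = 0
  -- If x lies on `Q`, no direction is counted, and the integrand on the right vanishes as well
  -- because y - x is parallel to `Q`.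
  · rw [show F.directions x n V Q = ∅ by
      ext z; simp [PlaneFamily.directions, ← ha, h0]]
    have h1 : ∀ z, (∅ : Set E3).indicator
        (fun z => ENNReal.ofReal (inner ℝ n z * Real.exp (-‖z‖ ^ 2))) z = 0 := fun z =>
      indicator_of_notMem (notMem_empty z) _
    simp only [h1, lintegral_zero]
    symm
    rw [setLIntegral_eq_zero hmQ]
    intro y hy
    refine indicator_apply_eq_zero.2 fun _ => ?_
    simp only [hyQ y hy, h0, abs_zero, mul_zero, zero_div, ENNReal.ofReal_zero]
  have hg : Measurable fun z : E3 => ENNReal.ofReal (inner ℝ n z * Real.exp (-‖z‖ ^ 2)) := by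
    fun_prop
  have hsub : F.directions x n V Q ⊆ {z | 0 < a * inner ℝ (F.normal Q) z} := fun z hz => hz.1
  have hmd := F.measurableSet_directions x n hV.isOpen Q
  have e1 : ∫⁻ z, (F.directions x n V Q).indicator
      (fun z => ENNReal.ofReal (inner ℝ n z * Real.exp (-‖z‖ ^ 2))) z =
      ∫⁻ z in {z | 0 < a * inner ℝ (F.normal Q) z}, (F.directions x n V Q).indicator
        (fun z => ENNReal.ofReal (inner ℝ n z * Real.exp (-‖z‖ ^ 2))) z := by
    rw [← lintegral_indicator (measurableSet_lt measurable_const (by fun_prop))]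
    congr 1
    ext z
    rw [indicator_indicator, inter_eq_right.2 hsub]
  rw [e1, lintegral_cone_at (F.norm_normal Q hQ) x h0 (hg.indicator hmd), ← F.eq_plane Q hQ]
  refine setLIntegral_congr_fun hmQ fun y hy => ?_
  have hy' := hyQ y hy
  have hit : ∀ t : ℝ, 0 < t → x + (a / inner ℝ (F.normal Q) (t • (y - x))) • (t • (y - x)) = y := by
    intro t ht
    rw [inner_smul_right, hy', smul_smul]
    have : a / (t * a) * t = 1 := by field_simp
    rw [this, one_smul, add_sub_cancel]
  by_cases hvis : y ∈ frontier V ∧ openSegment ℝ x y ⊆ V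
  · rw [indicator_of_mem (show y ∈ {y | y ∈ frontier V ∧ openSegment ℝ x y ⊆ V} from hvis)]
    have hpos := hx.inner_pos_of_visible hvis.2
    have hyx : y - x ≠ 0 := by rintro h; rw [h] at hpos; simp at hpos
    have hsq : 0 < inner ℝ (y - x) (y - x) := real_inner_self_pos.2 hyx
    have hpt : ∀ t ∈ Ioi (0 : ℝ), (F.directions x n V Q).indicator
        (fun z => ENNReal.ofReal (inner ℝ n z * Real.exp (-‖z‖ ^ 2))) (t • (y - x)) *
          ENNReal.ofReal (t ^ 2 * |a|) =
        ENNReal.ofReal (inner ℝ n (y - x) * |a|) *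
          ENNReal.ofReal (t ^ 3 * Real.exp (-(inner ℝ (y - x) (y - x)) * t ^ 2)) := by
      intro t ht
      have ht : 0 < t := ht
      rw [indicator_of_mem]
      · rw [← ENNReal.ofReal_mul (by rw [inner_smul_right]; positivity),
          ← ENNReal.ofReal_mul (by positivity)]
        congr 1
        rw [inner_smul_right, norm_smul, Real.norm_of_nonneg ht.le, mul_pow,
          real_inner_self_eq_norm_sq]
        ring_nf
      · refine ⟨?_, ?_, ?_, ?_⟩
        · rw [inner_smul_right, hy', ← ha, mul_left_comm]
          exact mul_pos ht (mul_self_pos.2 h0)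
        · rw [inner_smul_right]; positivity
        · rw [← ha, hit t ht]; exact hvis.1
        · rw [← ha, hit t ht]; exact hvis.2
    rw [setLIntegral_congr_fun measurableSet_Ioi hpt, lintegral_const_mul _ (by fun_prop),
      lintegral_cube_mul_exp_neg_sq hsq, ← ENNReal.ofReal_mul (by positivity), hy',
      abs_of_pos hpos]
    congr 1
    ring
  · rw [indicator_of_notMem (show y ∉ {y | y ∈ frontier V ∧ openSegment ℝ x y ⊆ V} from hvis)]
    rw [setLIntegral_eq_zero measurableSet_Ioi]
    intro t ht
    have ht : 0 < t := ht
    change (F.directions x n V Q).indicator _ (t • (y - x)) * _ = 0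
    rw [indicator_of_notMem]
    · simp
    · rintro ⟨-, -, h3, h4⟩
      rw [← ha, hit t ht] at h3 h4
      exact hvis ⟨h3, h4⟩

/-- The closure relation: a boundary point radiates into its closed surroundings only. -/
lemma PlaneFamily.lintegral_transport (hV : PiecewiseFlat V) (hF : F.Covers V)
    (hxV : x ∈ frontier V) (hxg : F.IsGeneric x) (hx : IsOuterNormal V x (-n)) :
    ∫⁻ y in frontier V, F.transport V x y ∂surf = 1 := by
  have hn : ‖n‖ = 1 := by have := hx.1; rwa [norm_neg] at this
  have hg : Measurable fun z : E3 => ENNReal.ofReal (inner ℝ n z * Real.exp (-‖z‖ ^ 2)) := by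
    fun_prop
  have hvis : MeasurableSet {y | openSegment ℝ x y ⊆ V} :=
    measurable_prodMk_left (measurableSet_visible hV.isOpen)
  have hvis2 : MeasurableSet {y | y ∈ frontier V ∧ openSegment ℝ x y ⊆ V} :=
    isClosed_frontier.measurableSet.inter hvis
  have h1 := lintegral_halfspace_gaussian hn
  rw [← lintegral_indicator (measurableSet_lt measurable_const (by fun_prop)),
    lintegral_congr_ae (F.ae_sum_directions hV hF hx _), lintegral_finsetSum _
      fun Q _ => hg.indicator (F.measurableSet_directions x n hV.isOpen Q)] at h1
  rw [Finset.sum_congr rfl fun Q hQ =>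
    F.lintegral_directions hV hx hQ] at h1
  have hm : ∀ Q : Set E3, Measurable ({y | y ∈ frontier V ∧ openSegment ℝ x y ⊆ V}.indicator
        (fun y => ENNReal.ofReal (|inner ℝ n (y - x)| * |inner ℝ (F.normal Q) (y - x)| /
          (2 * (inner ℝ (y - x) (y - x)) ^ 2)))) := fun Q =>
    Measurable.indicator (by fun_prop) hvis2
  -- The view factor carries 1/π where the cone integral carries 1/2, hence the factor π/2, which
  -- cancels against the half-space integral.
  have h2 : ∑ Q ∈ F.planes, ∫⁻ y in Q, {y | y ∈ frontier V ∧ openSegment ℝ x y ⊆ V}.indicator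
        (fun y => ENNReal.ofReal (|inner ℝ n (y - x)| * |inner ℝ (F.normal Q) (y - x)| /
          (2 * (inner ℝ (y - x) (y - x)) ^ 2))) y ∂surf =
      ENNReal.ofReal (Real.pi / 2) * ∫⁻ y in frontier V, F.transport V x y ∂surf := by
    have hpair : Measurable fun y : E3 => (x, y) := by fun_prop
    have hT := (F.measurable_transport hV.isOpen).comp hpair
    simp only [Function.comp_def] at hT
    rw [← lintegral_const_mul _ hT]
    rw [← lintegral_indicator isClosed_frontier.measurableSet]
    rw [Finset.sum_congr rfl fun Q hQ =>
      (lintegral_indicator (F.isPlane hQ).isClosed.measurableSet _).symm]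
    rw [← lintegral_finsetSum _ fun Q hQ =>
      (hm Q).indicator (F.isPlane hQ).isClosed.measurableSet]
    refine lintegral_congr fun y => ?_
    by_cases hy : y ∈ frontier V
    · rw [indicator_of_mem hy]
      unfold PlaneFamily.transport
      by_cases hs : openSegment ℝ x y ⊆ V
      · rw [indicator_of_mem (show (x, y) ∈ {p : E3 × E3 | openSegment ℝ p.1 p.2 ⊆ V} from hs),
          ← ENNReal.ofReal_mul (by positivity)]
        have e : ∀ Q ∈ F.planes, Q.indicator ({y | y ∈ frontier V ∧ openSegment ℝ x y ⊆ V}.indicator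
            (fun y => ENNReal.ofReal (|inner ℝ n (y - x)| * |inner ℝ (F.normal Q) (y - x)| /
              (2 * (inner ℝ (y - x) (y - x)) ^ 2)))) y =
            ENNReal.ofReal (|inner ℝ n (y - x)| / (2 * (inner ℝ (y - x) (y - x)) ^ 2) *
              Q.indicator (fun _ => |inner ℝ (F.normal Q) (y - x)|) y) := by
          intro Q _
          by_cases hyQ : y ∈ Q
          · rw [indicator_of_mem hyQ, indicator_of_mem hyQ, indicator_of_mem
              (show y ∈ {y | y ∈ frontier V ∧ openSegment ℝ x y ⊆ V} from ⟨hy, hs⟩)]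
            congr 1
            ring
          · rw [indicator_of_notMem hyQ, indicator_of_notMem hyQ]
            simp
        rw [Finset.sum_congr rfl e, ← ENNReal.ofReal_sum_of_nonneg, ← Finset.mul_sum]
        · congr 1
          unfold PlaneFamily.kernel
          rw [F.absNormal_eq_of_isOuterNormal hV hF hxV hxg hx]
          have hpi := Real.pi_pos.ne'
          simp only [PlaneFamily.absNormal]
          field_simp
        · intro Q _
          exact mul_nonneg (by positivity) (indicator_nonneg (fun _ _ => abs_nonneg _) _)
      · rw [indicator_of_notMem
          (show (x, y) ∉ {p : E3 × E3 | openSegment ℝ p.1 p.2 ⊆ V} from hs), mul_zero]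
        refine Finset.sum_eq_zero fun Q _ => ?_
        rw [indicator_indicator]
        exact indicator_of_notMem (fun h => hs h.2.2) _
    · rw [indicator_of_notMem hy]
      refine Finset.sum_eq_zero fun Q _ => ?_
      rw [indicator_indicator]
      exact indicator_of_notMem (fun h => hy h.2.1) _
  rw [h2] at h1
  have hpos : ENNReal.ofReal (Real.pi / 2) ≠ 0 := by
    simp [Real.pi_pos]
  exact (ENNReal.mul_right_inj hpos ENNReal.ofReal_ne_top).1 (h1.trans (mul_one _).symm)

end Closure

/-! ### Radiation exchange coefficients -/

section Exchange

variable {V : Set E3} {n : E3 → E3} {F : PlaneFamily}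

/-- Along a visible segment both normal components are positive, so the absolute values in `kernel`
are harmless. Otherwise both sides vanish. -/
lemma visibility_mul_viewFactor (hV : PiecewiseFlat V) (hF : F.Covers V) {x y : E3}
    (hxV : x ∈ frontier V) (hyV : y ∈ frontier V) (hxF : F.IsGeneric x) (hyF : F.IsGeneric y)
    (hx : IsOuterNormal V x (-n x)) (hy : IsOuterNormal V y (-n y)) :
    visibility V x y * viewFactor n x y = (F.transport V x y).toReal := by
  unfold visibility PlaneFamily.transport
  by_cases h : openSegment ℝ x y ⊆ V
  · rw [if_pos h, indicator_of_mem (show (x, y) ∈ {p : E3 × E3 | openSegment ℝ p.1 p.2 ⊆ V} from h),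
      ENNReal.toReal_ofReal (F.kernel_nonneg _ _), one_mul]
    have h1 := hx.inner_pos_of_visible h
    have h2 := hy.inner_pos_of_visible (openSegment_symm ℝ x y ▸ h)
    unfold viewFactor PlaneFamily.kernel
    rw [F.absNormal_eq_of_isOuterNormal hV hF hxV hxF hx,
      F.absNormal_eq_of_isOuterNormal hV hF hyV hyF hy, abs_of_pos h1, ← neg_sub x y,
      inner_neg_right (n y), abs_neg, abs_of_pos h2, mul_comm (inner ℝ (n y) (x - y))]
  · rw [if_neg h, indicator_of_notMem
      (show (x, y) ∉ {p : E3 × E3 | openSegment ℝ p.1 p.2 ⊆ V} from h)]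
    simp

variable {A B : Set E3}

/-- The integrand agrees almost everywhere with a measurable nonnegative kernel. In the extended
nonnegative reals, iterating and summing integrals then needs no integrability. -/
lemma exchange_eq_lintegral (hV : PiecewiseFlat V) (hF : F.Covers V)
    (hn : ∀ᵐ y ∂surf, y ∈ frontier V → IsOuterNormal V y (-n y))
    (hA : MeasurableSet A) (hAV : A ⊆ frontier V) (hB : MeasurableSet B) (hBV : B ⊆ frontier V) :
    exchange V n A B = (∫⁻ x in A, ∫⁻ y in B, F.transport V x y ∂surf ∂surf).toReal := by
  have hfA : IsFiniteMeasure (surf.restrict A) :=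
    isFiniteMeasure_restrict.2 ((measure_mono hAV).trans_lt hV.surf_frontier_lt_top).ne
  have hfB : IsFiniteMeasure (surf.restrict B) :=
    isFiniteMeasure_restrict.2 ((measure_mono hBV).trans_lt hV.surf_frontier_lt_top).ne
  have hgood : ∀ C : Set E3, MeasurableSet C → C ⊆ frontier V → ∀ᵐ y ∂(surf.restrict C),
      y ∈ frontier V ∧ F.IsGeneric y ∧ IsOuterNormal V y (-n y) := by
    intro C hC hCV
    filter_upwards [ae_restrict_mem hC, ae_restrict_of_ae hn, ae_restrict_of_ae F.ae_isGeneric]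
      with y h1 h2 h3
    exact ⟨hCV h1, h3, h2 (hCV h1)⟩
  have hmT := F.measurable_transport hV.isOpen
  unfold exchange
  rw [← lintegral_prod (fun p : E3 × E3 => F.transport V p.1 p.2) hmT.aemeasurable,
    ← integral_toReal hmT.aemeasurable]
  · apply integral_congr_ae
    filter_upwards [Measure.quasiMeasurePreserving_fst.ae (hgood A hA hAV),
      Measure.quasiMeasurePreserving_snd.ae (hgood B hB hBV)] with p h1 h2
    exact visibility_mul_viewFactor hV hF h1.1 h2.1 h1.2.1 h2.2.1 h1.2.2 h2.2.2
  · refine .of_forall fun p => ?_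
    exact (indicator_le_self _ _ _).trans_lt ENNReal.ofReal_lt_top

lemma exchange_nonneg (hV : PiecewiseFlat V)
    (hn : ∀ᵐ y ∂surf, y ∈ frontier V → IsOuterNormal V y (-n y))
    (hA : MeasurableSet A) (hAV : A ⊆ frontier V) (hB : MeasurableSet B) (hBV : B ⊆ frontier V) :
    0 ≤ exchange V n A B := by
  obtain ⟨F, hF⟩ := hV.exists_planeFamily
  rw [exchange_eq_lintegral hV hF hn hA hAV hB hBV]
  exact ENNReal.toReal_nonneg

/-- The radiation leaving `A` is distributed completely over a partition of the boundary. -/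
lemma sum_exchange {ι : Type*} [Fintype ι] {b : ι → Set E3} (hV : PiecewiseFlat V)
    (hn : ∀ᵐ y ∂surf, y ∈ frontier V → IsOuterNormal V y (-n y))
    (hA : MeasurableSet A) (hAV : A ⊆ frontier V) (hb : ∀ i, MeasurableSet (b i))
    (hbV : ∀ i, b i ⊆ frontier V) (hd : Pairwise fun i j => surf (b i ∩ b j) = 0)
    (hcov : ∀ᵐ y ∂surf, y ∈ frontier V → ∃ i, y ∈ b i) :
    ∑ i, exchange V n A (b i) = area A := by
  obtain ⟨F, hF⟩ := hV.exists_planeFamily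
  have hmT := F.measurable_transport hV.isOpen
  have hone : ∀ᵐ x ∂(surf.restrict A), ∫⁻ y in frontier V, F.transport V x y ∂surf = 1 := by
    filter_upwards [ae_restrict_mem hA, ae_restrict_of_ae hn, ae_restrict_of_ae F.ae_isGeneric]
      with x h1 h2 h3
    exact F.lintegral_transport hV hF (hAV h1) h3 (h2 (hAV h1))
  have hae : (⋃ i, b i : Set E3) =ᵐ[surf] frontier V := by
    filter_upwards [hcov] with y hy
    exact propext ⟨fun h => by
      obtain ⟨i, hi⟩ := mem_iUnion.1 h
      exact hbV i hi, fun h => mem_iUnion.2 (hy h)⟩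
  have hfin : ∀ B, B ⊆ frontier V → ∫⁻ x in A, ∫⁻ y in B, F.transport V x y ∂surf ∂surf ≠ ∞ := by
    intro B hB
    refine ne_top_of_le_ne_top ?_ (lintegral_mono_ae (g := fun _ => 1) ?_)
    · rw [lintegral_const, Measure.restrict_apply_univ, one_mul]
      exact ((measure_mono hAV).trans_lt hV.surf_frontier_lt_top).ne
    · filter_upwards [hone] with x hx
      rw [← hx]
      exact lintegral_mono_set hB
  rw [Finset.sum_congr rfl fun i _ => exchange_eq_lintegral hV hF hn hA hAV (hb i) (hbV i),
    ← ENNReal.toReal_sum fun i _ => hfin _ (hbV i), ← lintegral_finsetSum]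
  · unfold area Measure.real
    congr 1
    rw [← setLIntegral_one]
    refine lintegral_congr_ae ?_
    filter_upwards [hone] with x hx
    rw [← hx, ← setLIntegral_congr hae, lintegral_iUnion₀ (fun i => (hb i).nullMeasurableSet) hd,
      tsum_fintype]
  · intro i _
    have : IsFiniteMeasure (surf.restrict (b i)) :=
      isFiniteMeasure_restrict.2 ((measure_mono (hbV i)).trans_lt hV.surf_frontier_lt_top).ne
    exact hmT.lintegral_prod_right'

end Exchange

/-! ### Boundary elements -/

/-- The relative boundary of a planar polyhedral set is a null set. -/
lemma IsPolyhedral.surf_closure_diff_eq_zero {A : Set E3} (hA : IsPolyhedral A)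
    (hQ : ∃ Q : AffineSubspace ℝ E3, Module.finrank ℝ Q.direction = 2 ∧ A ⊆ Q) :
    surf (closure A \ A) = 0 := by
  obtain ⟨Q, hQ2, hAQ⟩ := hQ
  have hne : affineSpan ℝ A ≠ ⊤ := by
    intro h
    have h1 : affineSpan ℝ A ≤ Q := affineSpan_le.2 hAQ
    rw [h, top_le_iff] at h1
    rw [h1, AffineSubspace.direction_top, finrank_top] at hQ2
    simp at hQ2
  obtain ⟨R, ⟨ν, c, hν, rfl⟩, hAR⟩ := exists_isPlane_superset hne
  have hcl : closure A ⊆ plane ν c := closure_minimal hAR (isClosed_plane ν c)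
  -- In coordinates of the plane, the set to be estimated lies in the frontiers of finitely many
  -- convex sets, and the frontier of a convex set is a null set.
  set φ : orthPlane ν →ᵃⁱ[ℝ] E3 :=
    (AffineIsometryEquiv.constVAdd ℝ E3 (c • ν)).toAffineIsometry.comp
      (orthPlane ν).subtypeₗᵢ.toAffineIsometry with hφ
  have hφ1 : ∀ w : orthPlane ν, φ w = c • ν + (w : E3) := fun w => rfl
  have hr : Set.range φ = plane ν c := by
    rw [← range_planeParam hν]
    exact congrArg Set.range (funext hφ1)
  obtain ⟨T, hT⟩ := hA.1
  have himg : φ '' (φ ⁻¹' closure A) = closure A := by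
    rw [image_preimage_eq_inter_range, hr, inter_eq_left]
    exact hcl
  have hint : φ '' interior (φ ⁻¹' closure A) ⊆ A := by
    refine (image_mono (interior_subset_intrinsicInterior (𝕜 := ℝ))).trans ?_
    rw [← AffineIsometry.intrinsicInterior_image, himg]
    exact hA.2
  have hsub : closure A \ A ⊆ φ '' ⋃ t ∈ T, frontier (φ ⁻¹' convexHull ℝ (t : Set E3)) := by
    rintro y ⟨hy1, hy2⟩
    obtain ⟨w, rfl⟩ : y ∈ Set.range φ := by rw [hr]; exact hcl hy1
    refine mem_image_of_mem φ ?_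
    have hy3 := hy1
    rw [hT] at hy3
    obtain ⟨t, ht, hyt⟩ := mem_iUnion₂.1 hy3
    refine mem_iUnion₂.2 ⟨t, ht, ?_⟩
    have hc : IsClosed (φ ⁻¹' convexHull ℝ (t : Set E3)) :=
      (t.finite_toSet.isClosed_convexHull ℝ).preimage φ.continuous
    rw [hc.frontier_eq]
    refine ⟨hyt, fun hi => hy2 (hint (mem_image_of_mem φ (interior_mono ?_ hi)))⟩
    apply preimage_mono
    rw [hT]
    exact subset_biUnion_of_mem (u := fun t : Finset E3 => convexHull ℝ (t : Set E3)) ht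
  refine measure_mono_null hsub ?_
  rw [surf, φ.isometry.euclideanHausdorffMeasure_image, ← finrank_orthPlane hν,
    InnerProductSpace.euclideanHausdorffMeasure_eq_volume]
  refine (measure_biUnion_null_iff T.countable_toSet).2 fun t _ => ?_
  exact ((convex_convexHull ℝ (t : Set E3)).affine_preimage φ.toAffineMap).addHaar_frontier volume

/-- A set that separates two balls has positive surface measure. -/
lemma surf_pos_of_separates {Z : Set E3} {p q : E3} (hpq : p ≠ q) {r : ℝ} (hr : 0 < r)
    (h : ∀ p' ∈ Metric.ball p r, ∃ z ∈ Z, z ∈ segment ℝ p' (p' + (q - p))) : 0 < surf Z := by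
  set v := q - p with hv
  have hv0 : v ≠ 0 := sub_ne_zero.2 (Ne.symm hpq)
  have hrank : Module.finrank ℝ (orthPlane v) = 2 :=
    Submodule.finrank_orthogonal_span_singleton (n := 2) hv0
  -- Projection along q - p collapses each segment to a point, so the image of `Z` contains a disc.
  -- Being 1-Lipschitz, the projection cannot create positive measure from a null set.
  set π : E3 →L[ℝ] orthPlane v := (orthPlane v).orthogonalProjectionOnto with hπ
  have hπv : π v = 0 := Submodule.orthogonalProjectionOnto_orthogonalComplement_singleton_eq_zero v
  have hsub : Metric.ball (π p) r ⊆ π '' Z := by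
    intro w hw
    have hp' : p + ((w - π p : orthPlane v) : E3) ∈ Metric.ball p r := by
      rw [mem_ball_iff_norm, add_sub_cancel_left]
      rw [mem_ball_iff_norm] at hw
      exact hw
    obtain ⟨z, hz, hseg⟩ := h _ hp'
    refine ⟨z, hz, ?_⟩
    rw [segment_eq_image'] at hseg
    obtain ⟨t, -, rfl⟩ := hseg
    rw [add_sub_cancel_left]
    simp only [map_add, map_smul, hπv, smul_zero, add_zero]
    rw [hπ, Submodule.orthogonalProjectionOnto_mem_subspace_eq_self]
    exact add_sub_cancel _ _
  rw [pos_iff_ne_zero]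
  intro h0
  have hlip : LipschitzWith 1 π := (orthPlane v).lipschitzWith_orthogonalProjectionOnto
  have h1 : μHE[2] (π '' Z) = 0 := by
    have h2 : μH[((2 : ℕ) : ℝ)] Z = 0 := by
      rw [surf, Measure.euclideanHausdorffMeasure_def, Measure.smul_apply] at h0
      rcases smul_eq_zero.1 h0 with h3 | h3
      · exact absurd h3 (Measure.addHaarScalarFactor_volume_hausdorffMeasure_ne_zero 2)
      · exact h3
    have h3 := hlip.hausdorffMeasure_image_le (d := ((2 : ℕ) : ℝ)) (by positivity) Z
    rw [h2, mul_zero, nonpos_iff_eq_zero] at h3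
    rw [Measure.euclideanHausdorffMeasure_def, Measure.smul_apply, h3, smul_zero]
  rw [← hrank, InnerProductSpace.euclideanHausdorffMeasure_eq_volume] at h1
  exact (Metric.measure_ball_pos volume (π p) hr).ne' (measure_mono_null hsub h1)

/-- The last point of a segment in a closed set. -/
lemma exists_mem_segment_last {K : Set E3} (hK : IsClosed K) {p q : E3} (hp : p ∈ K) (hq : q ∉ K) :
    ∃ z ∈ segment ℝ p q, z ∈ K ∧ z ∈ closure (segment ℝ p q \ K) := by
  set T : Set ℝ := {t | t ∈ Icc (0 : ℝ) 1 ∧ p + t • (q - p) ∈ K} with hT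
  have hcont : Continuous fun t : ℝ => p + t • (q - p) := by fun_prop
  have hTc : IsClosed T := isClosed_Icc.inter (hK.preimage hcont)
  have hTne : T.Nonempty := ⟨0, by simp, by simpa using hp⟩
  have hTb : BddAbove T := ⟨1, fun t ht => ht.1.2⟩
  have hmem := hTc.csSup_mem hTne hTb
  set s := sSup T
  have hs1 : s < 1 := by
    refine lt_of_le_of_ne hmem.1.2 fun h => hq ?_
    have := hmem.2
    rwa [h, one_smul, add_sub_cancel] at this
  have hseg : ∀ t ∈ Icc (0 : ℝ) 1, p + t • (q - p) ∈ segment ℝ p q := fun t ht => by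
    rw [segment_eq_image']; exact mem_image_of_mem _ ht
  refine ⟨_, hseg s hmem.1, hmem.2, ?_⟩
  have hcl : s ∈ closure (Ioo s 1) := by
    rw [closure_Ioo hs1.ne]; exact left_mem_Icc.2 hs1.le
  refine closure_mono ?_ (image_closure_subset_closure_image hcont (mem_image_of_mem _ hcl))
  rintro _ ⟨t, ht, rfl⟩
  have ht1 : t ∈ Icc (0 : ℝ) 1 := ⟨hmem.1.1.trans ht.1.le, ht.2.le⟩
  exact ⟨hseg t ht1, fun h => absurd (le_csSup hTb ⟨ht1, h⟩) (not_le.2 ht.1)⟩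

/-- If the segments between two open sets have to leave the closed set `K` into `W`, then the
interface of `K` and `W` has positive surface measure. -/
lemma surf_interface_pos {K W C U : Set E3} (hK : IsClosed K) (hC : Convex ℝ C)
    (hCW : C \ K ⊆ W) {A B : Set E3} (hA : IsOpen A) (hAK : A ⊆ K) (hAC : A ⊆ C) (hB : IsOpen B)
    (hBK : Disjoint B K) (hBC : B ⊆ C) {y : E3} (hyA : y ∈ closure A) (hyB : y ∈ closure B)
    (hU : IsOpen U) (hyU : y ∈ U) : 0 < surf (K ∩ closure W ∩ U) := by
  obtain ⟨ρ, hρ, hρU⟩ := Metric.mem_nhds_iff.1 (hU.mem_nhds hyU)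
  have hyb := Metric.mem_ball_self (x := y) hρ
  obtain ⟨p, hpb, hpA⟩ := mem_closure_iff.1 hyA _ Metric.isOpen_ball hyb
  obtain ⟨q, hqb, hqB⟩ := mem_closure_iff.1 hyB _ Metric.isOpen_ball hyb
  obtain ⟨r₁, hr₁, h₁⟩ := Metric.mem_nhds_iff.1 ((hA.inter Metric.isOpen_ball).mem_nhds ⟨hpA, hpb⟩)
  obtain ⟨r₂, hr₂, h₂⟩ := Metric.mem_nhds_iff.1 ((hB.inter Metric.isOpen_ball).mem_nhds ⟨hqB, hqb⟩)
  have hpq : p ≠ q := fun h => disjoint_left.1 hBK hqB (hAK (h ▸ hpA))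
  refine surf_pos_of_separates hpq (lt_min hr₁ hr₂) fun p' hp' => ?_
  have hp1 := h₁ (Metric.ball_subset_ball (min_le_left _ _) hp')
  have hq1 : p' + (q - p) ∈ B ∩ Metric.ball y ρ := by
    apply h₂
    rw [mem_ball_iff_norm] at hp' ⊢
    rw [show p' + (q - p) - q = p' - p by abel]
    exact hp'.trans_le (min_le_right _ _)
  obtain ⟨z, hz, hzK, hzcl⟩ := exists_mem_segment_last hK (hAK hp1.1)
    (disjoint_left.1 hBK hq1.1)
  refine ⟨z, ⟨⟨hzK, closure_mono ?_ hzcl⟩, hρU ?_⟩, hz⟩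
  · refine (sdiff_subset_sdiff_left ?_).trans hCW
    exact hC.segment_subset (hAC hp1.1) (hBC hq1.1)
  · exact (convex_ball y ρ).segment_subset hp1.2 hq1.2 hz

/-! ### The geometry of the problem -/

namespace Problem

variable (P : Problem)

lemma piecewiseFlat_dom (m : Phase) : PiecewiseFlat (P.dom m) :=
  (P.dom_polyhedral m).piecewiseFlat (P.dom_open m) (P.dom_bounded m)

lemma piecewiseFlat_Om : PiecewiseFlat P.Om :=
  P.Om_polyhedral.piecewiseFlat P.Om_open P.Om_bounded

/-- The hull of a finite union of polytopes is the hull of all their vertices, which is already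
closed. -/
lemma exists_hull_eq : ∃ t : Finset E3, P.hull = convexHull ℝ (t : Set E3) := by
  classical
  obtain ⟨F, hF⟩ := P.Om_polyhedral.1
  refine ⟨F.biUnion id, subset_antisymm ?_ ?_⟩
  · refine closure_minimal ?_ ((Finset.finite_toSet _).isClosed_convexHull ℝ)
    refine convexHull_min (subset_closure.trans ?_) (convex_convexHull ℝ _)
    rw [hF]
    refine iUnion₂_subset fun t ht => convexHull_mono ?_
    exact_mod_cast Finset.subset_biUnion_of_mem id ht
  · refine convexHull_min ?_ (convex_convexHull ℝ _).closure
    intro y hy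
    obtain ⟨t, ht, hyt⟩ := Finset.mem_biUnion.1 (Finset.mem_coe.1 hy)
    have : y ∈ closure P.Om := by
      rw [hF]
      exact mem_iUnion₂.2 ⟨t, ht, subset_convexHull ℝ _ hyt⟩
    exact closure_mono (subset_convexHull ℝ _) this

lemma isClosed_hull : IsClosed P.hull := isClosed_closure

lemma convex_hull : Convex ℝ P.hull := (convex_convexHull ℝ _).closure

lemma piecewiseFlat_interior_hull : PiecewiseFlat (interior P.hull) where
  isOpen := isOpen_interior
  isBounded := by
    have : Bornology.IsBounded P.hull := (isBounded_convexHull.2 P.Om_bounded).closure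
    exact this.subset interior_subset
  interior_closure_subset := interior_mono (closure_minimal interior_subset P.isClosed_hull)
  exists_planes := by
    obtain ⟨t, ht⟩ := P.exists_hull_eq
    obtain ⟨S, hS1, hS2⟩ := exists_planes_frontier_convexHull t
    exact ⟨S, hS1, frontier_interior_subset.trans (ht ▸ hS2)⟩

lemma Om_subset_interior_hull : P.Om ⊆ interior P.hull :=
  interior_maximal ((subset_convexHull ℝ _).trans subset_closure) P.Om_open

lemma isOpen_cav : IsOpen P.cav := isOpen_interior.sdiff isClosed_closure

lemma disjoint_cav_Om : Disjoint P.cav P.Om :=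
  disjoint_left.2 fun _ h h' => h.2 (subset_closure h')

lemma disjoint_closure_cav_Om : Disjoint (closure P.cav) P.Om :=
  P.disjoint_cav_Om.closure_left P.Om_open

lemma piecewiseFlat_cav : PiecewiseFlat P.cav where
  isOpen := P.isOpen_cav
  isBounded := P.piecewiseFlat_interior_hull.isBounded.subset sdiff_subset
  interior_closure_subset := by
    intro y hy
    refine ⟨P.piecewiseFlat_interior_hull.interior_closure_subset
      (interior_mono (closure_mono sdiff_subset) hy), fun hcl => ?_⟩
    -- A point of the closure of Ω interior to the closure of O would have points of Ω nearby in the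
    -- closure of O, but O and the open set Ω are disjoint.
    obtain ⟨z, hz1, hz2⟩ := mem_closure_iff.1 hcl _ isOpen_interior hy
    exact disjoint_left.1 P.disjoint_closure_cav_Om (interior_subset hz1) hz2
  exists_planes := by
    classical
    obtain ⟨S, hS1, hS2⟩ := P.piecewiseFlat_interior_hull.exists_planes
    obtain ⟨R, hR1, hR2⟩ := P.piecewiseFlat_Om.exists_planes
    refine ⟨S ∪ R, fun Q hQ => (Finset.mem_union.1 hQ).elim (hS1 Q) (hR1 Q), ?_⟩
    rw [Finset.set_biUnion_union, cav, sdiff_eq]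
    refine (frontier_inter_subset _ _).trans (union_subset_union ?_ ?_)
    · exact inter_subset_left.trans hS2
    · rw [frontier_compl]
      exact inter_subset_right.trans (frontier_closure_subset.trans hR2)

lemma isClosed_GamOm : IsClosed P.GamOm := isClosed_closure.inter isClosed_closure

lemma isClosed_GamPh : IsClosed P.GamPh := isClosed_frontier.inter isClosed_frontier

lemma isClosed_Sig : IsClosed P.Sig := isClosed_frontier

lemma GamOm_subset_frontier_Om : P.GamOm ⊆ frontier P.Om := fun y hy => by
  rw [P.Om_open.frontier_eq]
  exact ⟨hy.1, disjoint_left.1 P.disjoint_closure_cav_Om hy.2⟩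

lemma GamOm_subset_frontier_cav : P.GamOm ⊆ frontier P.cav := fun y hy => by
  rw [P.isOpen_cav.frontier_eq]
  exact ⟨hy.2, fun h => h.2 hy.1⟩

lemma GamPh_subset_frontier_cav : P.GamPh ⊆ frontier P.cav := inter_subset_right

lemma frontier_cav_subset : frontier P.cav ⊆ P.GamOm ∪ P.GamPh := fun y hy => by
  have hy' := hy
  rw [P.isOpen_cav.frontier_eq] at hy'
  by_cases h : y ∈ closure P.Om
  · exact .inl ⟨h, hy'.1⟩
  · refine .inr ⟨?_, hy⟩
    rw [P.isClosed_hull.frontier_eq]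
    refine ⟨closure_minimal (sdiff_subset.trans interior_subset) P.isClosed_hull hy'.1, fun hi => ?_⟩
    exact hy'.2 ⟨hi, h⟩

/-- At a common regular point, Ω and O both inherit the outer normal of the interior of the hull,
which contains them. Being disjoint, they must also have opposite normals. -/
lemma surf_GamOm_inter_GamPh : surf (P.GamOm ∩ P.GamPh) = 0 := by
  rw [measure_eq_zero_iff_ae_notMem]
  filter_upwards [P.piecewiseFlat_Om.ae_isOuterNormal, P.piecewiseFlat_cav.ae_isOuterNormal,
    P.piecewiseFlat_interior_hull.ae_isOuterNormal] with y h1 h2 h3 hy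
  obtain ⟨a, ha⟩ := h1 (P.GamOm_subset_frontier_Om hy.1)
  obtain ⟨b, hb⟩ := h2 (P.GamOm_subset_frontier_cav hy.1)
  obtain ⟨c, hc⟩ := h3 (by
    rw [isOpen_interior.frontier_eq]
    refine ⟨closure_mono P.Om_subset_interior_hull hy.1.1, ?_⟩
    have := hy.2.1
    rw [P.isClosed_hull.frontier_eq] at this
    exact this.2)
  have hac := ha.eq_of_subset hc one_pos fun z _ hz => P.Om_subset_interior_hull hz
  have hbc := hb.eq_of_subset hc one_pos fun z _ hz => hz.1
  have hab := ha.eq_neg_of_disjoint hb P.disjoint_cav_Om.symm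
  have h0 : a = -a := by rw [← hab, hac, hbc]
  have h1 : inner ℝ a a = inner ℝ a (-a) := by rw [← h0]
  rw [inner_neg_right, inner_self_of_unit ha.1] at h1
  linarith

lemma ae_normal_Sig :
    ∀ᵐ y ∂surf, y ∈ frontier (P.dom .gas) →
      IsOuterNormal (P.dom .gas) y (-outerNormal (P.dom .solid) y) := by
  filter_upwards [(P.piecewiseFlat_dom .gas).ae_isOuterNormal,
    (P.piecewiseFlat_dom .solid).ae_isOuterNormal] with y h1 h2 hy
  obtain ⟨a, ha⟩ := h1 hy
  have hs := isOuterNormal_outerNormal (h2 (by rw [P.frontier_solid]; exact .inr hy))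
  rwa [← hs.eq_neg_of_disjoint ha P.dom_disjoint]

lemma ae_normal_cav :
    ∀ᵐ y ∂surf, y ∈ frontier P.cav → IsOuterNormal P.cav y (-(-outerNormal P.cav y)) := by
  filter_upwards [P.piecewiseFlat_cav.ae_isOuterNormal] with y h hy
  rw [neg_neg]
  exact isOuterNormal_outerNormal (h hy)

lemma exchangeSig_nonneg {A B : Set E3} (hA : MeasurableSet A) (hA' : A ⊆ P.Sig)
    (hB : MeasurableSet B) (hB' : B ⊆ P.Sig) : 0 ≤ P.exchangeSig A B :=
  exchange_nonneg (P.piecewiseFlat_dom .gas) P.ae_normal_Sig hA hA' hB hB'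

lemma exchangeGam_nonneg {A B : Set E3} (hA : MeasurableSet A) (hA' : A ⊆ frontier P.cav)
    (hB : MeasurableSet B) (hB' : B ⊆ frontier P.cav) : 0 ≤ P.exchangeGam A B :=
  exchange_nonneg P.piecewiseFlat_cav P.ae_normal_cav hA hA' hB hB'

lemma gas_subset_Om : P.dom .gas ⊆ P.Om := by
  refine (interior_maximal ?_ (P.dom_open .gas)).trans P.piecewiseFlat_Om.interior_closure_subset
  rw [P.closure_Om]
  exact subset_closure.trans subset_union_right

lemma notMem_closure_gas {y : E3} (hy : y ∈ frontier P.Om) : y ∉ closure (P.dom .gas) := by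
  intro h
  rw [closure_eq_self_union_frontier] at h
  rcases h with h | h
  · exact P.piecewiseFlat_Om.notMem_of_mem_frontier hy (P.gas_subset_Om h)
  · exact disjoint_left.1 P.frontier_disjoint hy h

lemma mem_solid_of_mem_Om {y : E3} (hy : y ∈ P.Om) (hg : y ∉ closure (P.dom .gas)) :
    y ∈ P.dom .solid := by
  apply (P.piecewiseFlat_dom .solid).interior_closure_subset
  refine mem_interior.2 ⟨P.Om ∩ (closure (P.dom .gas))ᶜ, fun z hz => ?_,
    P.Om_open.inter isClosed_closure.isOpen_compl, hy, hg⟩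
  have := subset_closure hz.1
  rw [P.closure_Om] at this
  exact this.resolve_right hz.2

end Problem

namespace SpaceGrid

variable {P : Problem} {I IG IS : Type*} (D : SpaceGrid P I IG IS)

lemma cv_subset (i : I) : D.cv i ⊆ P.Om := D.cv_partition.1 i

lemma cv_disjoint {i j : I} (h : i ≠ j) : Disjoint (D.cv i) (D.cv j) := D.cv_partition.2.1 i j h

lemma piecewiseFlat_cv (i : I) : PiecewiseFlat (D.cv i) :=
  (D.cv_polyhedral i).piecewiseFlat (D.cv_open i) (P.Om_bounded.subset (D.cv_subset i))

lemma piecewiseFlat_cvp (m : Phase) (i : I) : PiecewiseFlat (D.cvp m i) :=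
  (D.piecewiseFlat_cv i).inter (P.piecewiseFlat_dom m)

/-! ### Volumes -/

lemma volume_cv_lt_top (i : I) : volume (D.cv i) < ∞ :=
  (D.piecewiseFlat_cv i).isBounded.measure_lt_top

lemma vol_cv_pos (i : I) : 0 < vol (D.cv i) :=
  ENNReal.toReal_pos ((D.cv_open i).measure_pos volume (D.cv_nonempty i)).ne'
    (D.volume_cv_lt_top i).ne

lemma vol_cvp_nonneg (m : Phase) (i : I) : 0 ≤ vol (D.cvp m i) := measureReal_nonneg

lemma vol_cvp_add (i : I) : vol (D.cvp .solid i) + vol (D.cvp .gas i) = vol (D.cv i) := by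
  have hd : Disjoint (D.cvp .solid i) (D.cvp .gas i) :=
    P.dom_disjoint.mono inter_subset_right inter_subset_right
  have hmg := (D.piecewiseFlat_cvp .gas i).isOpen.measurableSet
  have hfin : ∀ m, volume (D.cvp m i) ≠ ∞ := fun m =>
    ((measure_mono inter_subset_left).trans_lt (D.volume_cv_lt_top i)).ne
  unfold vol
  rw [← measureReal_union hd hmg (hfin _) (hfin _)]
  apply measureReal_congr
  -- The closures of the two phases cover Ω, and their boundaries are null sets.
  have h1 := measure_eq_zero_iff_ae_notMem.1 (P.piecewiseFlat_dom .solid).volume_frontier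
  have h2 := measure_eq_zero_iff_ae_notMem.1 (P.piecewiseFlat_dom .gas).volume_frontier
  filter_upwards [h1, h2] with y hs hg
  refine propext ⟨fun h => h.elim (fun h => h.1) fun h => h.1, fun hy => ?_⟩
  have hcl := subset_closure (D.cv_subset i hy)
  rw [P.closure_Om, closure_eq_self_union_frontier, closure_eq_self_union_frontier] at hcl
  rcases hcl with (h | h) | (h | h)
  · exact .inl ⟨hy, h⟩
  · exact absurd h hs
  · exact .inr ⟨hy, h⟩
  · exact absurd h hg

lemma vol_cvp_of_empty {m : Phase} {i : I} (h : ¬ (D.cvp m i).Nonempty) : vol (D.cvp m i) = 0 := by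
  rw [not_nonempty_iff_eq_empty.1 h, vol, measureReal_empty]

/-! ### Interface elements -/

lemma zS_subset (α : IS) : D.zS α ⊆ P.Sig := D.zS_partition.1 α

lemma zO_subset (α : IG) : D.zO α ⊆ P.GamOm := D.zO_partition.1 α

lemma measurableSet_zS (α : IS) : MeasurableSet (D.zS α) := by
  obtain ⟨U, hU, h⟩ := D.zS_open α
  rw [h]
  exact P.isClosed_Sig.measurableSet.inter hU.measurableSet

lemma measurableSet_zO (α : IG) : MeasurableSet (D.zO α) := by
  obtain ⟨U, hU, h⟩ := D.zO_open α
  rw [h]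
  exact P.isClosed_GamOm.measurableSet.inter hU.measurableSet

lemma surf_Sig_lt_top : surf P.Sig < ∞ := (P.piecewiseFlat_dom .gas).surf_frontier_lt_top

lemma surf_GamOm_lt_top : surf P.GamOm < ∞ :=
  (measure_mono P.GamOm_subset_frontier_cav).trans_lt P.piecewiseFlat_cav.surf_frontier_lt_top

/-- Positive areas make the radiosity equation nondegenerate. A nonempty relatively open piece of Σ
locally separates the gas from its exterior, so it cannot be a null set. -/
lemma area_zS_pos (α : IS) : 0 < area (D.zS α) := by
  obtain ⟨U, hU, h⟩ := D.zS_open α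
  obtain ⟨y, hy⟩ := D.zS_nonempty α
  have hV := P.piecewiseFlat_dom .gas
  have hyS : y ∈ frontier (P.dom .gas) := D.zS_subset α hy
  have hpos := surf_interface_pos (K := closure (P.dom .gas)) (W := (closure (P.dom .gas))ᶜ)
    (C := univ) (U := U) isClosed_closure convex_univ (fun z hz => hz.2) hV.isOpen subset_closure
    (subset_univ _) isClosed_closure.isOpen_compl disjoint_compl_left (subset_univ _)
    (frontier_subset_closure hyS) (by
      rw [closure_compl]
      exact fun hi => hV.notMem_of_mem_frontier hyS (hV.interior_closure_subset hi)) hU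
    (by rw [h] at hy; exact hy.2)
  refine ENNReal.toReal_pos (hpos.trans_le (measure_mono ?_)).ne'
    ((measure_mono (D.zS_subset α)).trans_lt surf_Sig_lt_top).ne
  rw [h]
  refine inter_subset_inter_left U fun z hz => ?_
  have hz2 := hz.2
  rw [closure_compl] at hz2
  change z ∈ frontier (P.dom .gas)
  rw [hV.isOpen.frontier_eq]
  exact ⟨hz.1, fun hzV => hz2 (interior_maximal subset_closure hV.isOpen hzV)⟩

/-- Within the convex interior of the hull, everything outside the closure of Ω is O. Segments from
Ω to O near a point of the element must therefore cross Γ_Ω. -/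
lemma area_zO_pos (α : IG) : 0 < area (D.zO α) := by
  obtain ⟨U, hU, h⟩ := D.zO_open α
  obtain ⟨y, hy⟩ := D.zO_nonempty α
  have hyS : y ∈ P.GamOm := D.zO_subset α hy
  have hpos := surf_interface_pos (K := closure P.Om) (W := P.cav)
    (C := interior P.hull) (U := U) isClosed_closure P.convex_hull.interior (fun z hz => hz) P.Om_open
    subset_closure P.Om_subset_interior_hull P.isOpen_cav
    (disjoint_left.2 fun _ hz => hz.2) sdiff_subset hyS.1 hyS.2 hU
    (by rw [h] at hy; exact hy.2)
  refine ENNReal.toReal_pos ?_ ((measure_mono (D.zO_subset α)).trans_lt surf_GamOm_lt_top).ne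
  rw [h]
  exact hpos.ne'

/-- Only the closures of the elements are known to cover; their relative boundaries are null. -/
lemma ae_exists_mem {ι : Type*} [Finite ι] {Z : Set E3} {z : ι → Set E3} (hp : IsPartition Z z)
    (hZ : IsClosed Z) (hpol : ∀ α, IsPolyhedral (z α))
    (hpl : ∀ α, ∃ Q : AffineSubspace ℝ E3, Module.finrank ℝ Q.direction = 2 ∧ z α ⊆ Q) :
    ∀ᵐ y ∂surf, y ∈ Z → ∃ α, y ∈ z α := by
  have h1 : ∀ᵐ y ∂surf, ∀ α, y ∉ closure (z α) \ z α := by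
    rw [ae_all_iff]
    exact fun α => measure_eq_zero_iff_ae_notMem.1 ((hpol α).surf_closure_diff_eq_zero (hpl α))
  filter_upwards [h1] with y hy hyZ
  have : y ∈ ⋃ i, closure (z i) := by rw [hp.2.2, hZ.closure_eq]; exact hyZ
  obtain ⟨α, hα⟩ := mem_iUnion.1 this
  exact ⟨α, by_contra fun h => hy α ⟨hα, h⟩⟩

lemma ae_mem_zS [Finite IS] : ∀ᵐ y ∂surf, y ∈ P.Sig → ∃ α, y ∈ D.zS α :=
  ae_exists_mem D.zS_partition P.isClosed_Sig D.zS_polyhedral D.zS_planar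

lemma ae_mem_zO [Finite IG] : ∀ᵐ y ∂surf, y ∈ P.GamOm → ∃ α, y ∈ D.zO α :=
  ae_exists_mem D.zO_partition P.isClosed_GamOm D.zO_polyhedral D.zO_planar

lemma LamS_nonneg (α β : IS) : 0 ≤ D.LamS α β :=
  P.exchangeSig_nonneg (D.measurableSet_zS α) (D.zS_subset α) (D.measurableSet_zS β)
    (D.zS_subset β)

lemma sum_LamS [Fintype IS] (α : IS) : ∑ β, D.LamS α β = area (D.zS α) :=
  sum_exchange (P.piecewiseFlat_dom .gas) P.ae_normal_Sig (D.measurableSet_zS α) (D.zS_subset α)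
    D.measurableSet_zS D.zS_subset
    (fun i j hij => by
      change surf (D.zS i ∩ D.zS j) = 0
      rw [(D.zS_partition.2.1 i j hij).inter_eq, measure_empty]) D.ae_mem_zS

lemma zO_subset_frontier_cav (α : IG) : D.zO α ⊆ frontier P.cav :=
  (D.zO_subset α).trans P.GamOm_subset_frontier_cav

lemma LamO_nonneg (α β : IG) : 0 ≤ D.LamO α β :=
  P.exchangeGam_nonneg (D.measurableSet_zO α) (D.zO_subset_frontier_cav α) (D.measurableSet_zO β)
    (D.zO_subset_frontier_cav β)

lemma LamPh_nonneg (α : IG) : 0 ≤ D.LamPh α :=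
  P.exchangeGam_nonneg (D.measurableSet_zO α) (D.zO_subset_frontier_cav α)
    P.isClosed_GamPh.measurableSet P.GamPh_subset_frontier_cav

lemma sum_LamO_add_LamPh [Fintype IG] (α : IG) :
    ∑ β, D.LamO α β + D.LamPh α = area (D.zO α) := by
  -- The phantom closure is the extra element `none` of the partition of the boundary of O.
  set b : Option IG → Set E3 := fun o => o.elim P.GamPh D.zO with hb
  have hnull : ∀ β, surf (D.zO β ∩ P.GamPh) = 0 := fun β =>
    measure_mono_null (inter_subset_inter_left _ (D.zO_subset β)) P.surf_GamOm_inter_GamPh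
  have h := sum_exchange (b := b) P.piecewiseFlat_cav P.ae_normal_cav (D.measurableSet_zO α)
    (D.zO_subset_frontier_cav α)
    (by
      rintro (_ | β)
      exacts [P.isClosed_GamPh.measurableSet, D.measurableSet_zO β])
    (by
      rintro (_ | β)
      exacts [P.GamPh_subset_frontier_cav, D.zO_subset_frontier_cav β])
    (by
      rintro (_ | β) (_ | γ) hij
      · exact absurd rfl hij
      · exact (inter_comm _ _ ▸ hnull γ :)
      · exact hnull β
      · have hne : β ≠ γ := fun h => hij (by rw [h])
        change surf (D.zO β ∩ D.zO γ) = 0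
        rw [(D.zO_partition.2.1 β γ hne).inter_eq, measure_empty])
    (by
      filter_upwards [D.ae_mem_zO] with y hy hyf
      rcases P.frontier_cav_subset hyf with h | h
      · obtain ⟨β, hβ⟩ := hy h
        exact ⟨some β, hβ⟩
      · exact ⟨none, h⟩)
  rw [Fintype.sum_option, add_comm] at h
  exact h

/-! ### Boundary elements and control volumes -/

/-- The gas keeps away from the boundary of Ω, so near such a point the control volume coincides
with its solid part. -/
lemma mem_frontier_cvp_iff {y : E3} (hy : y ∈ frontier P.Om) (i : I) :
    y ∈ frontier (D.cvp .solid i) ↔ y ∈ frontier (D.cv i) := by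
  have hyn : y ∉ P.Om := P.piecewiseFlat_Om.notMem_of_mem_frontier hy
  have hg := P.notMem_closure_gas hy
  rw [(D.piecewiseFlat_cv i).isOpen.frontier_eq, (D.piecewiseFlat_cvp .solid i).isOpen.frontier_eq]
  constructor
  · rintro ⟨h1, -⟩
    exact ⟨closure_mono inter_subset_left h1, fun h => hyn (D.cv_subset i h)⟩
  · rintro ⟨h1, -⟩
    refine ⟨?_, fun h => hyn (D.cv_subset i h.1)⟩
    have h2 := isClosed_closure.isOpen_compl.inter_closure (show y ∈ (closure (P.dom .gas))ᶜ ∩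
      closure (D.cv i) from ⟨hg, h1⟩)
    have h3 : (closure (P.dom .gas))ᶜ ∩ D.cv i ⊆ D.cvp .solid i := fun z hz =>
      ⟨hz.2, P.mem_solid_of_mem_Om (D.cv_subset i hz.2) hz.1⟩
    exact closure_mono h3 h2

/-- By `cv_interface`, a regular boundary point of the solid part on Σ is also one of the gas part.
The normals are opposite, so the two parts fill a neighbourhood up to a plane, and regular openness
puts the point inside the control volume. -/
lemma ae_mem_frontier_cvp_iff [Countable I] :
    ∀ᵐ y ∂surf, y ∈ P.Sig → ∀ i, (y ∈ frontier (D.cvp .solid i) ↔ y ∈ D.cv i) := by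
  have h1 : ∀ᵐ y ∂surf, ∀ i, y ∈ frontier (D.cvp .solid i) →
      ∃ n, IsOuterNormal (D.cvp .solid i) y n :=
    ae_all_iff.2 fun i => (D.piecewiseFlat_cvp .solid i).ae_isOuterNormal
  filter_upwards [h1] with y hy hyS i
  constructor
  · intro hf
    obtain ⟨n, hn⟩ := hy i hf
    have hmem : y ∈ regBoundary (D.cv i ∩ P.dom .solid) ∩ P.Sig := And.intro ⟨n, hn⟩ hyS
    rw [D.cv_interface i] at hmem
    obtain ⟨⟨m, hm⟩, -⟩ := hmem
    have hd : Disjoint (D.cvp .solid i) (D.cv i ∩ P.dom .gas) :=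
      P.dom_disjoint.mono inter_subset_right inter_subset_right
    rw [hn.eq_neg_of_disjoint hm hd] at hm
    exact hn.mem_of_neg hm inter_subset_left inter_subset_left
      (D.piecewiseFlat_cv i).interior_closure_subset
  · intro hc
    have hs : y ∈ frontier (P.dom .solid) := by rw [P.frontier_solid]; exact .inr hyS
    have h2 := (D.cv_open i).inter_closure (show y ∈ D.cv i ∩ closure (P.dom .solid) from
      ⟨hc, frontier_subset_closure hs⟩)
    rw [(D.piecewiseFlat_cvp .solid i).isOpen.frontier_eq]
    refine ⟨h2, fun h => ?_⟩
    exact (P.piecewiseFlat_dom .solid).notMem_of_mem_frontier hs h.2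

/-- At a common regular point two distinct control volumes have opposite normals, which would make
it an interior point of Ω. -/
lemma ae_eq_of_mem_frontier [Countable I] :
    ∀ᵐ y ∂surf, y ∈ frontier P.Om → ∀ i j, y ∈ frontier (D.cv i) → y ∈ frontier (D.cv j) →
      i = j := by
  have h1 : ∀ᵐ y ∂surf, ∀ i, y ∈ frontier (D.cv i) → ∃ n, IsOuterNormal (D.cv i) y n :=
    ae_all_iff.2 fun i => (D.piecewiseFlat_cv i).ae_isOuterNormal
  filter_upwards [h1] with y hy hyO i j hi hj
  by_contra hne
  obtain ⟨n, hn⟩ := hy i hi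
  obtain ⟨m, hm⟩ := hy j hj
  rw [hn.eq_neg_of_disjoint hm (D.cv_disjoint hne)] at hm
  exact P.piecewiseFlat_Om.notMem_of_mem_frontier hyO
    (hn.mem_of_neg hm (D.cv_subset i) (D.cv_subset j)
      P.piecewiseFlat_Om.interior_closure_subset)

/-- This makes the emissivity in the absorbed radiation of control volume i the one at its own
temperature u_i. -/
lemma iS_eq_of_mem_JS [Countable I] [Fintype IS] {i : I} {α : IS} (h : α ∈ D.JS i) :
    D.iS α = i := by
  classical
  by_contra hne
  refine (Finset.mem_filter.1 h).2 (measure_eq_zero_iff_ae_notMem.2 ?_)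
  filter_upwards [D.ae_mem_frontier_cvp_iff] with y hy hmem
  have hyS := D.zS_subset α hmem.1
  exact disjoint_left.1 (D.cv_disjoint hne) ((hy hyS _).1 (D.iS_sub α hmem.1).1)
    ((hy hyS _).1 hmem.2)

lemma iO_eq_of_mem_JO [Countable I] [Fintype IG] {i : I} {α : IG} (h : α ∈ D.JO i) :
    D.iO α = i := by
  classical
  by_contra hne
  refine (Finset.mem_filter.1 h).2 (measure_eq_zero_iff_ae_notMem.2 ?_)
  filter_upwards [D.ae_eq_of_mem_frontier] with y hy hmem
  exact hne (hy (P.GamOm_subset_frontier_Om (D.zO_subset α hmem.1)) _ _ (D.iO_sub α hmem.1).1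
    hmem.2)

/-- The elements in `JS i` tile the part of Σ inside the control volume up to null sets, so emission
and absorption there refer to the same area. -/
lemma sum_area_JS [Countable I] [Fintype IS] (i : I) :
    ∑ α ∈ D.JS i, area (D.zS α) = area (D.cv i ∩ P.Sig) := by
  classical
  unfold area
  rw [← measureReal_biUnion_finset (fun α _ β _ hne => D.zS_partition.2.1 α β hne)
    (fun α _ => D.measurableSet_zS α)
    (fun α _ => ((measure_mono (D.zS_subset α)).trans_lt surf_Sig_lt_top).ne)]
  apply measureReal_congr
  have hnull : ∀ᵐ y ∂surf, ∀ α, α ∉ D.JS i → y ∉ D.zS α ∩ frontier (D.cvp .solid i) := by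
    rw [ae_all_iff]
    intro α
    by_cases h : α ∈ D.JS i
    · exact .of_forall fun y h' => absurd h h'
    · have h0 : surf (D.zS α ∩ frontier (D.cvp .solid i)) = 0 := by
        by_contra hc
        exact h (Finset.mem_filter.2 ⟨Finset.mem_univ _, hc⟩)
      filter_upwards [measure_eq_zero_iff_ae_notMem.1 h0] with y hy _ using hy
  filter_upwards [hnull, D.ae_mem_frontier_cvp_iff, D.ae_mem_zS] with y h1 h2 h3
  refine propext ⟨fun hy => ?_, fun hy => ?_⟩
  · obtain ⟨α, hα, hyα⟩ := mem_iUnion₂.1 hy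
    have hyS := D.zS_subset α hyα
    refine ⟨(h2 hyS i).1 ?_, hyS⟩
    rw [← D.iS_eq_of_mem_JS hα]
    exact (D.iS_sub α hyα).1
  · obtain ⟨α, hα⟩ := h3 hy.2
    refine mem_iUnion₂.2 ⟨α, ?_, hα⟩
    by_contra hc
    exact h1 α hc ⟨hα, (h2 hy.2 i).2 hy.1⟩

lemma sum_area_JO [Countable I] [Fintype IG] (i : I) :
    ∑ α ∈ D.JO i, area (D.zO α) = area (frontier (D.cvp .solid i) ∩ P.GamOm) := by
  classical
  unfold area
  rw [← measureReal_biUnion_finset (fun α _ β _ hne => D.zO_partition.2.1 α β hne)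
    (fun α _ => D.measurableSet_zO α)
    (fun α _ => ((measure_mono (D.zO_subset α)).trans_lt surf_GamOm_lt_top).ne)]
  apply measureReal_congr
  have hnull : ∀ᵐ y ∂surf, ∀ α, α ∉ D.JO i → y ∉ D.zO α ∩ frontier (D.cv i) := by
    rw [ae_all_iff]
    intro α
    by_cases h : α ∈ D.JO i
    · exact .of_forall fun y h' => absurd h h'
    · have h0 : surf (D.zO α ∩ frontier (D.cv i)) = 0 := by
        by_contra hc
        exact h (Finset.mem_filter.2 ⟨Finset.mem_univ _, hc⟩)
      filter_upwards [measure_eq_zero_iff_ae_notMem.1 h0] with y hy _ using hy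
  filter_upwards [hnull, D.ae_mem_zO] with y h1 h3
  refine propext ⟨fun hy => ?_, fun hy => ?_⟩
  · obtain ⟨α, hα, hyα⟩ := mem_iUnion₂.1 hy
    have hyG := D.zO_subset α hyα
    refine ⟨(D.mem_frontier_cvp_iff (P.GamOm_subset_frontier_Om hyG) i).2 ?_, hyG⟩
    rw [← D.iO_eq_of_mem_JO hα]
    exact (D.iO_sub α hyα).1
  · obtain ⟨α, hα⟩ := h3 hy.2
    refine mem_iUnion₂.2 ⟨α, ?_, hα⟩
    by_contra hc
    exact h1 α hc ⟨hα,
      (D.mem_frontier_cvp_iff (P.GamOm_subset_frontier_Om hy.2) i).1 hy.1⟩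

end SpaceGrid

/-! ### Radiosity -/

section Radiosity

variable {ι : Type*} [Fintype ι]

/-- The incoming radiation, for the radiosity `R`, and for the radiation `q` through the phantom
closure, which is seen with the exchange coefficients `p`. -/
def incoming (L : ι → ι → ℝ) (p : ι → ℝ) (q : ℝ) (R : ι → ℝ) (α : ι) : ℝ :=
  ∑ β, R β * L α β + q * p α

/-- `R` solves the radiosity equation with emissivities `e` and black-body radiation `s`. -/
def IsRadiosity (a : ι → ℝ) (L : ι → ι → ℝ) (p : ι → ℝ) (q : ℝ) (e s R : ι → ℝ) : Prop :=
  ∀ α, a α * R α = (1 - e α) * incoming L p q R α + e α * s α * a α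

variable {a : ι → ℝ} {L : ι → ι → ℝ} {p : ι → ℝ} {q : ℝ} {e s R : ι → ℝ}

lemma incoming_le (hL : ∀ α β, 0 ≤ L α β) (hp : ∀ α, 0 ≤ p α) (hsum : ∀ α, ∑ β, L α β + p α = a α)
    {K : ℝ} (hq : q ≤ K) (hR : ∀ α, R α ≤ K) (α : ι) : incoming L p q R α ≤ K * a α := by
  rw [incoming, ← hsum, mul_add, Finset.mul_sum]
  exact add_le_add (Finset.sum_le_sum fun β _ => mul_le_mul_of_nonneg_right (hR β) (hL α β))
    (mul_le_mul_of_nonneg_right hq (hp α))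

lemma le_incoming (hL : ∀ α β, 0 ≤ L α β) (hp : ∀ α, 0 ≤ p α) (hsum : ∀ α, ∑ β, L α β + p α = a α)
    {K : ℝ} (hq : K ≤ q) (hR : ∀ α, K ≤ R α) (α : ι) : K * a α ≤ incoming L p q R α := by
  rw [incoming, ← hsum, mul_add, Finset.mul_sum]
  exact add_le_add (Finset.sum_le_sum fun β _ => mul_le_mul_of_nonneg_right (hR β) (hL α β))
    (mul_le_mul_of_nonneg_right hq (hp α))

/-- The maximum principle for the radiosity equation. -/
lemma IsRadiosity.le (h : IsRadiosity a L p q e s R) (ha : ∀ α, 0 < a α)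
    (hL : ∀ α β, 0 ≤ L α β) (hp : ∀ α, 0 ≤ p α) (hsum : ∀ α, ∑ β, L α β + p α = a α)
    (he : ∀ α, e α ∈ Ioc 0 1) {K : ℝ} (hq : q ≤ K) (hs : ∀ α, s α ≤ K) (α : ι) : R α ≤ K := by
  have : Nonempty ι := ⟨α⟩
  obtain ⟨β, hβ⟩ := Finite.exists_max R
  refine (hβ α).trans ?_
  by_contra! hlt
  -- At the largest radiosity R > K, the mean incoming radiation is at most R and the source is
  -- below R. The positive weight of the source then contradicts the equation.
  have h1 := incoming_le hL hp hsum (hq.trans hlt.le) hβ β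
  have h2 := h β
  have h3 := mul_le_mul_of_nonneg_left h1 (sub_nonneg.2 (he β).2)
  have h4 : e β * s β * a β < e β * R β * a β :=
    mul_lt_mul_of_pos_right (mul_lt_mul_of_pos_left ((hs β).trans_lt hlt) (he β).1) (ha β)
  nlinarith

lemma IsRadiosity.neg (h : IsRadiosity a L p q e s R) :
    IsRadiosity a L p (-q) e (-s) (-R) := fun α => by
  have := h α
  simp only [incoming, Pi.neg_apply, neg_mul, Finset.sum_neg_distrib] at this ⊢
  linarith

/-- The minimum principle for the radiosity equation. -/
lemma IsRadiosity.ge (h : IsRadiosity a L p q e s R) (ha : ∀ α, 0 < a α)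
    (hL : ∀ α β, 0 ≤ L α β) (hp : ∀ α, 0 ≤ p α) (hsum : ∀ α, ∑ β, L α β + p α = a α)
    (he : ∀ α, e α ∈ Ioc 0 1) {K : ℝ} (hq : K ≤ q) (hs : ∀ α, K ≤ s α) (α : ι) : K ≤ R α :=
  neg_le_neg_iff.1 (h.neg.le ha hL hp hsum he (neg_le_neg hq) (fun β => neg_le_neg (hs β)) α)

/-- The difference of the two equations is evaluated where |R - R'| is largest, with value ρ.
Because the weights sum to the area, incoming differences are at most ρ times the area, which gives
e(ρ - d) ≤ ℓK and so ρ ≤ ℓK/m + d. The last ℓK comes from the emissivity in front of the incoming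
radiation. -/
lemma IsRadiosity.abs_sub_le {e' s' R' : ι → ℝ} (h : IsRadiosity a L p q e s R)
    (h' : IsRadiosity a L p q e' s' R') (ha : ∀ α, 0 < a α)
    (hL : ∀ α β, 0 ≤ L α β) (hp : ∀ α, 0 ≤ p α) (hsum : ∀ α, ∑ β, L α β + p α = a α)
    (he : ∀ α, e α ∈ Ioc 0 1) (he' : ∀ α, e' α ∈ Ioc 0 1) {K ℓ d m : ℝ} (hm : 0 < m)
    (hme : ∀ α, m ≤ e α) (hq0 : 0 ≤ q) (hq : q ≤ K) (hs0' : ∀ α, 0 ≤ s' α) (hs' : ∀ α, s' α ≤ K)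
    (hℓ : ∀ α, |e α - e' α| ≤ ℓ) (hd : ∀ α, |s α - s' α| ≤ d) (α : ι) :
    |e α * incoming L p q R α - e' α * incoming L p q R' α| ≤ (ℓ * K / m + d + ℓ * K) * a α := by
  have : Nonempty ι := ⟨α⟩
  have hK : 0 ≤ K := hq0.trans hq
  have hℓ0 : 0 ≤ ℓ := (abs_nonneg _).trans (hℓ α)
  have hd0 : 0 ≤ d := (abs_nonneg _).trans (hd α)
  have hJ1 : ∀ β, incoming L p q R' β ≤ K * a β :=
    incoming_le hL hp hsum hq (h'.le ha hL hp hsum he' hq hs')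
  have hJ0 : ∀ β, 0 ≤ incoming L p q R' β := fun β => by
    have := le_incoming hL hp hsum hq0 (h'.ge ha hL hp hsum he' hq0 hs0') β
    rwa [zero_mul] at this
  obtain ⟨β, hβ⟩ := Finite.exists_max fun β => |R β - R' β|
  set ρ := |R β - R' β| with hρ
  have hdiff : ∀ γ, |incoming L p q R γ - incoming L p q R' γ| ≤ ρ * a γ := by
    intro γ
    have h1 : incoming L p q R γ - incoming L p q R' γ = ∑ δ, (R δ - R' δ) * L γ δ := by
      simp only [incoming, sub_mul, Finset.sum_sub_distrib]; ring
    rw [h1]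
    calc |∑ δ, (R δ - R' δ) * L γ δ| ≤ ∑ δ, |(R δ - R' δ) * L γ δ| :=
          Finset.abs_sum_le_sum_abs _ _
      _ ≤ ∑ δ, ρ * L γ δ := Finset.sum_le_sum fun δ _ => by
          rw [abs_mul, abs_of_nonneg (hL γ δ)]
          exact mul_le_mul_of_nonneg_right (hβ δ) (hL γ δ)
      _ = ρ * ∑ δ, L γ δ := by rw [Finset.mul_sum]
      _ ≤ ρ * a γ := mul_le_mul_of_nonneg_left (by linarith [hsum γ, hp γ]) (abs_nonneg _)
  have hρle : ρ ≤ ℓ * K / m + d := by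
    have e1 : a β * (R β - R' β) = (1 - e β) * (incoming L p q R β - incoming L p q R' β) +
        (e' β - e β) * (incoming L p q R' β - s' β * a β) + e β * (s β - s' β) * a β := by
      have := h β
      have := h' β
      linarith
    have e2 : a β * ρ ≤ (1 - e β) * (ρ * a β) + ℓ * (K * a β) + e β * d * a β := by
      rw [hρ, ← abs_of_pos (ha β), ← abs_mul, e1, abs_of_pos (ha β)]
      refine (abs_add_le _ _).trans (add_le_add ((abs_add_le _ _).trans (add_le_add ?_ ?_)) ?_)
      · rw [abs_mul, abs_of_nonneg (sub_nonneg.2 (he β).2)]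
        exact mul_le_mul_of_nonneg_left (hdiff β) (sub_nonneg.2 (he β).2)
      · rw [abs_mul, abs_sub_comm]
        refine mul_le_mul (hℓ β) ?_ (abs_nonneg _) hℓ0
        have h1 := mul_nonneg (hs0' β) (ha β).le
        have h2 := mul_le_mul_of_nonneg_right (hs' β) (ha β).le
        rw [abs_le]
        constructor <;> linarith [hJ0 β, hJ1 β]
      · rw [abs_mul, abs_mul, abs_of_pos (he β).1, abs_of_pos (ha β)]
        exact mul_le_mul_of_nonneg_right (mul_le_mul_of_nonneg_left (hd β) (he β).1.le) (ha β).le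
    have e3 : e β * ρ ≤ ℓ * K + e β * d := by
      have : (e β * ρ) * a β ≤ (ℓ * K + e β * d) * a β := by linarith
      exact le_of_mul_le_mul_right this (ha β)
    have e4 : e β * (ρ - d) ≤ ℓ * K := by linarith
    -- Replacing e by its lower bound m is legitimate only if ρ - d is positive.
    by_cases hneg : ρ ≤ d
    · have : 0 ≤ ℓ * K / m := by positivity
      linarith
    · push Not at hneg
      have : (ρ - d) * m ≤ ℓ * K := by nlinarith [hme β]
      rw [← le_div_iff₀ hm] at this
      linarith
  have e5 : e α * incoming L p q R α - e' α * incoming L p q R' α =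
      e α * (incoming L p q R α - incoming L p q R' α) +
        (e α - e' α) * incoming L p q R' α := by ring
  rw [e5, add_mul]
  refine (abs_add_le _ _).trans (add_le_add ?_ ?_)
  · rw [abs_mul, abs_of_pos (he α).1]
    calc e α * |incoming L p q R α - incoming L p q R' α| ≤ 1 * (ρ * a α) :=
          mul_le_mul (he α).2 (hdiff α) (abs_nonneg _) zero_le_one
      _ ≤ (ℓ * K / m + d) * a α := by
          rw [one_mul]; exact mul_le_mul_of_nonneg_right hρle (ha α).le
  · rw [abs_mul, abs_of_nonneg (hJ0 α), mul_assoc]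
    exact mul_le_mul (hℓ α) (hJ1 α) (hJ0 α) hℓ0

/-- A kernel vector of the matrix solves the radiosity equation without sources, so the maximum and
minimum principles with bound 0 make it vanish. The matrix is thus invertible, and its inverse is a
genuine one. -/
lemma isRadiosity_radiosity {em : ℝ → ℝ} {u : ι → ℝ} (ha : ∀ α, 0 < a α)
    (hL : ∀ α β, 0 ≤ L α β) (hp : ∀ α, 0 ≤ p α) (hsum : ∀ α, ∑ β, L α β + p α = a α)
    (he : ∀ α, em (u α) ∈ Ioc 0 1) {b : ι → ℝ}
    (hb : ∀ α, b α = (1 - em (u α)) * (q * p α) + em (u α) * s α * a α) :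
    IsRadiosity a L p q (fun α => em (u α)) s (radiosity em a L b u) := by
  classical
  have hmul : ∀ (v : ι → ℝ) α, (radMatrix em a L u).mulVec v α =
      a α * v α - (1 - em (u α)) * ∑ β, v β * L α β := by
    intro v α
    have h : ∀ β, ((if α = β then a α else 0) - (1 - em (u α)) * L α β) * v β =
        (if α = β then a α * v β else 0) - (1 - em (u α)) * (v β * L α β) := by
      intro β
      split_ifs <;> ring
    simp only [radMatrix, Matrix.mulVec, dotProduct, Matrix.of_apply, h, Finset.sum_sub_distrib,
      Finset.sum_ite_eq, Finset.mem_univ, if_true, ← Finset.mul_sum]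
  have hdet : (radMatrix em a L u).det ≠ 0 := by
    intro h0
    obtain ⟨v, hv0, hv⟩ := Matrix.exists_mulVec_eq_zero_iff.2 h0
    apply hv0
    have hr : IsRadiosity a L p 0 (fun α => em (u α)) 0 v := fun α => by
      have := congrFun hv α
      rw [hmul] at this
      simp only [incoming, Pi.zero_apply] at this ⊢
      linarith
    ext α
    exact le_antisymm (hr.le ha hL hp hsum he le_rfl (fun _ => le_rfl) α)
      (hr.ge ha hL hp hsum he le_rfl (fun _ => le_rfl) α)
  intro α
  have h1 : (radMatrix em a L u).mulVec (radiosity em a L b u) α = b α := by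
    unfold radiosity
    rw [Matrix.mulVec_mulVec, Matrix.mul_nonsing_inv _ (isUnit_iff_ne_zero.2 hdet),
      Matrix.one_mulVec]
  rw [hmul, hb] at h1
  simp only [incoming]
  linarith

end Radiosity

/-! ### Emissivity -/

namespace Problem

variable (P : Problem) {r : ℝ}

lemma lipConst_nonneg : 0 ≤ lipConst P.em r :=
  Real.sSup_nonneg fun q hq => by
    obtain ⟨a, -, b, -, -, rfl⟩ := hq
    positivity

lemma abs_em_sub_le {u v : ℝ} (hu : u ∈ Icc 0 r) (hv : v ∈ Icc 0 r) :
    |P.em u - P.em v| ≤ lipConst P.em r * |u - v| := by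
  by_cases h : u = v
  · simp [h]
  · rw [← div_le_iff₀ (abs_pos.2 (sub_ne_zero.2 h))]
    exact le_csSup (P.em_lipschitz r (hu.1.trans hu.2)) ⟨u, hu, v, hv, h, rfl⟩

lemma continuousOn_em : ContinuousOn P.em (Icc 0 r) := by
  have : LipschitzOnWith (lipConst P.em r).toNNReal P.em (Icc 0 r) := by
    refine LipschitzOnWith.of_dist_le_mul fun u hu v hv => ?_
    rw [Real.coe_toNNReal _ P.lipConst_nonneg]
    exact P.abs_em_sub_le hu hv
  exact this.continuousOn

lemma bddBelow_em_image : BddBelow (P.em '' Icc 0 r) :=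
  ⟨0, by rintro _ ⟨u, hu, rfl⟩; exact (P.em_mem u hu.1).1.le⟩

lemma minOn_le {u : ℝ} (hu : u ∈ Icc 0 r) : minOn P.em r ≤ P.em u :=
  csInf_le P.bddBelow_em_image (mem_image_of_mem _ hu)

lemma minOn_pos (hr : 0 ≤ r) : 0 < minOn P.em r := by
  obtain ⟨u, hu, h⟩ := isCompact_Icc.exists_isMinOn (nonempty_Icc.2 hr) P.continuousOn_em
  refine (P.em_mem u hu.1).1.trans_le (le_csInf ((nonempty_Icc.2 hr).image _) ?_)
  rintro _ ⟨v, hv, rfl⟩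
  exact h hv

lemma minOn_le_one (hr : 0 ≤ r) : minOn P.em r ≤ 1 :=
  (P.minOn_le (left_mem_Icc.2 hr)).trans (P.em_mem 0 le_rfl).2

lemma negVar_nonneg : 0 ≤ negVar P.em r :=
  Real.sSup_nonneg fun v hv => by
    obtain ⟨n, s, -, -, -, rfl⟩ := hv
    exact Finset.sum_nonneg fun k _ => neg_nonneg.2 (min_le_left _ _)

lemma lipConst_mono {r' : ℝ} (hr' : 0 ≤ r') (h : r ≤ r') : lipConst P.em r ≤ lipConst P.em r' := by
  rcases (diffQuotients P.em r).eq_empty_or_nonempty with h0 | hne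
  · rw [lipConst, h0, Real.sSup_empty]
    exact P.lipConst_nonneg
  · refine csSup_le_csSup (P.em_lipschitz r' hr') hne ?_
    rintro q ⟨a, ha, b, hb, hab, rfl⟩
    exact ⟨a, Icc_subset_Icc_right h ha, b, Icc_subset_Icc_right h hb, hab, rfl⟩

lemma minOn_anti {r' : ℝ} (hr : 0 ≤ r) (h : r ≤ r') : minOn P.em r' ≤ minOn P.em r :=
  csInf_le_csInf P.bddBelow_em_image ((nonempty_Icc.2 hr).image _)
    (image_mono (Icc_subset_Icc_right h))

/-- Appending r' to a discretization of [0, r] adds a nonnegative term. The supremum for r' must be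
known to be finite, since an unbounded real supremum would be 0. -/
lemma negVar_mono {r' : ℝ} (h : r ≤ r') : negVar P.em r ≤ negVar P.em r' := by
  rcases h.eq_or_lt with rfl | hlt
  · exact le_rfl
  refine Real.sSup_le ?_ P.negVar_nonneg
  rintro v ⟨n, s, hs, hs0, hsl, rfl⟩
  have hbdd : BddAbove {v | ∃ (n : ℕ) (s : Fin (n + 1) → ℝ), StrictMono s ∧ s 0 = 0 ∧
      s (Fin.last n) = r' ∧ v = ∑ k : Fin n, -min 0 (P.em (s k.succ) - P.em (s k.castSucc))} := by
    -- Each term is at most the Lipschitz constant times the step length, and the lengths telescope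
    -- to r'.
    refine ⟨lipConst P.em r' * r', ?_⟩
    rintro v ⟨n, s, hs, hs0, hsl, rfl⟩
    have hmem : ∀ k, s k ∈ Icc 0 r' := fun k =>
      ⟨hs0 ▸ hs.monotone (Fin.zero_le k), hsl ▸ hs.monotone (Fin.le_last k)⟩
    calc ∑ k : Fin n, -min 0 (P.em (s k.succ) - P.em (s k.castSucc))
        ≤ ∑ k : Fin n, lipConst P.em r' * (s k.succ - s k.castSucc) := by
          refine Finset.sum_le_sum fun k _ => ?_
          have h1 := P.abs_em_sub_le (hmem k.succ) (hmem k.castSucc)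
          have h2 : s k.castSucc < s k.succ := hs Fin.castSucc_lt_succ
          rw [abs_of_pos (sub_pos.2 h2)] at h1
          rw [neg_le, le_min_iff]
          constructor
          · have := mul_nonneg (P.lipConst_nonneg (r := r')) (sub_pos.2 h2).le
            linarith
          · linarith [neg_abs_le (P.em (s k.succ) - P.em (s k.castSucc))]
      _ = lipConst P.em r' * r' := by
          rw [← Finset.mul_sum, Finset.sum_sub_distrib]
          have e1 := Fin.sum_univ_succ s
          have e2 := Fin.sum_univ_castSucc s
          rw [hs0] at e1
          rw [hsl] at e2
          have e3 : ∑ k : Fin n, s k.succ - ∑ k : Fin n, s k.castSucc = r' := by linarith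
          rw [e3]
  refine le_csSup_of_le hbdd
    ⟨n + 1, Fin.snoc s r', ?_, ?_, Fin.snoc_last _ _, rfl⟩ ?_
  · rw [Fin.strictMono_iff_lt_succ]
    intro k
    refine Fin.lastCases ?_ (fun k => ?_) k
    · rw [Fin.snoc_castSucc, Fin.succ_last, Fin.snoc_last, hsl]
      exact hlt
    · rw [Fin.snoc_castSucc, Fin.succ_castSucc, Fin.snoc_castSucc]
      exact hs Fin.castSucc_lt_succ
  · rw [← Fin.castSucc_zero, Fin.snoc_castSucc, hs0]
  · rw [Fin.sum_univ_castSucc]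
    simp only [Fin.snoc_castSucc, Fin.succ_castSucc]
    exact le_add_of_nonneg_right (neg_nonneg.2 (min_le_left _ _))

lemma abs_pow_four_sub_le {u v : ℝ} (hu : u ∈ Icc 0 r) (hv : v ∈ Icc 0 r) :
    |u ^ 4 - v ^ 4| ≤ 4 * r ^ 3 * |u - v| := by
  have hr : 0 ≤ r := hu.1.trans hu.2
  have h1 : u ^ 4 - v ^ 4 = (u ^ 3 + u ^ 2 * v + u * v ^ 2 + v ^ 3) * (u - v) := by ring
  rw [h1, abs_mul]
  refine mul_le_mul_of_nonneg_right ?_ (abs_nonneg _)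
  obtain ⟨hu0, hu1⟩ := hu
  obtain ⟨hv0, hv1⟩ := hv
  rw [abs_of_nonneg (by positivity)]
  have a1 : u ^ 3 ≤ r ^ 3 := by gcongr
  have a2 : u ^ 2 * v ≤ r ^ 2 * r := by gcongr
  have a3 : u * v ^ 2 ≤ r * r ^ 2 := by gcongr
  have a4 : v ^ 3 ≤ r ^ 3 := by gcongr
  nlinarith

/-- The emission is bounded below by its decrease due to the emissivity. -/
lemma em_mul_sub_ge {q u v : ℝ} (hq : 0 ≤ q) (hv : 0 ≤ v) (hvu : v ≤ u) (hu : u ≤ r) :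
    -(lipConst P.em r * (r ^ 4 + q)) * (u - v) ≤
      P.em u * (u ^ 4 - q) - P.em v * (v ^ 4 - q) := by
  have h1 := P.abs_em_sub_le (r := r) ⟨hv.trans hvu, hu⟩ ⟨hv, hvu.trans hu⟩
  rw [abs_of_nonneg (sub_nonneg.2 hvu)] at h1
  have h2 : |v ^ 4 - q| ≤ r ^ 4 + q := by
    have a1 : v ^ 4 ≤ r ^ 4 := by gcongr; exact hvu.trans hu
    have a2 : 0 ≤ v ^ 4 := by positivity
    rw [abs_le]
    constructor <;> linarith
  have h3 : |(P.em u - P.em v) * (v ^ 4 - q)| ≤ lipConst P.em r * (u - v) * (r ^ 4 + q) := by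
    rw [abs_mul]
    exact mul_le_mul h1 h2 (abs_nonneg _) (mul_nonneg P.lipConst_nonneg (sub_nonneg.2 hvu))
  -- The difference splits into this monotone part and (em u - em v)(v⁴ - q); only the latter can
  -- decrease.
  have h4 : 0 ≤ P.em u * (u ^ 4 - v ^ 4) :=
    mul_nonneg (P.em_mem u (hv.trans hvu)).1.le (sub_nonneg.2 (by gcongr))
  have h5 := neg_abs_le ((P.em u - P.em v) * (v ^ 4 - q))
  nlinarith

end Problem

/-! ### Accretive systems -/

section Accretive

variable {I : Type*} [Fintype I]

/-- A diagonal system with strongly increasing entries and a right-hand side with a smaller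
Lipschitz constant has a unique solution. -/
lemma existsUnique_of_slope {F : I → ℝ → ℝ} {G : I → (I → ℝ) → ℝ} {b g : I → ℝ}
    (hF : ∀ i, Continuous (F i)) (hslope : ∀ i s t, t ≤ s → b i * (s - t) ≤ F i s - F i t)
    (hg : ∀ i, 0 ≤ g i) (hgb : ∀ i, g i < b i)
    (hG : ∀ i u v, |G i u - G i v| ≤ g i * dist u v) :
    ∃! u : I → ℝ, ∀ i, F i (u i) = G i u := by
  have hb : ∀ i, 0 < b i := fun i => (hg i).trans_lt (hgb i)
  have habs : ∀ i s t, b i * |s - t| ≤ |F i s - F i t| := by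
    intro i s t
    rcases le_total t s with h | h
    · rw [abs_of_nonneg (sub_nonneg.2 h)]
      exact (hslope i s t h).trans (le_abs_self _)
    · rw [abs_sub_comm, abs_of_nonneg (sub_nonneg.2 h), abs_sub_comm]
      exact (hslope i t s h).trans (le_abs_self _)
  -- Positive slope makes each entry coercive in both directions; with continuity it is onto.
  have hsurj : ∀ i, Function.Surjective (F i) := by
    intro i
    apply (hF i).surjective
    · refine Filter.tendsto_atTop_mono' _ (f₁ := fun s => b i * s + F i 0) ?_
        (Filter.tendsto_atTop_add_const_right _ _ (Filter.tendsto_id.const_mul_atTop (hb i)))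
      filter_upwards [Filter.eventually_ge_atTop 0] with s hs
      have := hslope i s 0 hs
      linarith
    · refine Filter.tendsto_atBot_mono' _ (f₁ := fun s => b i * s + F i 0) (f₂ := F i) ?_
        (Filter.tendsto_atBot_add_const_right _ _ (Filter.tendsto_id.const_mul_atBot (hb i)))
      filter_upwards [Filter.eventually_le_atBot 0] with s hs
      have := hslope i 0 s hs
      linarith
  choose Φ hΦ using hsurj
  -- The contraction ratio is the largest of the quotients g_i/b_i; an empty index set has none and
  -- gets 0.
  obtain ⟨q, hq0, hq1, hq⟩ : ∃ q : ℝ, 0 ≤ q ∧ q < 1 ∧ ∀ i, g i ≤ q * b i := by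
    rcases isEmpty_or_nonempty I with h | h
    · exact ⟨0, le_rfl, zero_lt_one, fun i => h.elim i⟩
    · obtain ⟨j, hj⟩ := Finite.exists_max fun i => g i / b i
      refine ⟨g j / b j, div_nonneg (hg j) (hb j).le, (div_lt_one (hb j)).2 (hgb j), fun i => ?_⟩
      rw [← div_le_iff₀ (hb i)]
      exact hj i
  set T : (I → ℝ) → I → ℝ := fun u i => Φ i (G i u) with hT
  have hcontr : ContractingWith q.toNNReal T := by
    refine ⟨Real.toNNReal_lt_one.2 hq1, LipschitzWith.of_dist_le_mul fun u v => ?_⟩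
    rw [Real.coe_toNNReal _ hq0]
    rw [dist_pi_le_iff (mul_nonneg hq0 dist_nonneg)]
    intro i
    have h1 := habs i (T u i) (T v i)
    simp only [hT, hΦ] at h1
    have h2 := h1.trans ((hG i u v).trans (mul_le_mul_of_nonneg_right (hq i) dist_nonneg))
    rw [Real.dist_eq]
    have h3 : b i * |Φ i (G i u) - Φ i (G i v)| ≤ b i * (q * dist u v) := by linarith
    exact le_of_mul_le_mul_left h3 (hb i)
  have hiff : ∀ u : I → ℝ, (∀ i, F i (u i) = G i u) ↔ Function.IsFixedPt T u := by
    intro u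
    constructor
    · intro h
      ext i
      have h1 := habs i (T u i) (u i)
      simp only [hT, hΦ, h i, sub_self, abs_zero] at h1
      have h2 : |Φ i (G i u) - u i| ≤ 0 := by
        by_contra! hpos
        exact absurd h1 (not_le.2 (mul_pos (hb i) hpos))
      exact sub_eq_zero.1 (abs_nonpos_iff.1 h2)
    · intro h i
      conv_lhs => rw [← h]
      exact hΦ i _
  refine ⟨hcontr.fixedPoint, (hiff _).2 hcontr.fixedPoint_isFixedPt, fun v hv => ?_⟩
  exact hcontr.fixedPoint_unique ((hiff v).1 hv)

/-- Existence and uniqueness in a box for a diagonally implicit system with diffusive coupling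
`c` and Lipschitz continuous coupling `W`. -/
lemma existsUnique_in_box {M : ℝ} (hM : 0 ≤ M) {B : I → ℝ → ℝ} {W : I → (I → ℝ) → ℝ}
    {c : I → I → ℝ} {b g : I → ℝ} (hB : ∀ i, ContinuousOn (B i) (Icc 0 M))
    (hslope : ∀ i s t, 0 ≤ t → t ≤ s → s ≤ M → b i * (s - t) ≤ B i s - B i t)
    (hc : ∀ i j, 0 ≤ c i j) (hg : ∀ i, 0 ≤ g i) (hgb : ∀ i, g i < b i)
    (hW : ∀ i (u v : I → ℝ) (δ : ℝ), (∀ j, u j ∈ Icc 0 M) → (∀ j, v j ∈ Icc 0 M) →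
      (∀ j, |u j - v j| ≤ δ) → |W i u - W i v| ≤ g i * δ)
    (hup : ∀ i (u : I → ℝ), (∀ j, u j ∈ Icc 0 M) → u i = M → W i u ≤ B i M)
    (hlow : ∀ i (u : I → ℝ), (∀ j, u j ∈ Icc 0 M) → u i = 0 → B i 0 ≤ W i u) :
    ∃! u : I → ℝ, (∀ i, u i ∈ Icc 0 M) ∧
      ∀ i, B i (u i) + ∑ j, c i j * (u i - u j) = W i u := by
  -- Truncation to the box, monotone and 1-Lipschitz, makes the system globally defined without
  -- changing it inside the box.
  set τ : ℝ → ℝ := fun s => max 0 (min s M) with hτ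
  have hτmem : ∀ s, τ s ∈ Icc 0 M := fun s => ⟨le_max_left _ _, max_le hM (min_le_right _ _)⟩
  have hτid : ∀ s ∈ Icc 0 M, τ s = s := fun s hs => by
    simp only [hτ, min_eq_left hs.2, max_eq_right hs.1]
  have hτcont : Continuous τ := by fun_prop
  have hτmono : Monotone τ := fun s t h => max_le_max le_rfl (min_le_min_right _ h)
  have hτlip : ∀ s t, |τ s - τ t| ≤ |s - t| := fun s t => by
    refine (abs_max_sub_max_le_max _ _ _ _).trans ?_
    rw [sub_self, abs_zero]
    refine max_le (abs_nonneg _) ((abs_min_sub_min_le_max _ _ _ _).trans ?_)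
    simp
  have hτdiff : ∀ s t, t ≤ s → τ s - τ t ≤ s - t := fun s t h => by
    have := hτlip s t
    rw [abs_of_nonneg (sub_nonneg.2 h)] at this
    exact (le_abs_self _).trans this
  have hb : ∀ i, 0 < b i := fun i => (hg i).trans_lt (hgb i)
  set C : I → ℝ := fun i => ∑ j, c i j with hC
  have hC0 : ∀ i, 0 ≤ C i := fun i => Finset.sum_nonneg fun j _ => hc i j
  -- Outside the box the entry continues with slope b_i. The diffusive coupling is split: its row
  -- sum C_i enters the slope here and the Lipschitz constant of `G`, so the strict inequality g_i <
  -- b_i survives.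
  set F : I → ℝ → ℝ := fun i s => B i (τ s) + b i * (s - τ s) + C i * s with hF
  set G : I → (I → ℝ) → ℝ := fun i u => W i (fun j => τ (u j)) + ∑ j, c i j * u j with hG
  have key := existsUnique_of_slope (F := F) (G := G) (b := fun i => b i + C i)
    (g := fun i => g i + C i) ?_ ?_ (fun i => add_nonneg (hg i) (hC0 i))
    (fun i => by linarith [hgb i]) ?_
  rotate_left
  · intro i
    have h1 : Continuous fun s => B i (τ s) :=
      (hB i).comp_continuous hτcont hτmem
    exact (h1.add (continuous_const.mul (continuous_id.sub hτcont))).add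
      (continuous_const.mul continuous_id)
  · intro i s t hst
    have h1 := hslope i (τ s) (τ t) (hτmem t).1 (hτmono hst) (hτmem s).2
    simp only [hF]
    linarith
  · intro i u v
    have h1 := hW i (fun j => τ (u j)) (fun j => τ (v j)) (dist u v) (fun j => hτmem _)
      (fun j => hτmem _) (fun j => (hτlip _ _).trans (by
        rw [← Real.dist_eq]; exact dist_le_pi_dist u v j))
    have h2 : |∑ j, c i j * u j - ∑ j, c i j * v j| ≤ C i * dist u v := by
      rw [← Finset.sum_sub_distrib, hC, Finset.sum_mul]
      refine (Finset.abs_sum_le_sum_abs _ _).trans (Finset.sum_le_sum fun j _ => ?_)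
      rw [← mul_sub, abs_mul, abs_of_nonneg (hc i j), ← Real.dist_eq]
      exact mul_le_mul_of_nonneg_left (dist_le_pi_dist u v j) (hc i j)
    simp only [hG]
    rw [add_sub_add_comm, add_mul]
    exact (abs_add_le _ _).trans (add_le_add h1 h2)
  obtain ⟨u, hu, huniq⟩ := key
  have hsum : ∀ (w : I → ℝ) i, ∑ j, c i j * (w i - w j) = C i * w i - ∑ j, c i j * w j := by
    intro w i
    simp only [mul_sub, Finset.sum_sub_distrib, hC, Finset.sum_mul]
  -- At an extremal index outside the box the coupling has the favourable sign and `hlow` or `hup`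
  -- compares the truncated terms, so the extra slope term b_i(s - τ s) has nothing to balance it.
  have hbox : ∀ i, u i ∈ Icc 0 M := by
    intro i
    have : Nonempty I := ⟨i⟩
    constructor
    · obtain ⟨j, hj⟩ := Finite.exists_min u
      refine le_trans ?_ (hj i)
      by_contra! hneg
      have h1 : τ (u j) = 0 := by
        simp only [hτ]
        rw [min_eq_left (hneg.le.trans hM), max_eq_left hneg.le]
      have h2 := hu j
      simp only [hF, hG] at h2
      have h3 := hlow j (fun k => τ (u k)) (fun k => hτmem _) h1
      have h4 : C j * u j ≤ ∑ k, c j k * u k := by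
        rw [hC, Finset.sum_mul]
        exact Finset.sum_le_sum fun k _ => mul_le_mul_of_nonneg_left (hj k) (hc j k)
      rw [h1] at h2
      have h5 := mul_neg_of_pos_of_neg (hb j) hneg
      linarith
    · obtain ⟨j, hj⟩ := Finite.exists_max u
      refine le_trans (hj i) ?_
      by_contra! hpos
      have h1 : τ (u j) = M := by
        simp only [hτ]
        rw [min_eq_right hpos.le, max_eq_right hM]
      have h2 := hu j
      simp only [hF, hG] at h2
      have h3 := hup j (fun k => τ (u k)) (fun k => hτmem _) h1
      have h4 : ∑ k, c j k * u k ≤ C j * u j := by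
        rw [hC, Finset.sum_mul]
        exact Finset.sum_le_sum fun k _ => mul_le_mul_of_nonneg_left (hj k) (hc j k)
      rw [h1] at h2
      have h5 := mul_pos (hb j) (sub_pos.2 hpos)
      linarith
  have hiff : ∀ w : I → ℝ, (∀ i, w i ∈ Icc 0 M) → ((∀ i, F i (w i) = G i w) ↔
      ∀ i, B i (w i) + ∑ j, c i j * (w i - w j) = W i w) := by
    intro w hw
    refine forall_congr' fun i => ?_
    have h1 : (fun j => τ (w j)) = w := funext fun j => hτid _ (hw j)
    simp only [hF, hG, h1, hτid _ (hw i), hsum]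
    constructor <;> intro h <;> linarith
  exact ⟨u, ⟨hbox, (hiff u hbox).1 hu⟩, fun w hw => huniq w ((hiff w hw.1).2 hw.2)⟩

end Accretive

/-! ### The absorbed radiation -/

namespace SpaceGrid

variable {P : Problem} {I IG IS : Type*} (D : SpaceGrid P I IG IS)

/-- The area of the part of a control volume's surface that takes part in a radiation exchange. -/
def radArea (i : I) : ℝ :=
  area (frontier (D.cvp .solid i) ∩ P.GamOm) + area (D.cv i ∩ P.Sig)

/-- The area of the part of a control volume's surface that emits to the exterior only. -/
def outArea (i : I) : ℝ := area (frontier (D.cvp .solid i) ∩ (frontier P.Om \ P.GamOm))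

lemma radArea_nonneg (i : I) : 0 ≤ D.radArea i :=
  add_nonneg measureReal_nonneg measureReal_nonneg

lemma outArea_nonneg (i : I) : 0 ≤ D.outArea i := measureReal_nonneg

lemma isRadiosity_RO [Fintype IG] {u : IG → ℝ} (hu : ∀ α, 0 ≤ u α) :
    IsRadiosity (fun α => area (D.zO α)) D.LamO D.LamPh (P.sig * P.ext ^ 4)
      (fun α => P.em (u α)) (fun α => P.sig * u α ^ 4) (D.RO u) :=
  isRadiosity_radiosity D.area_zO_pos D.LamO_nonneg D.LamPh_nonneg D.sum_LamO_add_LamPh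
    (fun α => P.em_mem _ (hu α)) fun α => by ring

/-- A closed cavity is the case of vanishing phantom coefficients. The phantom radiation is then
immaterial; this value lets both kinds of cavity share the same bounds. -/
lemma isRadiosity_RS [Fintype IS] {u : IS → ℝ} (hu : ∀ α, 0 ≤ u α) :
    IsRadiosity (fun α => area (D.zS α)) D.LamS (fun _ => 0) (P.sig * P.ext ^ 4)
      (fun α => P.em (u α)) (fun α => P.sig * u α ^ 4) (D.RS u) :=
  isRadiosity_radiosity D.area_zS_pos D.LamS_nonneg (fun _ => le_rfl)
    (fun α => by rw [add_zero]; exact D.sum_LamS α)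
    (fun α => P.em_mem _ (hu α)) fun α => by ring

lemma VO_eq [Fintype IG] (u : IG → ℝ) (α : IG) :
    D.VO u α = P.em (u α) * incoming D.LamO D.LamPh (P.sig * P.ext ^ 4) (D.RO u) α := by
  rw [VO, incoming]; ring

lemma VS_eq [Fintype IS] (u : IS → ℝ) (α : IS) :
    D.VS u α = P.em (u α) * incoming D.LamS (fun _ => 0) (P.sig * P.ext ^ 4) (D.RS u) α := by
  rw [VS, incoming]; ring

variable [Fintype IG] [Fintype IS]

/-- The radiation that is absorbed by a control volume. -/
def absorbed (u : I → ℝ) (i : I) : ℝ :=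
  ∑ α ∈ D.JO i, D.VO (fun β => u (D.iO β)) α + ∑ α ∈ D.JS i, D.VS (fun β => u (D.iS β)) α

variable [Countable I]

/-- By the maximum principle every radiosity is at most σK⁴; the closure relation turns this into a
bound by the area, and the elements of i all carry the emissivity at u_i. -/
lemma absorbed_le {u : I → ℝ} (hu : ∀ j, 0 ≤ u j) {K : ℝ} (hext : P.ext ≤ K)
    (huK : ∀ j, u j ≤ K) (i : I) :
    D.absorbed u i ≤ P.sig * P.em (u i) * K ^ 4 * D.radArea i := by
  have hK4 : P.sig * P.ext ^ 4 ≤ P.sig * K ^ 4 := by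
    have := P.ext_pos.le
    have := P.sig_pos.le
    gcongr
  have hs : ∀ j, P.sig * u j ^ 4 ≤ P.sig * K ^ 4 := fun j => by
    have := hu j
    have := P.sig_pos.le
    gcongr
    exact huK j
  have he := (P.em_mem (u i) (hu i)).1.le
  rw [absorbed, radArea, mul_add, ← D.sum_area_JO, ← D.sum_area_JS, Finset.mul_sum, Finset.mul_sum]
  refine add_le_add (Finset.sum_le_sum fun α hα => ?_) (Finset.sum_le_sum fun α hα => ?_)
  · have hr := D.isRadiosity_RO (u := fun β => u (D.iO β)) fun β => hu _
    have hR := hr.le D.area_zO_pos D.LamO_nonneg D.LamPh_nonneg D.sum_LamO_add_LamPh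
      (fun β => P.em_mem _ (hu _)) hK4 fun β => hs _
    have := incoming_le D.LamO_nonneg D.LamPh_nonneg D.sum_LamO_add_LamPh hK4 hR α
    rw [VO_eq]
    simp only [D.iO_eq_of_mem_JO hα]
    exact (mul_le_mul_of_nonneg_left this he).trans_eq (by ring)
  · have hsum : ∀ α, ∑ β, D.LamS α β + 0 = area (D.zS α) := fun α => by
      rw [add_zero]; exact D.sum_LamS α
    have hr := D.isRadiosity_RS (u := fun β => u (D.iS β)) fun β => hu _
    have hR := hr.le D.area_zS_pos D.LamS_nonneg (fun _ => le_rfl) hsum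
      (fun β => P.em_mem _ (hu _)) hK4 fun β => hs _
    have := incoming_le D.LamS_nonneg (fun _ => le_rfl) hsum hK4 hR α
    rw [VS_eq]
    simp only [D.iS_eq_of_mem_JS hα]
    exact (mul_le_mul_of_nonneg_left this he).trans_eq (by ring)

lemma le_absorbed {u : I → ℝ} {k : ℝ} (hk : 0 ≤ k) (hext : k ≤ P.ext)
    (hku : ∀ j, k ≤ u j) (i : I) :
    P.sig * P.em (u i) * k ^ 4 * D.radArea i ≤ D.absorbed u i := by
  have hσ := P.sig_pos.le
  have hu : ∀ j, 0 ≤ u j := fun j => hk.trans (hku j)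
  have hK4 : P.sig * k ^ 4 ≤ P.sig * P.ext ^ 4 := by gcongr
  have hs : ∀ j, P.sig * k ^ 4 ≤ P.sig * u j ^ 4 := fun j => by
    gcongr
    exact hku j
  have he := (P.em_mem (u i) (hu i)).1.le
  rw [absorbed, radArea, mul_add, ← D.sum_area_JO, ← D.sum_area_JS, Finset.mul_sum, Finset.mul_sum]
  refine add_le_add (Finset.sum_le_sum fun α hα => ?_) (Finset.sum_le_sum fun α hα => ?_)
  · have hr := D.isRadiosity_RO (u := fun β => u (D.iO β)) fun β => hu _
    have hR := hr.ge D.area_zO_pos D.LamO_nonneg D.LamPh_nonneg D.sum_LamO_add_LamPh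
      (fun β => P.em_mem _ (hu _)) hK4 fun β => hs _
    have := le_incoming D.LamO_nonneg D.LamPh_nonneg D.sum_LamO_add_LamPh hK4 hR α
    rw [VO_eq]
    simp only [D.iO_eq_of_mem_JO hα]
    exact (mul_le_mul_of_nonneg_left this he).trans_eq' (by ring)
  · have hsum : ∀ α, ∑ β, D.LamS α β + 0 = area (D.zS α) := fun α => by
      rw [add_zero]; exact D.sum_LamS α
    have hr := D.isRadiosity_RS (u := fun β => u (D.iS β)) fun β => hu _
    have hR := hr.ge D.area_zS_pos D.LamS_nonneg (fun _ => le_rfl) hsum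
      (fun β => P.em_mem _ (hu _)) hK4 fun β => hs _
    have := le_incoming D.LamS_nonneg (fun _ => le_rfl) hsum hK4 hR α
    rw [VS_eq]
    simp only [D.iS_eq_of_mem_JS hα]
    exact (mul_le_mul_of_nonneg_left this he).trans_eq' (by ring)

lemma abs_absorbed_sub_le {r δ : ℝ} {u v : I → ℝ} (hu : ∀ j, u j ∈ Icc 0 r)
    (hv : ∀ j, v j ∈ Icc 0 r) (huv : ∀ j, |u j - v j| ≤ δ) (i : I) :
    |D.absorbed u i - D.absorbed v i| ≤ P.sig * P.lg2 r * D.radArea i * δ := by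
  have hr : 0 ≤ r := (hu i).1.trans (hu i).2
  have hδ : 0 ≤ δ := (abs_nonneg _).trans (huv i)
  have hσ := P.sig_pos.le
  have hm := P.minOn_pos hr
  have hL := P.lipConst_nonneg (r := r)
  set K := P.sig * max (r ^ 4) (P.ext ^ 4) with hK
  have hK4 : P.sig * P.ext ^ 4 ≤ K := mul_le_mul_of_nonneg_left (le_max_right _ _) hσ
  have hs : ∀ j, P.sig * v j ^ 4 ≤ K := fun j =>
    mul_le_mul_of_nonneg_left ((pow_le_pow_left₀ (hv j).1 (hv j).2 4).trans (le_max_left _ _)) hσ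
  have hq0 : 0 ≤ P.sig * P.ext ^ 4 := by have := P.ext_pos; positivity
  have hs0 : ∀ j, 0 ≤ P.sig * v j ^ 4 := fun j => by positivity
  have hℓ : ∀ j, |P.em (u j) - P.em (v j)| ≤ lipConst P.em r * δ := fun j =>
    (P.abs_em_sub_le (hu j) (hv j)).trans (mul_le_mul_of_nonneg_left (huv j) hL)
  have hd : ∀ j, |P.sig * u j ^ 4 - P.sig * v j ^ 4| ≤ P.sig * (4 * r ^ 3 * δ) := fun j => by
    rw [← mul_sub, abs_mul, abs_of_nonneg hσ]
    exact mul_le_mul_of_nonneg_left ((Problem.abs_pow_four_sub_le (hu j) (hv j)).trans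
      (mul_le_mul_of_nonneg_left (huv j) (by positivity))) hσ
  -- The radiosity estimate is sharper than l²: the latter has 4r³ multiplied by 1/ε_min ≥ 1 and one
  -- spare term with 1/ε_min.
  have hfac : lipConst P.em r * δ * K / minOn P.em r + P.sig * (4 * r ^ 3 * δ) +
      lipConst P.em r * δ * K ≤ P.sig * P.lg2 r * δ := by
    have h1 : 1 ≤ (minOn P.em r)⁻¹ := (one_le_inv₀ hm).2 (P.minOn_le_one hr)
    have h2 : 0 ≤ P.sig * (4 * r ^ 3 * δ) * ((minOn P.em r)⁻¹ - 1) :=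
      mul_nonneg (by positivity) (sub_nonneg.2 h1)
    have h3 : 0 ≤ lipConst P.em r * δ * K * (minOn P.em r)⁻¹ :=
      mul_nonneg (mul_nonneg (mul_nonneg hL hδ) (hq0.trans hK4)) (by linarith)
    rw [Problem.lg2, div_eq_mul_inv]
    rw [hK] at h3 ⊢
    linarith
  rw [absorbed, absorbed, add_sub_add_comm, ← Finset.sum_sub_distrib, ← Finset.sum_sub_distrib,
    radArea, mul_add, add_mul, mul_right_comm (P.sig * P.lg2 r) _ δ,
    mul_right_comm (P.sig * P.lg2 r) _ δ, ← D.sum_area_JO, ← D.sum_area_JS,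
    Finset.mul_sum, Finset.mul_sum]
  refine (abs_add_le _ _).trans (add_le_add ?_ ?_)
  · refine (Finset.abs_sum_le_sum_abs _ _).trans (Finset.sum_le_sum fun α _ => ?_)
    rw [VO_eq, VO_eq]
    refine ((D.isRadiosity_RO fun β => (hu (D.iO β)).1).abs_sub_le
      (D.isRadiosity_RO fun β => (hv (D.iO β)).1) D.area_zO_pos D.LamO_nonneg D.LamPh_nonneg
      D.sum_LamO_add_LamPh (fun β => P.em_mem _ (hu _).1) (fun β => P.em_mem _ (hv _).1) hm
      (fun β => P.minOn_le (hu _)) hq0 hK4 (fun β => hs0 _) (fun β => hs _) (fun β => hℓ _)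
      (fun β => hd _) α).trans (mul_le_mul_of_nonneg_right hfac measureReal_nonneg)
  · refine (Finset.abs_sum_le_sum_abs _ _).trans (Finset.sum_le_sum fun α _ => ?_)
    rw [VS_eq, VS_eq]
    refine ((D.isRadiosity_RS fun β => (hu (D.iS β)).1).abs_sub_le
      (D.isRadiosity_RS fun β => (hv (D.iS β)).1) D.area_zS_pos D.LamS_nonneg (fun _ => le_rfl)
      (fun α => by rw [add_zero]; exact D.sum_LamS α)
      (fun β => P.em_mem _ (hu _).1) (fun β => P.em_mem _ (hv _).1) hm
      (fun β => P.minOn_le (hu _)) hq0 hK4 (fun β => hs0 _) (fun β => hs _) (fun β => hℓ _)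
      (fun β => hd _) α).trans (mul_le_mul_of_nonneg_right hfac measureReal_nonneg)

end SpaceGrid

/-! ### The data of the scheme -/

namespace Problem

variable (P : Problem)

lemma lg2_nonneg {r : ℝ} (hr : 0 ≤ r) : 0 ≤ P.lg2 r := by
  have := P.minOn_pos hr
  have := P.lipConst_nonneg (r := r)
  rw [lg2]
  positivity

lemma fNorm_nonneg (m : Phase) (a b : ℝ) (A : Set E3) : 0 ≤ P.fNorm m a b A :=
  ENNReal.toReal_nonneg

lemma fNorm_mono (m : Phase) {a b a' b' : ℝ} {A A' : Set E3} (h0 : 0 ≤ a') (ha : a' ≤ a)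
    (hb : b ≤ b') (hT : b' ≤ P.T) (hA : A ⊆ A') (hA' : A' ⊆ P.dom m) :
    P.fNorm m a b A ≤ P.fNorm m a' b' A' := by
  refine ENNReal.toReal_mono (ne_top_of_le_ne_top (P.f_memLp m).2.ne
    (eLpNorm_mono_measure _ (Measure.restrict_mono ?_ le_rfl)))
    (eLpNorm_mono_measure _ (Measure.restrict_mono ?_ le_rfl))
  · exact prod_mono (Ioo_subset_Ioo h0 hT) hA'
  · exact prod_mono (Ioo_subset_Ioo ha hb) hA

/-- The sum of the norms of the heat sources up to the time `s`. -/
def sourceNorm (s : ℝ) : ℝ := P.fNorm .solid 0 s (P.dom .solid) + P.fNorm .gas 0 s (P.dom .gas)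

lemma sourceNorm_nonneg (s : ℝ) : 0 ≤ P.sourceNorm s :=
  add_nonneg (P.fNorm_nonneg _ _ _ _) (P.fNorm_nonneg _ _ _ _)

lemma sourceNorm_mono {s t : ℝ} (hst : s ≤ t) (ht : t ≤ P.T) : P.sourceNorm s ≤ P.sourceNorm t :=
  add_le_add (P.fNorm_mono _ le_rfl le_rfl hst ht le_rfl le_rfl)
    (P.fNorm_mono _ le_rfl le_rfl hst ht le_rfl le_rfl)

/-- The source norm is nondecreasing in time, so replacing it by its value at t on [0, s] leaves
room for the increment of one step. -/
lemma upper_add_le {s t : ℝ} (hs : 0 ≤ s) (hst : s ≤ t) (ht : t ≤ P.T) :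
    P.upper s + (t - s) / P.C * P.sourceNorm t ≤ P.upper t := by
  have h : s / P.C * P.sourceNorm s ≤ s / P.C * P.sourceNorm t :=
    mul_le_mul_of_nonneg_left (P.sourceNorm_mono hst ht) (div_nonneg hs P.C_pos.le)
  change _ + s / P.C * P.sourceNorm s + _ ≤ _ + t / P.C * P.sourceNorm t
  rw [sub_div, sub_mul]
  linarith

lemma upper_mono {s t : ℝ} (hs : 0 ≤ s) (hst : s ≤ t) (ht : t ≤ P.T) : P.upper s ≤ P.upper t :=
  le_trans (le_add_of_nonneg_right (mul_nonneg (div_nonneg (sub_nonneg.2 hst) P.C_pos.le)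
    (P.sourceNorm_nonneg t))) (P.upper_add_le hs hst ht)

lemma ext_le_upper {s : ℝ} (hs : 0 ≤ s) : P.ext ≤ P.upper s :=
  (le_max_left _ _).trans (le_add_of_nonneg_right
    (mul_nonneg (div_nonneg hs P.C_pos.le) (P.sourceNorm_nonneg s)))

lemma upper_nonneg {s : ℝ} (hs : 0 ≤ s) : 0 ≤ P.upper s := P.ext_pos.le.trans (P.ext_le_upper hs)

lemma initNorm_mono {A : Set E3} (hA : A ⊆ P.Om) : P.initNorm A ≤ P.initNorm P.Om :=
  ENNReal.toReal_mono P.init_memLp.2.ne (eLpNorm_mono_measure _ (Measure.restrict_mono hA le_rfl))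

lemma essInf_init_mono {A : Set E3} (hA : A ⊆ P.Om) (hA0 : volume A ≠ 0) :
    essInf P.init (volume.restrict P.Om) ≤ essInf P.init (volume.restrict A) := by
  have hle : volume.restrict A ≤ volume.restrict P.Om := Measure.restrict_mono hA le_rfl
  -- On a null set the essential infimum would be a default value and monotonicity could fail.
  have : (ae (volume.restrict A)).NeBot := ae_neBot.2 (by rwa [Ne, Measure.restrict_eq_zero])
  have hbdd : ∀ᵐ x ∂volume.restrict P.Om, P.init x ≤ P.initNorm P.Om := by
    filter_upwards [ae_le_eLpNormEssSup (f := P.init) (μ := volume.restrict P.Om)] with x hx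
    have h := ENNReal.toReal_mono P.init_memLp.2.ne (hx.trans_eq eLpNorm_exponent_top.symm)
    exact (le_abs_self _).trans (by simpa [Problem.initNorm] using h)
  refine Filter.liminf_le_liminf_of_le (ae_mono hle) ?_ ?_
  · exact ⟨0, Filter.eventually_map.2 (P.init_pos.mono fun x hx => hx.le)⟩
  · have h : ∀ᵐ x ∂volume.restrict A, P.init x ≤ P.initNorm P.Om := ae_mono hle hbdd
    exact Filter.IsBoundedUnder.isCoboundedUnder_ge ⟨_, Filter.eventually_map.2 h⟩

end Problem

/-! ### The scheme -/

namespace SpaceGrid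

variable {P : Problem} {I IG IS : Type*} (D : SpaceGrid P I IG IS)

/-- The internal energy of a control volume at the temperature `s`. -/
def energy (i : I) (s : ℝ) : ℝ :=
  P.en .solid s * vol (D.cvp .solid i) + P.en .gas s * vol (D.cvp .gas i)

lemma energy_growth (i : I) {s t : ℝ} (hs : 0 ≤ s) (hst : s ≤ t) :
    P.C * vol (D.cv i) * (t - s) ≤ D.energy i t - D.energy i s := by
  have h1 := mul_le_mul_of_nonneg_right (P.en_growth .solid s t hs hst)
    (D.vol_cvp_nonneg .solid i)
  have h2 := mul_le_mul_of_nonneg_right (P.en_growth .gas s t hs hst) (D.vol_cvp_nonneg .gas i)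
  rw [← D.vol_cvp_add, energy, energy]
  linarith

lemma continuousOn_energy (i : I) : ContinuousOn (D.energy i) (Ici 0) :=
  ((P.en_continuous .solid).mul continuousOn_const).add
    ((P.en_continuous .gas).mul continuousOn_const)

open Classical in
/-- The transmissivity between two control volumes within one phase. -/
def transmissivity [Fintype I] (m : Phase) (i j : I) : ℝ :=
  if j ∈ D.nb m i then
    area (frontier (D.cvp m i) ∩ frontier (D.cvp m j)) / ‖D.x i - D.x j‖ else 0

/-- The heat conduction coefficient between two control volumes. -/
def conduct [Fintype I] (i j : I) : ℝ :=
  P.kap .solid * D.transmissivity .solid i j + P.kap .gas * D.transmissivity .gas i j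

lemma transmissivity_nonneg [Fintype I] (m : Phase) (i j : I) : 0 ≤ D.transmissivity m i j := by
  rw [transmissivity]
  split_ifs
  · exact div_nonneg measureReal_nonneg (norm_nonneg _)
  · exact le_rfl

lemma conduct_nonneg [Fintype I] (i j : I) : 0 ≤ D.conduct i j :=
  add_nonneg (mul_nonneg (P.kap_nonneg _) (D.transmissivity_nonneg _ _ _))
    (mul_nonneg (P.kap_nonneg _) (D.transmissivity_nonneg _ _ _))

lemma sum_nb_eq [Fintype I] (m : Phase) (u : I → ℝ) (i : I) :
    ∑ j ∈ D.nb m i,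
        (u j - u i) / ‖D.x i - D.x j‖ * area (frontier (D.cvp m i) ∩ frontier (D.cvp m j)) =
      -∑ j, D.transmissivity m i j * (u i - u j) := by
  classical
  simp only [transmissivity, ite_mul, zero_mul]
  rw [← Finset.sum_filter, Finset.filter_univ_mem, ← Finset.sum_neg_distrib]
  exact Finset.sum_congr rfl fun j _ => by ring

lemma bddAbove_range_div [Finite I] (a : I → ℝ) : BddAbove (range fun i => a i / vol (D.cv i)) :=
  (finite_range _).bddAbove

lemma mul_area_le [Finite I] (a : I → ℝ) (i : I) :
    P.sig * a i ≤ (P.sig * ⨆ j, a j / vol (D.cv j)) * vol (D.cv i) := by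
  have h := le_ciSup (D.bddAbove_range_div a) i
  rw [div_le_iff₀ (D.vol_cv_pos i)] at h
  rw [mul_assoc]
  exact mul_le_mul_of_nonneg_left h P.sig_pos.le

lemma mul_iSup_nonneg {a : I → ℝ} (ha : ∀ i, 0 ≤ a i) :
    0 ≤ P.sig * ⨆ j, a j / vol (D.cv j) :=
  mul_nonneg P.sig_pos.le (Real.iSup_nonneg fun i => div_nonneg (ha i) (D.vol_cv_pos i).le)

lemma LVcav_nonneg : 0 ≤ D.LVcav := D.mul_iSup_nonneg fun _ => measureReal_nonneg

lemma LVout_nonneg : 0 ≤ D.LVout := D.mul_iSup_nonneg fun _ => measureReal_nonneg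

lemma LVsig_nonneg : 0 ≤ D.LVsig := D.mul_iSup_nonneg fun _ => measureReal_nonneg

lemma radArea_le [Finite I] (i : I) :
    P.sig * D.radArea i ≤ (D.LVcav + D.LVsig) * vol (D.cv i) := by
  have h1 := D.mul_area_le (fun i => area (frontier (D.cvp .solid i) ∩ P.GamOm)) i
  have h2 := D.mul_area_le (fun i => area (D.cv i ∩ P.Sig)) i
  rw [radArea, mul_add, add_mul]
  exact add_le_add h1 h2

lemma outArea_le [Finite I] (i : I) : P.sig * D.outArea i ≤ D.LVout * vol (D.cv i) :=
  D.mul_area_le _ i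

/-- The step factor controls the growth of the radiation terms of a control volume. -/
lemma radiation_slope_le [Finite I] {r : ℝ} (hr : 0 ≤ r) (i : I) :
    P.sig * (lipConst P.em r * r ^ 4 + P.lg2 r) * D.radArea i +
        P.sig * (lipConst P.em r * (r ^ 4 + P.ext ^ 4)) * D.outArea i ≤
      D.stepFactor r * vol (D.cv i) := by
  have hL := P.lipConst_nonneg (r := r)
  have hV := (D.vol_cv_pos i).le
  have h0 : 0 ≤ lipConst P.em r * r ^ 4 := by positivity
  -- Since u⁴ is increasing, the slope estimate costs only this part of l¹.
  have h1 : lipConst P.em r * r ^ 4 ≤ P.lg1 r :=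
    le_add_of_nonneg_left (by have := P.negVar_nonneg (r := r); positivity)
  have h2 := P.lg2_nonneg hr
  have h3 : lipConst P.em r * (r ^ 4 + P.ext ^ 4) ≤ P.lg1 r + P.lg3 r := by
    rw [Problem.lg3]; linarith
  have h4 : 0 ≤ P.lg1 r + P.lg3 r := le_trans (by have := P.ext_pos; positivity) h3
  have e1 : P.sig * D.radArea i * (lipConst P.em r * r ^ 4 + P.lg2 r) ≤
      (D.LVcav + D.LVsig) * vol (D.cv i) * (P.lg1 r + P.lg2 r) :=
    mul_le_mul (D.radArea_le i) (by linarith) (add_nonneg h0 h2)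
      (mul_nonneg (add_nonneg D.LVcav_nonneg D.LVsig_nonneg) hV)
  have e2 : P.sig * D.outArea i * (lipConst P.em r * (r ^ 4 + P.ext ^ 4)) ≤
      D.LVout * vol (D.cv i) * (P.lg1 r + P.lg3 r) :=
    mul_le_mul (D.outArea_le i) h3 (by have := P.ext_pos; positivity)
      (mul_nonneg D.LVout_nonneg hV)
  rw [stepFactor]
  linarith

lemma stepFactor_nonneg {r : ℝ} (hr : 0 ≤ r) : 0 ≤ D.stepFactor r := by
  have := D.LVcav_nonneg
  have := D.LVout_nonneg
  have := D.LVsig_nonneg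
  have := P.lipConst_nonneg (r := r)
  have := P.negVar_nonneg (r := r)
  have := P.lg2_nonneg hr
  have := P.ext_pos
  rw [stepFactor, Problem.lg1, Problem.lg3]
  positivity

lemma stepFactor_mono {r r' : ℝ} (hr : 0 ≤ r) (h : r ≤ r') : D.stepFactor r ≤ D.stepFactor r' := by
  have hr' := hr.trans h
  have hL := P.lipConst_nonneg (r := r)
  have hL' := P.lipConst_mono hr' h
  have hL'' := P.lipConst_nonneg (r := r')
  have hN := P.negVar_nonneg (r := r)
  have hN' := P.negVar_mono h
  have hN'' := P.negVar_nonneg (r := r')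
  have hm := P.minOn_pos hr
  have hm' := P.minOn_pos hr'
  have hinv : (minOn P.em r)⁻¹ ≤ (minOn P.em r')⁻¹ := inv_anti₀ hm' (P.minOn_anti hr h)
  have hext := P.ext_pos
  have h1 : P.lg1 r ≤ P.lg1 r' := by unfold Problem.lg1; gcongr
  have h2 : P.lg2 r ≤ P.lg2 r' := by unfold Problem.lg2; gcongr
  have h3 : P.lg3 r ≤ P.lg3 r' := by unfold Problem.lg3; gcongr
  have := D.LVcav_nonneg
  have := D.LVout_nonneg
  have := D.LVsig_nonneg
  unfold stepFactor
  gcongr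

end SpaceGrid

section TimeGrid

variable {T : ℝ} {N : ℕ} (τ : TimeGrid T N)

lemma TimeGrid.t_nonneg (ν : Fin (N + 1)) : 0 ≤ τ.t ν :=
  τ.t_zero.symm.trans_le (τ.strictMono.monotone (Fin.zero_le ν))

lemma TimeGrid.t_le (ν : Fin (N + 1)) : τ.t ν ≤ T :=
  (τ.strictMono.monotone (Fin.le_last ν)).trans_eq τ.t_last

lemma TimeGrid.k_pos (ν : Fin N) : 0 < τ.k ν :=
  sub_pos.2 (τ.strictMono Fin.castSucc_lt_succ)

end TimeGrid

/-- A recursion along `Fin (N + 1)` that keeps an invariant. -/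
lemma exists_fin_sequence {X : Type*} {N : ℕ} {Q : Fin (N + 1) → X → Prop}
    {R : Fin N → X → X → Prop} {x₀ : X} (h0 : Q 0 x₀)
    (hstep : ∀ ν x, Q ν.castSucc x → ∃ y, Q ν.succ y ∧ R ν x y) :
    ∃ u : Fin (N + 1) → X, u 0 = x₀ ∧ (∀ ν, Q ν (u ν)) ∧
      ∀ ν : Fin N, R ν (u ν.castSucc) (u ν.succ) := by
  choose! F hF using hstep
  let u : ∀ ν : Fin (N + 1), {x // Q ν x} :=
    Fin.induction ⟨x₀, h0⟩ fun ν x => ⟨F ν x.1, (hF ν x.1 x.2).1⟩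
  refine ⟨fun ν => (u ν).1, rfl, fun ν => (u ν).2, fun ν => ?_⟩
  have h : u ν.succ = ⟨F ν (u ν.castSucc).1, (hF ν _ (u ν.castSucc).2).1⟩ :=
    Fin.induction_succ _ _ _
  simp only [h]
  exact (hF ν _ (u ν.castSucc).2).2

section Scheme

variable {P : Problem} {I IG IS : Type*} {D : SpaceGrid P I IG IS} {N : ℕ} {τ : TimeGrid P.T N}
  (A : Approximation D τ)

/-- The heat source in a control volume. -/
def Approximation.source (ν : Fin N) (i : I) : ℝ :=
  A.f .solid ν i * vol (D.cvp .solid i) + A.f .gas ν i * vol (D.cvp .gas i)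

lemma Approximation.f_mul_vol_nonneg (m : Phase) (ν : Fin N) (i : I) :
    0 ≤ A.f m ν i * vol (D.cvp m i) := by
  by_cases h : (D.cvp m i).Nonempty
  · exact mul_nonneg ((A.f_nonneg m ν i h).trans (A.f_lower m ν i h)) (D.vol_cvp_nonneg m i)
  · rw [D.vol_cvp_of_empty h, mul_zero]

lemma Approximation.f_mul_vol_le (m : Phase) (ν : Fin N) (i : I) :
    A.f m ν i * vol (D.cvp m i) ≤ P.fNorm m 0 (τ.t ν.succ) (P.dom m) * vol (D.cv i) := by
  by_cases h : (D.cvp m i).Nonempty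
  · refine mul_le_mul ((A.f_upper m ν i h).trans (P.fNorm_mono m le_rfl (τ.t_nonneg _) le_rfl
      (τ.t_le _) inter_subset_right le_rfl)) ?_ (D.vol_cvp_nonneg m i) (P.fNorm_nonneg _ _ _ _)
    have h1 := D.vol_cvp_add i
    have h2 := D.vol_cvp_nonneg .solid i
    have h3 := D.vol_cvp_nonneg .gas i
    cases m <;> linarith
  · rw [D.vol_cvp_of_empty h, mul_zero]
    exact mul_nonneg (P.fNorm_nonneg _ _ _ _) (D.vol_cv_pos i).le

lemma Approximation.source_nonneg (ν : Fin N) (i : I) : 0 ≤ A.source ν i :=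
  add_nonneg (A.f_mul_vol_nonneg _ ν i) (A.f_mul_vol_nonneg _ ν i)

lemma Approximation.source_le (ν : Fin N) (i : I) :
    A.source ν i ≤ P.sourceNorm (τ.t ν.succ) * vol (D.cv i) := by
  rw [Problem.sourceNorm, add_mul]
  exact add_le_add (A.f_mul_vol_le _ ν i) (A.f_mul_vol_le _ ν i)

lemma Approximation.lower_le_init (i : I) : P.lower ≤ A.init i :=
  (min_le_right _ _).trans ((P.essInf_init_mono (D.cv_subset i) fun h => by
    have := D.vol_cv_pos i
    rw [vol, measureReal_def, h] at this
    exact lt_irrefl _ this).trans (A.init_lower i))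

lemma Approximation.init_le (i : I) : A.init i ≤ max P.ext (P.initNorm P.Om) :=
  (A.init_upper i).trans ((P.initNorm_mono (D.cv_subset i)).trans (le_max_right _ _))

/-- The terms of the scheme that depend on the temperature in one control volume only. -/
def localTerm (D : SpaceGrid P I IG IS) (k : ℝ) (i : I) (s : ℝ) : ℝ :=
  k⁻¹ * D.energy i s + P.sig * (P.em s * s ^ 4) * D.radArea i +
    P.sig * (P.em s * (s ^ 4 - P.ext ^ 4)) * D.outArea i

lemma continuousOn_localTerm {k M : ℝ} (i : I) : ContinuousOn (localTerm D k i) (Icc 0 M) := by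
  have h1 : ContinuousOn (D.energy i) (Icc 0 M) :=
    (D.continuousOn_energy i).mono fun s hs => hs.1
  have h2 := P.continuousOn_em (r := M)
  unfold localTerm
  fun_prop

/-- The growth of the internal energy supplies the positive slope, and `em_mul_sub_ge` with q = 0
and q = θ_ext⁴ bounds the loss through the two kinds of emission. -/
lemma localTerm_slope {k M : ℝ} (hk : 0 < k) (i : I) {s t : ℝ} (ht : 0 ≤ t) (hts : t ≤ s)
    (hsM : s ≤ M) :
    (k⁻¹ * (P.C * vol (D.cv i)) - (P.sig * (lipConst P.em M * M ^ 4) * D.radArea i +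
        P.sig * (lipConst P.em M * (M ^ 4 + P.ext ^ 4)) * D.outArea i)) * (s - t) ≤
      localTerm D k i s - localTerm D k i t := by
  have h1 := mul_le_mul_of_nonneg_left (D.energy_growth i ht hts) (inv_pos.2 hk).le
  have h2 := mul_le_mul_of_nonneg_left (P.em_mul_sub_ge le_rfl ht hts hsM)
    (mul_nonneg P.sig_pos.le (D.radArea_nonneg i))
  have h3 := mul_le_mul_of_nonneg_left
    (P.em_mul_sub_ge (pow_nonneg P.ext_pos.le 4) ht hts hsM)
    (mul_nonneg P.sig_pos.le (D.outArea_nonneg i))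
  simp only [sub_zero, add_zero] at h2
  rw [localTerm, localTerm]
  linarith

lemma step_condition_of_iSup
    (h : (⨆ ν : Fin N, τ.k ν) * D.stepFactor (P.upper (τ.t (Fin.last N))) < P.C) (ν : Fin N) :
    τ.k ν * D.stepFactor (P.upper (τ.t ν.succ)) < P.C := by
  have h0 := P.upper_nonneg (τ.t_nonneg ν.succ)
  have hle : P.upper (τ.t ν.succ) ≤ P.upper (τ.t (Fin.last N)) :=
    P.upper_mono (τ.t_nonneg _) (τ.strictMono.monotone (Fin.le_last _)) (τ.t_le _)
  have hk : τ.k ν ≤ ⨆ ν : Fin N, τ.k ν := le_ciSup (finite_range _).bddAbove ν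
  exact (mul_le_mul hk (D.stepFactor_mono h0 hle) (D.stepFactor_nonneg h0)
    ((τ.k_pos ν).le.trans hk)).trans_lt h

variable [Fintype I] [Fintype IG] [Fintype IS]

/-- The form required by `existsUnique_in_box`: a term of u_i alone, a diffusive coupling, and a
right-hand side that depends on u only through absorption. -/
lemma schemeOp_eq (ν : Fin N) (v u : I → ℝ) (i : I) :
    schemeOp A ν v u i = localTerm D (τ.k ν) i (u i) + ∑ j, D.conduct i j * (u i - u j) -
      (D.absorbed u i + ((τ.k ν)⁻¹ * D.energy i (v i) + A.source ν i)) := by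
  simp only [schemeOp, phaseTerm, radiationTerm, D.sum_nb_eq, localTerm, SpaceGrid.energy,
    SpaceGrid.conduct, SpaceGrid.absorbed, Approximation.source, SpaceGrid.radArea,
    SpaceGrid.outArea, add_mul, Finset.sum_add_distrib, mul_assoc, ← Finset.mul_sum]
  ring

lemma schemeOp_eq_zero_iff (ν : Fin N) (v u : I → ℝ) (i : I) :
    schemeOp A ν v u i = 0 ↔ localTerm D (τ.k ν) i (u i) + ∑ j, D.conduct i j * (u i - u j) =
      D.absorbed u i + ((τ.k ν)⁻¹ * D.energy i (v i) + A.source ν i) := by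
  rw [schemeOp_eq, sub_eq_zero]

/-- At temperatures above the external one, the radiation terms dominate the absorbed radiation. -/
lemma energy_add_le_localTerm {u : I → ℝ} (hu : ∀ j, 0 ≤ u j) {i : I} (hext : P.ext ≤ u i)
    (hmax : ∀ j, u j ≤ u i) (k : ℝ) :
    k⁻¹ * D.energy i (u i) + D.absorbed u i ≤ localTerm D k i (u i) := by
  have h1 := D.absorbed_le hu hext hmax i
  have h2 : 0 ≤ P.sig * (P.em (u i) * (u i ^ 4 - P.ext ^ 4)) * D.outArea i :=
    mul_nonneg (mul_nonneg P.sig_pos.le (mul_nonneg (P.em_mem _ (hu i)).1.le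
      (sub_nonneg.2 (pow_le_pow_left₀ P.ext_pos.le hext 4)))) (D.outArea_nonneg i)
  rw [localTerm]
  linarith

/-- At temperatures below the external one, the absorbed radiation dominates the radiation
terms. -/
lemma localTerm_le_energy_add {u : I → ℝ} (hu : ∀ j, 0 ≤ u j) {i : I} (hext : u i ≤ P.ext)
    (hmin : ∀ j, u i ≤ u j) (k : ℝ) :
    localTerm D k i (u i) ≤ k⁻¹ * D.energy i (u i) + D.absorbed u i := by
  have h1 := D.le_absorbed (hu i) hext hmin i
  have h2 : 0 ≤ P.sig * (P.em (u i) * (P.ext ^ 4 - u i ^ 4)) * D.outArea i :=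
    mul_nonneg (mul_nonneg P.sig_pos.le (mul_nonneg (P.em_mem _ (hu i)).1.le
      (sub_nonneg.2 (pow_le_pow_left₀ (hu i) hext 4)))) (D.outArea_nonneg i)
  rw [localTerm]
  linarith

variable {A}

/-- The maximum principle for one time step. -/
lemma le_of_schemeOp_eq_zero {ν : Fin N} {v u : I → ℝ} (hv : ∀ i, 0 ≤ v i) (hu : ∀ i, 0 ≤ u i)
    (h : ∀ i, schemeOp A ν v u i = 0) {K : ℝ} (hext : P.ext ≤ K) (hvK : ∀ i, v i ≤ K) (i : I) :
    u i ≤ K + τ.k ν / P.C * P.sourceNorm (τ.t ν.succ) := by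
  have : Nonempty I := ⟨i⟩
  obtain ⟨j, hj⟩ := Finite.exists_max u
  refine (hj i).trans ?_
  have hk := τ.k_pos ν
  have hC := P.C_pos
  by_contra! hlt
  have h0 : 0 ≤ τ.k ν / P.C * P.sourceNorm (τ.t ν.succ) :=
    mul_nonneg (by positivity) (P.sourceNorm_nonneg _)
  have hKu : K < u j := by linarith
  have h1 := (schemeOp_eq_zero_iff A ν v u j).1 (h j)
  have h2 := energy_add_le_localTerm (D := D) hu (hext.trans hKu.le) hj (τ.k ν)
  have h3 : 0 ≤ ∑ l, D.conduct j l * (u j - u l) :=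
    Finset.sum_nonneg fun l _ => mul_nonneg (D.conduct_nonneg j l) (sub_nonneg.2 (hj l))
  have h4 := D.energy_growth j (hv j) ((hvK j).trans hKu.le)
  have h5 := A.source_le ν j
  -- At the maximum, conduction and net radiation only remove heat, so the energy gain is bounded by
  -- the source.
  have h6 : (τ.k ν)⁻¹ * (P.C * vol (D.cv j) * (u j - v j)) ≤
      P.sourceNorm (τ.t ν.succ) * vol (D.cv j) := by
    have := mul_le_mul_of_nonneg_left h4 (inv_pos.2 hk).le
    linarith
  rw [inv_mul_le_iff₀ hk] at h6
  have h7 : (P.C * (u j - v j)) * vol (D.cv j) ≤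
      (τ.k ν * P.sourceNorm (τ.t ν.succ)) * vol (D.cv j) := by linarith
  have h8 := le_of_mul_le_mul_right h7 (D.vol_cv_pos j)
  rw [div_mul_eq_mul_div] at hlt
  have h9 : τ.k ν * P.sourceNorm (τ.t ν.succ) / P.C < u j - v j := by linarith [hvK j]
  rw [div_lt_iff₀ hC] at h9
  linarith

/-- The minimum principle for one time step. -/
lemma ge_of_schemeOp_eq_zero {ν : Fin N} {v u : I → ℝ} (hu : ∀ i, 0 ≤ u i)
    (h : ∀ i, schemeOp A ν v u i = 0) {K : ℝ} (hext : K ≤ P.ext) (hvK : ∀ i, K ≤ v i) (i : I) :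
    K ≤ u i := by
  have : Nonempty I := ⟨i⟩
  obtain ⟨j, hj⟩ := Finite.exists_min u
  refine le_trans ?_ (hj i)
  have hk := τ.k_pos ν
  by_contra! hlt
  have h1 := (schemeOp_eq_zero_iff A ν v u j).1 (h j)
  have h2 := localTerm_le_energy_add (D := D) hu (hlt.le.trans hext) hj (τ.k ν)
  have h3 : ∑ l, D.conduct j l * (u j - u l) ≤ 0 :=
    Finset.sum_nonpos fun l _ => mul_nonpos_of_nonneg_of_nonpos (D.conduct_nonneg j l)
      (sub_nonpos.2 (hj l))
  have h4 := D.energy_growth j (hu j) (hlt.le.trans (hvK j))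
  have h5 := A.source_nonneg ν j
  have h6 : 0 < P.C * vol (D.cv j) * (v j - u j) :=
    mul_pos (mul_pos P.C_pos (D.vol_cv_pos j)) (sub_pos.2 (hlt.trans_le (hvK j)))
  have h7 := mul_pos (inv_pos.2 hk) (h6.trans_le h4)
  linarith

/-- One time step of the scheme has a unique nonnegative solution. -/
lemma existsUnique_step (A : Approximation D τ) {ν : Fin N}
    (hstep : τ.k ν * D.stepFactor (P.upper (τ.t ν.succ)) < P.C) {v : I → ℝ}
    (hv : ∀ i, v i ∈ Icc 0 (P.upper (τ.t ν.castSucc))) :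
    ∃! u : I → ℝ, (∀ i, 0 ≤ u i) ∧ ∀ i, schemeOp A ν v u i = 0 := by
  set M := P.upper (τ.t ν.succ) with hMdef
  have hk := τ.k_pos ν
  have hM : 0 ≤ M := P.upper_nonneg (τ.t_nonneg _)
  have hextM : P.ext ≤ M := P.ext_le_upper (τ.t_nonneg _)
  have hMadd : P.upper (τ.t ν.castSucc) + τ.k ν / P.C * P.sourceNorm (τ.t ν.succ) ≤ M :=
    P.upper_add_le (τ.t_nonneg _) (sub_nonneg.1 hk.le) (τ.t_le _)
  have hF0 := P.sourceNorm_nonneg (τ.t ν.succ)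
  have hvM : ∀ i, v i + τ.k ν / P.C * P.sourceNorm (τ.t ν.succ) ≤ M := fun i =>
    (add_le_add_left (hv i).2 _).trans hMadd
  obtain ⟨u, ⟨hu, huz⟩, huniq⟩ := existsUnique_in_box hM (B := localTerm D (τ.k ν))
    (W := fun i u => D.absorbed u i + ((τ.k ν)⁻¹ * D.energy i (v i) + A.source ν i))
    (c := D.conduct)
    (b := fun i => (τ.k ν)⁻¹ * (P.C * vol (D.cv i)) -
      (P.sig * (lipConst P.em M * M ^ 4) * D.radArea i +
        P.sig * (lipConst P.em M * (M ^ 4 + P.ext ^ 4)) * D.outArea i))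
    (g := fun i => P.sig * P.lg2 M * D.radArea i)
    continuousOn_localTerm (fun i s t => localTerm_slope hk i) D.conduct_nonneg
    (fun i => mul_nonneg (mul_nonneg P.sig_pos.le (P.lg2_nonneg hM)) (D.radArea_nonneg i))
    -- The step-size condition is exactly what puts the Lipschitz constant of the absorption below
    -- the slope.
    (fun i => by
      have h1 := D.radiation_slope_le hM i
      have h2 : D.stepFactor M * vol (D.cv i) < (τ.k ν)⁻¹ * (P.C * vol (D.cv i)) := by
        rw [← mul_assoc]
        refine mul_lt_mul_of_pos_right ?_ (D.vol_cv_pos i)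
        rwa [lt_inv_mul_iff₀ hk]
      linarith)
    (fun i u w δ hu hw huw => by
      rw [add_sub_add_right_eq_sub]
      exact D.abs_absorbed_sub_le hu hw huw i)
    -- At the top of the box emission dominates absorption, and the increase from M_{ν-1} to M_ν
    -- leaves enough internal energy to take up the source.
    (fun i u hu hi => by
      have h1 := energy_add_le_localTerm (D := D) (fun j => (hu j).1) (hextM.trans_eq hi.symm)
        (fun j => (hu j).2.trans_eq hi.symm) (τ.k ν)
      rw [hi] at h1
      have h2 : A.source ν i ≤ (τ.k ν)⁻¹ * (D.energy i M - D.energy i (v i)) := by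
        refine (A.source_le ν i).trans ?_
        rw [le_inv_mul_iff₀ hk]
        have h3 : v i ≤ M := le_trans (le_add_of_nonneg_right
          (mul_nonneg (div_nonneg hk.le P.C_pos.le) hF0)) (hvM i)
        refine le_trans ?_ (D.energy_growth i (hv i).1 h3)
        have h4 := hvM i
        rw [div_mul_eq_mul_div, ← le_sub_iff_add_le', div_le_iff₀ P.C_pos] at h4
        have := mul_le_mul_of_nonneg_right h4 (D.vol_cv_pos i).le
        linarith
      linarith)
    (fun i u hu hi => by
      have h1 := localTerm_le_energy_add (D := D) (fun j => (hu j).1) (hi.trans_le P.ext_pos.le)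
        (fun j => hi.trans_le (hu j).1) (τ.k ν)
      rw [hi] at h1
      have h2 := D.energy_growth i le_rfl (hv i).1
      have h3 := mul_le_mul_of_nonneg_left ((mul_nonneg (mul_nonneg P.C_pos.le
        (D.vol_cv_pos i).le) (sub_nonneg.2 (hv i).1)).trans h2) (inv_pos.2 hk).le
      have h4 := A.source_nonneg ν i
      linarith)
  refine ⟨u, ⟨fun i => (hu i).1, fun i => (schemeOp_eq_zero_iff A ν v u i).2 (huz i)⟩, ?_⟩
  rintro w ⟨hw, hwz⟩
  refine huniq w ⟨fun i => ⟨hw i, ?_⟩, fun i => (schemeOp_eq_zero_iff A ν v w i).1 (hwz i)⟩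
  -- An arbitrary nonnegative solution of the step lies in the box by the a priori bound, so
  -- uniqueness in the box applies to it.
  exact (le_of_schemeOp_eq_zero (fun i => (hv i).1) hw hwz (P.ext_le_upper (τ.t_nonneg _))
    (fun i => (hv i).2) i).trans hMadd

lemma IsNonnegSolution.mem_Icc {u : Fin (N + 1) → I → ℝ} (h : IsNonnegSolution A u)
    (ν : Fin (N + 1)) : ∀ i, u ν i ∈ Icc P.lower (P.upper (τ.t ν)) := by
  obtain ⟨h0, hinit, hz⟩ := h
  induction ν using Fin.induction with
  | zero =>
    intro i
    rw [hinit]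
    refine ⟨A.lower_le_init i, (A.init_le i).trans (le_add_of_nonneg_right ?_)⟩
    exact mul_nonneg (div_nonneg (τ.t_nonneg _) P.C_pos.le) (P.sourceNorm_nonneg _)
  | succ ν ih =>
    intro i
    refine ⟨ge_of_schemeOp_eq_zero (h0 _) (hz ν) (min_le_left _ _) (fun j => (ih j).1) i,
      (le_of_schemeOp_eq_zero (h0 _) (h0 _) (hz ν) (P.ext_le_upper (τ.t_nonneg _))
        (fun j => (ih j).2) i).trans ?_⟩
    exact P.upper_add_le (τ.t_nonneg _) (sub_nonneg.1 (τ.k_pos ν).le) (τ.t_le _)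

theorem existsUnique_isNonnegSolution (A : Approximation D τ)
    (hstep : ∀ ν : Fin N, τ.k ν * D.stepFactor (P.upper (τ.t ν.succ)) < P.C) :
    ∃! u : Fin (N + 1) → I → ℝ, IsNonnegSolution A u := by
  obtain ⟨u, hu0, hu, hz⟩ := exists_fin_sequence (x₀ := A.init)
    (Q := fun ν w => ∀ i, w i ∈ Icc 0 (P.upper (τ.t ν)))
    (R := fun ν v w => ∀ i, schemeOp A ν v w i = 0)
    (fun i => ⟨(A.init_nonneg i).trans (A.init_lower i),
      (A.init_le i).trans (le_add_of_nonneg_right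
        (mul_nonneg (div_nonneg (τ.t_nonneg _) P.C_pos.le) (P.sourceNorm_nonneg _)))⟩)
    (fun ν v hv => by
      obtain ⟨w, ⟨hw, hwz⟩, -⟩ := existsUnique_step A (hstep ν) hv
      refine ⟨w, fun i => ⟨hw i, ?_⟩, hwz⟩
      exact (le_of_schemeOp_eq_zero (fun i => (hv i).1) hw hwz (P.ext_le_upper (τ.t_nonneg _))
        (fun i => (hv i).2) i).trans
        (P.upper_add_le (τ.t_nonneg _) (sub_nonneg.1 (τ.k_pos ν).le) (τ.t_le _)))
  refine ⟨u, ⟨fun ν i => (hu ν i).1, fun i => congrFun hu0 i, hz⟩, fun w hw => ?_⟩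
  -- Uniqueness propagates in time: equal states at one time level solve the same step.
  funext ν
  induction ν using Fin.induction with
  | zero => rw [hu0]; exact funext hw.2.1
  | succ ν ih =>
    refine (existsUnique_step A (hstep ν) (hu ν.castSucc)).unique ⟨hw.1 _, ?_⟩
      ⟨fun i => (hu _ i).1, hz ν⟩
    rw [← ih]
    exact hw.2.2 ν

end Scheme

end HeatFV

end

theorem corollary4p4 {I IG IS : Type*} [Fintype I] [Fintype IG] [Fintype IS] {N : ℕ}
    (P : HeatFV.Problem) (D : HeatFV.SpaceGrid P I IG IS) (τ : HeatFV.TimeGrid P.T N)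
    (A : HeatFV.Approximation D τ) :
    (∀ u : Fin (N + 1) → I → ℝ, HeatFV.IsNonnegSolution A u →
      ∀ ν i, u ν i ∈ Set.Icc P.lower (P.upper (τ.t ν))) ∧
    ((∀ ν : Fin N, τ.k ν * D.stepFactor (P.upper (τ.t ν.succ)) < P.C) →
      ∃! u : Fin (N + 1) → I → ℝ, HeatFV.IsNonnegSolution A u) ∧
    ((⨆ ν : Fin N, τ.k ν) * D.stepFactor (P.upper (τ.t (Fin.last N))) < P.C →
      ∀ ν : Fin N, τ.k ν * D.stepFactor (P.upper (τ.t ν.succ)) < P.C) := by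
  exact ⟨fun u hu ν => hu.mem_Icc ν, HeatFV.existsUnique_isNonnegSolution A,
    HeatFV.step_condition_of_iSup⟩
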